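/- Identify $\mathbb R^4$ with the quaternions $\mathbb H$, $S^4=P(\mathbb H^2)=\mathbb H\cup\{\infty\}$, and let $\mathrm{Sp}(1)$ (acting through $\mathrm{SO}(3)$) act by $x\mapsto gxg^{-1}$; its fixed set is the circle $S^1=\mathbb R\cup\{\infty\}$. The action is lifted to the bundle by the adjoint action on the fibres, so a connection form $A$ with values in the imaginary quaternions $\mathfrak{sp}(1)$ is invariant if $A_{gxg^{-1}}(gvg^{-1})=g\,A_x(v)\,g^{-1}$ for all unit $g$. Off the real axis write $x=t+rQ$ with $r>0$, $Q^2=-1$, put $z=t+ir$, and let $\mathcal H^2=\{r>0\}$ carry the metric $h=r^{-2}(dt^2+dr^2)$ with Hodge star $\star_h$ and the orientation $dt\wedge dr$. For a real one-form $a$ and a complex function $\Phi$ on $\mathcal H^2$ put $d_a\Phi=d\Phi+ia\Phi$, with $(1,0)$- and $(0,1)$-parts $\partial_a\Phi,\bar\partial_a\Phi$, and $F_a=i\,da$. Let $F_A=dA+A\wedge A$, $c_2(A)=-\frac1{4\pi^2}\int F_A\wedge F_A$, $c_1(a)=\frac i{2\pi}\int_{\mathcal H^2}F_a$, $\|F_A\|^2=\int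 -F_A\wedge\star F_A\in[0,\infty]$, with $|\xi|^2=\xi\bar\xi$ on $\mathfrak{sp}(1)$. 1. A one-form $A$ on $\mathbb R^4\setminus\mathbb R=S^4\setminus S^1$ is a smooth, $\mathfrak{sp}(1)$-valued, invariant connection form if and only if $$A=\tfrac12\bigl(Qa+\Phi_1\,dQ+\Phi_2\,Q\,dQ\bigr),\qquad \Phi=\Phi_1+i(\Phi_2+1),$$ for a smooth real one-form $a=a_t\,dt+a_r\,dr$ and a smooth function $\Phi$ on $\mathcal H^2$ (pulled back by $x\mapsto z$); the pair $(a,\Phi)$ is unique. 2. For every smooth pair $(a,\Phi)$ and the corresponding $A$ on $S^4\setminus S^1$: (i) $F_A=\star F_A$ if and only if the vortex equations $\bar\partial_a\Phi=0$, $\star_h iF_a=1-|\Phi|^2$ hold on $\mathcal H^2$; (ii) $F_A=-\star F_A$ if and only if the anti-vortex equations $\partial_a\Phi=0$, $\star_h iF_a=|\Phi|^2-1$ hold on $\mathcal H^2$; (iii) $\|F_A\|^2=\pi\bigl(\|F_a\|_h^2+2\|d_a\Phi\|_h^2+\|1-|\Phi|^2\|_h^2\bigr)$ as elements of $[0,\infty]$;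 (iv) if the integrals defining $c_2(A)$ and $c_1(a)$ converge absolutely and $i\bar\Phi\,d_a\Phi$ vanishes at infinity (its norm in the coordinate $w=(z-i)/(z+i)$ of the unit disc tends to $0$ as $|w|\to1$), then $c_2(A)=c_1(a)$. 3. Let a smooth $\mathrm{SO}(3)$-invariant connection on an $\mathrm{Sp}(1)$-bundle over all of $S^4$ be given, with the adjoint lift, i.e. invariant smooth connection forms in the two charts $x\mapsto(1:x)$, $y\mapsto(y:1)$ related by a transition function $u$ with $u(gxg^{-1})=g\,u(x)\,g^{-1}$. Then there is a smooth pair $(a,\Phi)$ on $\mathcal H^2$ such that its connection form $A$ in the first chart has the form in 1 off the real axis; the self-duality (resp. anti-self-duality) equation on $S^4$ is equivalent to the vortex (resp. anti-vortex) equations for $(a,\Phi)$; the identity (iii) holds; the integrals defining $c_2(A)$ and $c_1(a)$ converge absolutely, $i\bar\Phi\,d_a\Phi$ vanishes at infinity as in (iv), and $c_2(A)=c_1(a)$. -/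

import Mathlib

open scoped Quaternion ContDiff Topology

noncomputable section

namespace DimRed

/-! ### Connections on `ℝ⁴ = ℍ` with values in `sp(1)`, the imaginary quaternions -/

/-- The orthonormal basis `1, i, j, k` of `ℍ`, which is positively oriented. -/
def e : Fin 4 → ℍ[ℝ] := ![⟨1, 0, 0, 0⟩, ⟨0, 1, 0, 0⟩, ⟨0, 0, 1, 0⟩, ⟨0, 0, 0, 1⟩]

/-- The one-form `A` takes its values in the imaginary quaternions on `U`. -/
def IsImaginaryOn (A : ℍ[ℝ] → ℍ[ℝ] →L[ℝ] ℍ[ℝ]) (U : Set ℍ[ℝ]) : Prop :=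
  ∀ x ∈ U, ∀ v, (A x v).re = 0

/-- The curvature two-form `F_A = dA + A ∧ A` of the connection one-form `A`. -/
def curvature (A : ℍ[ℝ] → ℍ[ℝ] →L[ℝ] ℍ[ℝ]) (x v w : ℍ[ℝ]) : ℍ[ℝ] :=
  (fderiv ℝ A x v w - fderiv ℝ A x w v) + (A x v * A x w - A x w * A x v)

/-- The Hodge star on (quaternion valued) two-forms on oriented Euclidean `ℝ⁴`; as the Hodge star
is conformally invariant in the middle degree, it is also that of the round metric on `S⁴`. -/
def hodgeStar (α : ℍ[ℝ] → ℍ[ℝ] → ℍ[ℝ]) (v w : ℍ[ℝ]) : ℍ[ℝ] :=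
  (v.re * w.imI - v.imI * w.re) • α (e 2) (e 3)
    + (v.re * w.imJ - v.imJ * w.re) • α (e 3) (e 1)
    + (v.re * w.imK - v.imK * w.re) • α (e 1) (e 2)
    + (v.imJ * w.imK - v.imK * w.imJ) • α (e 0) (e 1)
    + (v.imK * w.imI - v.imI * w.imK) • α (e 0) (e 2)
    + (v.imI * w.imJ - v.imJ * w.imI) • α (e 0) (e 3)

/-- `F_A = ⋆ F_A` on `U`. -/
def IsSelfDualOn (A : ℍ[ℝ] → ℍ[ℝ] →L[ℝ] ℍ[ℝ]) (U : Set ℍ[ℝ]) : Prop :=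
  ∀ x ∈ U, ∀ v w, curvature A x v w = hodgeStar (curvature A x) v w

/-- `F_A = - ⋆ F_A` on `U`. -/
def IsAntiSelfDualOn (A : ℍ[ℝ] → ℍ[ℝ] →L[ℝ] ℍ[ℝ]) (U : Set ℍ[ℝ]) : Prop :=
  ∀ x ∈ U, ∀ v w, curvature A x v w = - hodgeStar (curvature A x) v w

/-- `|F_A|² = ∑_{μ < ν} |F_{μν}|²`, the coefficient of `- F_A ∧ ⋆ F_A`, with the standard metric
`|ξ|² = ξ ξ̄` on `sp(1)`. -/
def curvatureNormSq (A : ℍ[ℝ] → ℍ[ℝ] →L[ℝ] ℍ[ℝ]) (x : ℍ[ℝ]) : ℝ :=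
  ∑ μ : Fin 4, ∑ ν : Fin 4, if μ < ν then ‖curvature A x (e μ) (e ν)‖ ^ 2 else 0

/-- The coefficient of the four-form `F_A ∧ F_A` with respect to the volume form. It is real when
`A` is imaginary; the real part turns it into an element of `ℝ`. -/
def curvatureWedge (A : ℍ[ℝ] → ℍ[ℝ] →L[ℝ] ℍ[ℝ]) (x : ℍ[ℝ]) : ℝ :=
  let F : Fin 4 → Fin 4 → ℍ[ℝ] := fun μ ν => curvature A x (e μ) (e ν)
  (F 0 1 * F 2 3 + F 2 3 * F 0 1 - (F 0 2 * F 1 3 + F 1 3 * F 0 2)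
    + (F 0 3 * F 1 2 + F 1 2 * F 0 3)).re

/-- The point of `ℍ` with given Cartesian coordinates. -/
def ofCoord (p : EuclideanSpace ℝ (Fin 4)) : ℍ[ℝ] := ⟨p 0, p 1, p 2, p 3⟩

/-- The Yang-Mills action `‖F_A‖² = ∫ - F_A ∧ ⋆ F_A ∈ [0, ∞]`. The integrand is conformally
invariant, so the integral over `ℝ⁴` is the integral over `S⁴`. -/
def yangMills (A : ℍ[ℝ] → ℍ[ℝ] →L[ℝ] ℍ[ℝ]) : ENNReal :=
  ∫⁻ p : EuclideanSpace ℝ (Fin 4), ENNReal.ofReal (curvatureNormSq A (ofCoord p))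

/-- The integral of `F_A ∧ F_A` converges (absolutely). -/
def HasSecondChern (A : ℍ[ℝ] → ℍ[ℝ] →L[ℝ] ℍ[ℝ]) : Prop :=
  MeasureTheory.Integrable (fun p : EuclideanSpace ℝ (Fin 4) => curvatureWedge A (ofCoord p))

/-- `c₂(A) = - (1 / 4π²) ∫ F_A ∧ F_A`. -/
def secondChern (A : ℍ[ℝ] → ℍ[ℝ] →L[ℝ] ℍ[ℝ]) : ℝ :=
  - (1 / (4 * Real.pi ^ 2)) *
    ∫ p : EuclideanSpace ℝ (Fin 4), curvatureWedge A (ofCoord p)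

/-- Invariance on `U` under the action `x ↦ g x g⁻¹` of `Sp(1)` (that is, of `SO(3)`) on `ℍ`,
lifted to the Lie algebra bundle by the adjoint representation on the fibres. -/
def IsInvariantOn (A : ℍ[ℝ] → ℍ[ℝ] →L[ℝ] ℍ[ℝ]) (U : Set ℍ[ℝ]) : Prop :=
  ∀ g : ℍ[ℝ], ‖g‖ = 1 → ∀ x ∈ U, ∀ v, A (g * x * g⁻¹) (g * v * g⁻¹) = g * A x v * g⁻¹

/-! ### Connections on `S⁴` -/

/-- A smooth connection on an `Sp(1)`-bundle over `S⁴ = P(ℍ²)`, given in the two affine charts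
`x ↦ (1 : x)` and `y ↦ (y : 1)`, related by `y = x⁻¹` (which preserves the orientation), by its
connection forms `A₀`, `A₁` in trivializations over the charts and by the transition function `u`
of the bundle. -/
structure ConnectionS4 where
  A₀ : ℍ[ℝ] → ℍ[ℝ] →L[ℝ] ℍ[ℝ]
  A₁ : ℍ[ℝ] → ℍ[ℝ] →L[ℝ] ℍ[ℝ]
  u : ℍ[ℝ] → ℍ[ℝ]
  smooth₀ : ContDiff ℝ ∞ A₀
  smooth₁ : ContDiff ℝ ∞ A₁
  imaginary₀ : IsImaginaryOn A₀ Set.univ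
  imaginary₁ : IsImaginaryOn A₁ Set.univ
  smooth_u : ContDiffOn ℝ ∞ u {x | x ≠ 0}
  norm_u : ∀ x, x ≠ 0 → ‖u x‖ = 1
  glue : ∀ x, x ≠ 0 → ∀ v, A₁ x⁻¹ (fderiv ℝ (fun y : ℍ[ℝ] => y⁻¹) x v)
    = u x * A₀ x v * (u x)⁻¹ - fderiv ℝ u x v * (u x)⁻¹

namespace ConnectionS4

/-- Invariance under the action `(x : y) ↦ (g x g⁻¹ : g y g⁻¹)` of `Sp(1)` on `S⁴`, lifted to the
bundle by the adjoint action on the fibres: the transition function is equivariant, so that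
the lift is defined over all of `S⁴`, and the connection is invariant. -/
structure IsInvariant (C : ConnectionS4) : Prop where
  transition : ∀ g : ℍ[ℝ], ‖g‖ = 1 → ∀ x, x ≠ 0 → C.u (g * x * g⁻¹) = g * C.u x * g⁻¹
  form₀ : IsInvariantOn C.A₀ Set.univ
  form₁ : IsInvariantOn C.A₁ Set.univ

/-- The self-duality equation on all of `S⁴`. -/
def IsSelfDual (C : ConnectionS4) : Prop :=
  IsSelfDualOn C.A₀ Set.univ ∧ IsSelfDualOn C.A₁ Set.univ

/-- The anti-self-duality equation on all of `S⁴`. -/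
def IsAntiSelfDual (C : ConnectionS4) : Prop :=
  IsAntiSelfDualOn C.A₀ Set.univ ∧ IsAntiSelfDualOn C.A₁ Set.univ

end ConnectionS4

/-! ### Pairs `(a, Φ)` on the hyperbolic half-plane, with the coordinate `z = t + i r`, `r > 0` -/

/-- The upper half-plane. -/
def halfPlane : Set ℂ := {z | 0 < z.im}

/-- `a = a_t dt + a_r dr` is a smooth real one-form and `Φ` a smooth complex function on the
half-plane. -/
def IsSmoothPair (a : ℂ → ℂ →L[ℝ] ℝ) (Φ : ℂ → ℂ) : Prop :=
  ContDiffOn ℝ ∞ a halfPlane ∧ ContDiffOn ℝ ∞ Φ halfPlane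

/-- `d_a Φ = dΦ + i a Φ`. -/
def covDeriv (a : ℂ → ℂ →L[ℝ] ℝ) (Φ : ℂ → ℂ) (z : ℂ) : ℂ →L[ℝ] ℂ :=
  fderiv ℝ Φ z + (Complex.I * Φ z) • Complex.ofRealCLM.comp (a z)

/-- `∂̄_a Φ`, the part of type `(0, 1)` of `d_a Φ`. -/
def dbar (a : ℂ → ℂ →L[ℝ] ℝ) (Φ : ℂ → ℂ) (z v : ℂ) : ℂ :=
  (1 / 2) * (covDeriv a Φ z v + Complex.I * covDeriv a Φ z (Complex.I * v))

/-- `∂_a Φ`, the part of type `(1, 0)` of `d_a Φ`. -/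
def del (a : ℂ → ℂ →L[ℝ] ℝ) (Φ : ℂ → ℂ) (z v : ℂ) : ℂ :=
  (1 / 2) * (covDeriv a Φ z v - Complex.I * covDeriv a Φ z (Complex.I * v))

/-- The curvature `F_a = i da` of the `U(1)` connection `ia`. -/
def curvatureU1 (a : ℂ → ℂ →L[ℝ] ℝ) (z v w : ℂ) : ℂ :=
  Complex.I * ((fderiv ℝ a z v w - fderiv ℝ a z w v : ℝ) : ℂ)

/-- The Hodge star of `h = r⁻² (dt² + dr²)` on two-forms: `⋆_h (f dt ∧ dr) = r² f`. -/
def hypStar (z : ℂ) (α : ℂ → ℂ → ℂ) : ℂ := (z.im : ℂ) ^ 2 * α 1 Complex.I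

/-- The vortex equations `∂̄_a Φ = 0` and `⋆_h i F_a = 1 - |Φ|²`. -/
def IsVortex (a : ℂ → ℂ →L[ℝ] ℝ) (Φ : ℂ → ℂ) : Prop :=
  ∀ z ∈ halfPlane, (∀ v, dbar a Φ z v = 0) ∧
    hypStar z (fun v w => Complex.I * curvatureU1 a z v w) = 1 - (‖Φ z‖ : ℂ) ^ 2

/-- The anti-vortex equations `∂_a Φ = 0` and `⋆_h i F_a = |Φ|² - 1`. -/
def IsAntiVortex (a : ℂ → ℂ →L[ℝ] ℝ) (Φ : ℂ → ℂ) : Prop :=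
  ∀ z ∈ halfPlane, (∀ v, del a Φ z v = 0) ∧
    hypStar z (fun v w => Complex.I * curvatureU1 a z v w) = (‖Φ z‖ : ℂ) ^ 2 - 1

/-- The hyperbolic area measure `r⁻² dt dr` on the half-plane. -/
def hypArea : MeasureTheory.Measure ℂ :=
  (MeasureTheory.volume.restrict halfPlane).withDensity fun z => ENNReal.ofReal (1 / z.im ^ 2)

/-- The Yang-Mills-Higgs action `‖F_a‖²_h + 2 ‖d_a Φ‖²_h + ‖1 - |Φ|²‖²_h ∈ [0, ∞]`; here
`|F_a|_h = |⋆_h F_a|` and `|d_a Φ|²_h = r² (|D_t Φ|² + |D_r Φ|²)`. -/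
def yangMillsHiggs (a : ℂ → ℂ →L[ℝ] ℝ) (Φ : ℂ → ℂ) : ENNReal :=
  (∫⁻ z, ENNReal.ofReal (‖hypStar z (curvatureU1 a z)‖ ^ 2) ∂hypArea)
    + 2 * (∫⁻ z, ENNReal.ofReal
        (z.im ^ 2 * (‖covDeriv a Φ z 1‖ ^ 2 + ‖covDeriv a Φ z Complex.I‖ ^ 2)) ∂hypArea)
    + ∫⁻ z, ENNReal.ofReal ((1 - ‖Φ z‖ ^ 2) ^ 2) ∂hypArea

/-- The integral of `F_a` over the half-plane converges (absolutely). -/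
def HasFirstChern (a : ℂ → ℂ →L[ℝ] ℝ) : Prop :=
  MeasureTheory.IntegrableOn (fun z => curvatureU1 a z 1 Complex.I) halfPlane

/-- `c₁(a) = (i / 2π) ∫ F_a`. -/
def firstChern (a : ℂ → ℂ →L[ℝ] ℝ) : ℂ :=
  Complex.I / (2 * (Real.pi : ℂ)) * ∫ z in halfPlane, curvatureU1 a z 1 Complex.I

/-- The one-form `i Φ̄ d_a Φ` vanishes at infinity, that is, along the boundary circle of the
hyperbolic plane: its norm in the coordinate `w = (z - i) / (z + i)` of the unit disc tends to
zero as `|w| → 1`. The norms in the two coordinates differ by the factor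
`|dz / dw| = |z + i|² / 2`. -/
def CurrentVanishesAtInfinity (a : ℂ → ℂ →L[ℝ] ℝ) (Φ : ℂ → ℂ) : Prop :=
  Filter.Tendsto
    (fun z : UpperHalfPlane =>
      ‖(Complex.I * (starRingEnd ℂ) (Φ (z : ℂ))) • covDeriv a Φ (z : ℂ)‖
        * (‖(z : ℂ) + Complex.I‖ ^ 2 / 2))
    (Filter.cocompact UpperHalfPlane) (𝓝 0)

/-! ### The symmetric connection of a pair -/

/-- The complement of the real axis in `ℍ`, i.e. of the fixed circle in `S⁴`. -/
def offAxis : Set ℍ[ℝ] := {x | x.im ≠ 0}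

/-- For `x = t + r Q` with `r ≥ 0`, `Q² = -1`: the point `z = t + i r`. -/
def zCoord (x : ℍ[ℝ]) : ℂ := ⟨x.re, ‖x.im‖⟩

/-- For `x = t + r Q` with `r > 0`, `Q² = -1`: the imaginary unit `Q`. -/
def Q (x : ℍ[ℝ]) : ℍ[ℝ] := ‖x.im‖⁻¹ • x.im

/-- `A = ½ (Q a + Φ₁ dQ + Φ₂ Q dQ)` with `Φ = Φ₁ + i (Φ₂ + 1)` (on the complement of the real
axis), where `a` and `Φ` are pulled back along `x ↦ t + i r`. -/
def symConnection (a : ℂ → ℂ →L[ℝ] ℝ) (Φ : ℂ → ℂ) (x : ℍ[ℝ]) : ℍ[ℝ] →L[ℝ] ℍ[ℝ] :=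
  (1 / 2 : ℝ) •
    (((a (zCoord x)).comp (fderiv ℝ zCoord x)).smulRight (Q x)
      + (Φ (zCoord x)).re • fderiv ℝ Q x
      + ((Φ (zCoord x)).im - 1) • (ContinuousLinearMap.mul ℝ ℍ[ℝ] (Q x)).comp (fderiv ℝ Q x))

end DimRed

end

/-! Off the real axis `ℍ` is the product of the half-plane (coordinate `z`) and the sphere of
imaginary units `Q`, and the group acts on the sphere only. Every orbit meets the slice `ℂ ⊆ ℍ`,
where `Q = i`. An invariant form is therefore determined by its values on the slice, and there the
stabilizer, the rotations about `i`, leaves only these data: a real multiple of `i` on vectors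
tangent to the slice, which is `a`, and a complex-linear map of `span (j, k)`, which is `Φ` up to a
scaling and a shift (`IsInvariantOn.apply_coeComplex`, `eqOn_symConnection`).

The curvature splits into an electric part `F(e 0, ·)` and a magnetic part, each an axially
symmetric tensor on `ℝ³` with three coefficients (`curvature_components`). The electric coefficients
are `da` and `D_t Φ / r`, the magnetic ones `(|Φ|² - 1) / r²` and `D_r Φ / r`. Since these tensors
determine their coefficients, equality of the two parts up to sign is the vortex or anti-vortex
system. The orthogonality of the three basic tensors gives `|F_A|²` and `F_A ∧ F_A`. As `z` pushes
Lebesgue measure on `ℝ⁴` forward to `4π r² dt dr`, the integrals become integrals over the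
half-plane.

Twice the reduced density of `F_A ∧ F_A` is `da - d Im(Φ̄ d_a Φ)`. Stokes on the rectangles `[-n, n]
× [n⁻¹, n]` removes the exact term if the current vanishes at infinity; this leaves `c₂ = c₁`.

For a connection on all of `S⁴` the pair is smooth on the whole plane in both charts, and the two
pairs are related by `z ↦ z⁻¹` and a `U(1)` gauge transformation, the restriction of `u` to `ℂ`
(`IsInvariant.inversionRelated`). The densities then decay like `|z|⁻⁴` and are integrable. At a
real point the stabilizer is the full group, which forces `d_a Φ = 0` there
(`covDeriv_ofReal_eq_zero`), so the current vanishes on the boundary circle. The equations in the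
second chart follow from those in the first by inversion and the reflection `z ↦ z̄`, which is
conjugation by `j`. -/

noncomputable section

namespace DimRed

/-! ### Exterior derivatives -/

section Curl

variable {E : Type*} [NormedAddCommGroup E] [NormedSpace ℝ E]
  {R : Type*} [NormedRing R] [NormedAlgebra ℝ R]

/-- The one-form `p dq`. -/
def mulFDeriv (p q : E → R) (y : E) : E →L[ℝ] R :=
  (ContinuousLinearMap.mul ℝ R (p y)).comp (fderiv ℝ q y)

theorem differentiableAt_mulFDeriv {p q : E → R} {x : E} (hp : DifferentiableAt ℝ p x)
    (hq : ContDiffAt ℝ 2 q x) : DifferentiableAt ℝ (mulFDeriv p q) x := by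
  have h2 : DifferentiableAt ℝ (fderiv ℝ q) x :=
    (hq.fderiv_right (m := 1) (by norm_num)).differentiableAt (by norm_num)
  exact ((ContinuousLinearMap.mul ℝ R).differentiableAt.comp x hp).clm_comp h2

/-- `d(p dq) = dp ∧ dq`. -/
theorem curl_mulFDeriv {p q : E → R} {x : E} (hp : DifferentiableAt ℝ p x)
    (hq : ContDiffAt ℝ 2 q x) (v w : E) :
    fderiv ℝ (mulFDeriv p q) x v w - fderiv ℝ (mulFDeriv p q) x w v
      = fderiv ℝ p x v * fderiv ℝ q x w - fderiv ℝ p x w * fderiv ℝ q x v := by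
  have h2 : DifferentiableAt ℝ (fderiv ℝ q) x :=
    (hq.fderiv_right (m := 1) (by norm_num)).differentiableAt (by norm_num)
  have hsymm : fderiv ℝ (fderiv ℝ q) x v w = fderiv ℝ (fderiv ℝ q) x w v :=
    (hq.isSymmSndFDerivAt (by simp)).eq v w
  have hc : HasFDerivAt (fun y => ContinuousLinearMap.mul ℝ R (p y))
      ((ContinuousLinearMap.mul ℝ R).comp (fderiv ℝ p x)) x :=
    (ContinuousLinearMap.mul ℝ R).hasFDerivAt.comp x hp.hasFDerivAt
  have h := (hc.clm_comp h2.hasFDerivAt).fderiv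
  change fderiv ℝ (mulFDeriv p q) x = _ at h
  rw [h]
  simp [hsymm]

end Curl

/-! ### The functions `z` and `Q` -/

theorem isOpen_offAxis : IsOpen offAxis :=
  isOpen_ne_fun Quaternion.continuous_im continuous_const

theorem isOpen_halfPlane : IsOpen halfPlane :=
  isOpen_lt continuous_const Complex.continuous_im

/-- The imaginary part, as a continuous linear map. -/
def imCLM : ℍ[ℝ] →L[ℝ] ℍ[ℝ] :=
  ⟨{ toFun := fun x => x.im, map_add' := fun _ _ => Quaternion.im_add _ _,
     map_smul' := fun _ _ => Quaternion.im_smul _ _ }, Quaternion.continuous_im⟩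

@[simp] theorem imCLM_apply (x : ℍ[ℝ]) : imCLM x = x.im := rfl

/-- The real part, as a continuous linear map. -/
def reCLM : ℍ[ℝ] →L[ℝ] ℝ :=
  ⟨{ toFun := fun x => x.re, map_add' := fun _ _ => rfl,
     map_smul' := fun _ _ => by simp }, Quaternion.continuous_re⟩

@[simp] theorem reCLM_apply (x : ℍ[ℝ]) : reCLM x = x.re := rfl

/-- The inner product of the imaginary parts. -/
def dot (q v : ℍ[ℝ]) : ℝ := q.imI * v.imI + q.imJ * v.imJ + q.imK * v.imK

theorem inner_im_eq_dot (q v : ℍ[ℝ]) : inner ℝ q.im v.im = dot q v := by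
  simp [Quaternion.inner_def, dot]
  ring

theorem norm_im_pos {x : ℍ[ℝ]} (hx : x ∈ offAxis) : 0 < ‖x.im‖ := norm_pos_iff.2 hx

theorem zCoord_mem {x : ℍ[ℝ]} (hx : x ∈ offAxis) : zCoord x ∈ halfPlane := norm_im_pos hx

@[simp] theorem zCoord_re (x : ℍ[ℝ]) : (zCoord x).re = x.re := rfl

@[simp] theorem zCoord_im (x : ℍ[ℝ]) : (zCoord x).im = ‖x.im‖ := rfl

theorem normSq_im (x : ℍ[ℝ]) : x.imI ^ 2 + x.imJ ^ 2 + x.imK ^ 2 = ‖x.im‖ ^ 2 := by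
  rw [sq ‖x.im‖, ← Quaternion.normSq_eq_norm_mul_self, Quaternion.normSq_def']
  simp

@[simp] theorem Q_re (x : ℍ[ℝ]) : (Q x).re = 0 := by simp [Q]

theorem Q_im (x : ℍ[ℝ]) : (Q x).im = Q x := by
  ext <;> simp

theorem smul_Q {x : ℍ[ℝ]} (hx : x ∈ offAxis) : ‖x.im‖ • Q x = x.im := by
  rw [Q, smul_smul, mul_inv_cancel₀ (norm_im_pos hx).ne', one_smul]

theorem dot_Q_self {x : ℍ[ℝ]} (hx : x ∈ offAxis) : dot (Q x) (Q x) = 1 := by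
  have h := (norm_im_pos hx).ne'
  have := normSq_im x
  simp only [dot, Q, Quaternion.imI_smul, Quaternion.imJ_smul, Quaternion.imK_smul,
    Quaternion.imI_im, Quaternion.imJ_im, Quaternion.imK_im, smul_eq_mul]
  field_simp
  linarith

theorem contDiffAt_zCoord {x : ℍ[ℝ]} (hx : x ∈ offAxis) : ContDiffAt ℝ ∞ zCoord x := by
  have h : zCoord = fun x => Complex.equivRealProdCLM.symm (x.re, ‖x.im‖) := by
    funext y; apply Complex.ext <;> simp
  rw [h]
  exact Complex.equivRealProdCLM.symm.contDiff.contDiffAt.comp x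
    (reCLM.contDiff.contDiffAt.prodMk (imCLM.contDiff.contDiffAt.norm ℝ hx))

theorem contDiffAt_Q {x : ℍ[ℝ]} (hx : x ∈ offAxis) : ContDiffAt ℝ ∞ Q x :=
  ((imCLM.contDiff.contDiffAt.norm ℝ hx).inv (norm_im_pos hx).ne').smul imCLM.contDiff.contDiffAt

theorem hasFDerivAt_norm_im {x : ℍ[ℝ]} (hx : x ∈ offAxis) :
    ∃ L : ℍ[ℝ] →L[ℝ] ℝ, (∀ v, L v = dot (Q x) v) ∧
      HasFDerivAt (fun x : ℍ[ℝ] => ‖x.im‖) L x := by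
  refine ⟨(innerSL ℝ (Q x)).comp imCLM, fun v => ?_, ?_⟩
  · simp [← inner_im_eq_dot, Q_im]
  · have h1 := ((imCLM.hasFDerivAt (x := x)).norm_sq).sqrt (by
      simpa using (norm_im_pos hx).ne')
    simp only [imCLM_apply, Real.sqrt_sq (norm_nonneg _)] at h1
    refine HasFDerivAt.congr_fderiv h1 (ContinuousLinearMap.ext fun v => ?_)
    have := (norm_im_pos hx).ne'
    simp [Q]
    field_simp

theorem fderiv_zCoord {x : ℍ[ℝ]} (hx : x ∈ offAxis) (v : ℍ[ℝ]) :
    fderiv ℝ zCoord x v = ⟨v.re, dot (Q x) v⟩ := by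
  have h := ((contDiffAt_zCoord hx).differentiableAt (by simp)).hasFDerivAt
  obtain ⟨L, hL, hL'⟩ := hasFDerivAt_norm_im hx
  apply Complex.ext
  · have h1 := Complex.reCLM.hasFDerivAt.comp x h
    have := h1.unique (reCLM.hasFDerivAt (x := x))
    simpa using DFunLike.congr_fun this v
  · have h1 := Complex.imCLM.hasFDerivAt.comp x h
    have := h1.unique hL'
    simpa [hL] using DFunLike.congr_fun this v

/-- Obtained by differentiating `r Q = Im x` and solving for `dQ`, which avoids the derivative of
`r⁻¹`. -/
theorem fderiv_Q {x : ℍ[ℝ]} (hx : x ∈ offAxis) (v : ℍ[ℝ]) :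
    fderiv ℝ Q x v = ‖x.im‖⁻¹ • (v.im - dot (Q x) v • Q x) := by
  obtain ⟨L, hL, hL'⟩ := hasFDerivAt_norm_im hx
  have hr := (norm_im_pos hx).ne'
  have h := ((contDiffAt_Q hx).differentiableAt (by simp)).hasFDerivAt
  have h1 := hL'.smul h
  have h2 : HasFDerivAt (fun y : ℍ[ℝ] => ‖y.im‖ • Q y) imCLM x := by
    refine (imCLM.hasFDerivAt (x := x)).congr_of_eventuallyEq ?_
    filter_upwards [isOpen_offAxis.mem_nhds hx] with y hy
    exact smul_Q hy
  have := DFunLike.congr_fun (h1.unique h2) v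
  simp only [add_apply, smul_apply,
    ContinuousLinearMap.smulRight_apply, hL, imCLM_apply] at this
  rw [← this, add_sub_cancel_right, smul_smul, inv_mul_cancel₀ hr, one_smul]

theorem Q_mul_self {x : ℍ[ℝ]} (hx : x ∈ offAxis) : Q x * Q x = -1 := by
  have h := dot_Q_self hx
  simp only [dot] at h
  ext <;> simp <;> linarith

/-- This is the derivative of `Q² = -1`. -/
theorem fderiv_Q_mul_Q {x : ℍ[ℝ]} (hx : x ∈ offAxis) (v : ℍ[ℝ]) :
    fderiv ℝ Q x v * Q x = -(Q x * fderiv ℝ Q x v) := by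
  have h := dot_Q_self hx
  simp only [dot] at h
  rw [fderiv_Q hx]
  rw [smul_mul_assoc, mul_smul_comm, ← smul_neg]
  congr 1
  ext <;> simp [dot]
  · linear_combination (2 * ((Q x).imI * v.imI + (Q x).imJ * v.imJ + (Q x).imK * v.imK)) * h
  all_goals ring

/-! ### The curvature of a symmetric connection -/

/-- Anticommutation gives `(qη)(qη') = ηη'`, whence the coefficient `s² + p²`, while the terms with
`s p` cancel because `η q η' + q η η' = 0`. -/
theorem commutator_symmetric {R : Type*} [Ring R] [Algebra ℝ R] {q η η' : R}
    (hq : q * q = -1) (h : η * q = -(q * η)) (h' : η' * q = -(q * η')) (α α' s p : ℝ) :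
    ((1 / 2 : ℝ) • (α • q + s • η + p • (q * η))) * ((1 / 2 : ℝ) • (α' • q + s • η' + p • (q * η')))
      - ((1 / 2 : ℝ) • (α' • q + s • η' + p • (q * η'))) *
        ((1 / 2 : ℝ) • (α • q + s • η + p • (q * η)))
      = (1 / 2 : ℝ) • ((α * s) • (q * η') - (α' * s) • (q * η) - (α * p) • η' + (α' * p) • η
        + ((s ^ 2 + p ^ 2) / 2) • (η * η' - η' * η)) := by
  have e1 : ∀ y, q * (q * y) = -y := fun y => by rw [← mul_assoc, hq, neg_one_mul]
  have e2 : ∀ y, η * (q * y) = -(q * (η * y)) := fun y => by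
    rw [← mul_assoc, h, neg_mul, mul_assoc]
  have e3 : ∀ y, η' * (q * y) = -(q * (η' * y)) := fun y => by
    rw [← mul_assoc, h', neg_mul, mul_assoc]
  simp only [mul_add, add_mul, smul_mul_assoc, mul_smul_comm, mul_assoc, hq, h, h', e1, e2, e3,
    mul_neg, smul_neg, smul_add, smul_sub]
  module

theorem two_le_smooth : (2 : WithTop ℕ∞) ≤ ∞ := WithTop.coe_le_coe.2 (le_top (a := (2 : ℕ∞)))

section SymConnection

variable {a : ℂ → ℂ →L[ℝ] ℝ} {Φ : ℂ → ℂ} {x : ℍ[ℝ]}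

theorem clm_complex_apply {F : Type*} [AddCommGroup F] [Module ℝ F] [TopologicalSpace F]
    (L : ℂ →L[ℝ] F) (v : ℂ) : L v = v.re • L 1 + v.im • L Complex.I := by
  conv_lhs => rw [show v = v.re • (1 : ℂ) + v.im • Complex.I by apply Complex.ext <;> simp]
  simp only [map_add, map_smul]

theorem symConnection_apply (a : ℂ → ℂ →L[ℝ] ℝ) (Φ : ℂ → ℂ) (x v : ℍ[ℝ]) :
    symConnection a Φ x v = (1 / 2 : ℝ) • (a (zCoord x) (fderiv ℝ zCoord x v) • Q x
      + (Φ (zCoord x)).re • fderiv ℝ Q x v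
      + ((Φ (zCoord x)).im - 1) • (Q x * fderiv ℝ Q x v)) := rfl

/-- `D_v Φ`, where the vector `v` is projected to the half-plane. -/
def covAt (a : ℂ → ℂ →L[ℝ] ℝ) (Φ : ℂ → ℂ) (x v : ℍ[ℝ]) : ℂ :=
  covDeriv a Φ (zCoord x) (fderiv ℝ zCoord x v)

/-- `da` evaluated on `∂_t, ∂_r`. -/
def curlAt (a : ℂ → ℂ →L[ℝ] ℝ) (z : ℂ) : ℝ := fderiv ℝ a z 1 Complex.I - fderiv ℝ a z Complex.I 1

theorem curl_eq_curlAt (a : ℂ → ℂ →L[ℝ] ℝ) (z v w : ℂ) :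
    fderiv ℝ a z v w - fderiv ℝ a z w v = curlAt a z * (v.re * w.im - v.im * w.re) := by
  have h (v w : ℂ) : fderiv ℝ a z v w = v.re * (w.re * fderiv ℝ a z 1 1
      + w.im * fderiv ℝ a z 1 Complex.I) + v.im * (w.re * fderiv ℝ a z Complex.I 1
      + w.im * fderiv ℝ a z Complex.I Complex.I) := by
    rw [clm_complex_apply (fderiv ℝ a z) v, add_apply, smul_apply, smul_apply,
      clm_complex_apply (fderiv ℝ a z 1) w, clm_complex_apply (fderiv ℝ a z Complex.I) w]
    simp
  rw [h v w, h w v, curlAt]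
  ring

theorem covDeriv_apply (a : ℂ → ℂ →L[ℝ] ℝ) (Φ : ℂ → ℂ) (z v : ℂ) :
    covDeriv a Φ z v = fderiv ℝ Φ z v + Complex.I * Φ z * a z v := by
  simp [covDeriv]

theorem IsSmoothPair.contDiffAt_fst (h : IsSmoothPair a Φ) {z : ℂ} (hz : z ∈ halfPlane) :
    ContDiffAt ℝ ∞ a z := h.1.contDiffAt (isOpen_halfPlane.mem_nhds hz)

theorem IsSmoothPair.contDiffAt_snd (h : IsSmoothPair a Φ) {z : ℂ} (hz : z ∈ halfPlane) :
    ContDiffAt ℝ ∞ Φ z := h.2.contDiffAt (isOpen_halfPlane.mem_nhds hz)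

theorem curl_symConnection (h : IsSmoothPair a Φ) (hx : x ∈ offAxis) (v w : ℍ[ℝ]) :
    fderiv ℝ (symConnection a Φ) x v w - fderiv ℝ (symConnection a Φ) x w v
      = (1 / 2 : ℝ) • ((curlAt a (zCoord x) * ((fderiv ℝ zCoord x v).re * (fderiv ℝ zCoord x w).im
          - (fderiv ℝ zCoord x v).im * (fderiv ℝ zCoord x w).re)) • Q x
        + a (zCoord x) (fderiv ℝ zCoord x w) • fderiv ℝ Q x v
        - a (zCoord x) (fderiv ℝ zCoord x v) • fderiv ℝ Q x w
        + (fderiv ℝ Φ (zCoord x) (fderiv ℝ zCoord x v)).re • fderiv ℝ Q x w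
        - (fderiv ℝ Φ (zCoord x) (fderiv ℝ zCoord x w)).re • fderiv ℝ Q x v
        + (fderiv ℝ Φ (zCoord x) (fderiv ℝ zCoord x v)).im • (Q x * fderiv ℝ Q x w)
        - (fderiv ℝ Φ (zCoord x) (fderiv ℝ zCoord x w)).im • (Q x * fderiv ℝ Q x v)
        + ((Φ (zCoord x)).im - 1) •
          (fderiv ℝ Q x v * fderiv ℝ Q x w - fderiv ℝ Q x w * fderiv ℝ Q x v)) := by
  have hz := zCoord_mem hx
  have hzd : HasFDerivAt zCoord (fderiv ℝ zCoord x) x :=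
    ((contDiffAt_zCoord hx).differentiableAt (by simp)).hasFDerivAt
  have hQd : HasFDerivAt Q (fderiv ℝ Q x) x :=
    ((contDiffAt_Q hx).differentiableAt (by simp)).hasFDerivAt
  have had : HasFDerivAt a (fderiv ℝ a (zCoord x)) (zCoord x) :=
    ((h.contDiffAt_fst hz).differentiableAt (by simp)).hasFDerivAt
  have hΦd : HasFDerivAt Φ (fderiv ℝ Φ (zCoord x)) (zCoord x) :=
    ((h.contDiffAt_snd hz).differentiableAt (by simp)).hasFDerivAt
  have hat (v : ℂ) : HasFDerivAt (fun y => a (zCoord y) v)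
      (((ContinuousLinearMap.apply ℝ ℝ v).comp (fderiv ℝ a (zCoord x))).comp
        (fderiv ℝ zCoord x)) x :=
    ((ContinuousLinearMap.apply ℝ ℝ v).hasFDerivAt.comp _ had).comp x hzd
  have hre := (Complex.reCLM.hasFDerivAt.comp _ hΦd).comp x hzd
  have him := (Complex.imCLM.hasFDerivAt.comp _ hΦd).comp x hzd
  -- Up to the factor `½` the connection is the sum of four forms `p dq` with `q = t, r, Q, Q`;
  -- since `d(p dq) = dp ∧ dq`, no second derivative of `z` or `Q` survives.
  let p : Fin 4 → ℍ[ℝ] → ℍ[ℝ] := ![fun y => a (zCoord y) 1 • Q y,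
    fun y => a (zCoord y) Complex.I • Q y, fun y => (Φ (zCoord y)).re • 1,
    fun y => ((Φ (zCoord y)).im - 1) • Q y]
  let q : Fin 4 → ℍ[ℝ] → ℍ[ℝ] := ![fun y => (zCoord y).re • 1, fun y => (zCoord y).im • 1, Q, Q]
  have hq0 {y : ℍ[ℝ]} (hy : y ∈ offAxis) :
      HasFDerivAt (q 0) ((Complex.reCLM.comp (fderiv ℝ zCoord y)).smulRight 1) y :=
    (Complex.reCLM.hasFDerivAt.comp y
      ((contDiffAt_zCoord hy).differentiableAt (by simp)).hasFDerivAt).smul_const 1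
  have hq1 {y : ℍ[ℝ]} (hy : y ∈ offAxis) :
      HasFDerivAt (q 1) ((Complex.imCLM.comp (fderiv ℝ zCoord y)).smulRight 1) y :=
    (Complex.imCLM.hasFDerivAt.comp y
      ((contDiffAt_zCoord hy).differentiableAt (by simp)).hasFDerivAt).smul_const 1
  have hp0 := (hat 1).smul hQd
  have hp1 := (hat Complex.I).smul hQd
  have hp2 := hre.smul_const (1 : ℍ[ℝ])
  have hp3 := (him.sub_const 1).smul hQd
  have hqs : ∀ k, ContDiffAt ℝ 2 (q k) x := by
    have hz2 := (contDiffAt_zCoord hx).of_le (m := 2) two_le_smooth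
    intro k
    fin_cases k
    · exact (Complex.reCLM.contDiff.contDiffAt.comp x hz2).smul contDiffAt_const
    · exact (Complex.imCLM.contDiff.contDiffAt.comp x hz2).smul contDiffAt_const
    · exact (contDiffAt_Q hx).of_le two_le_smooth
    · exact (contDiffAt_Q hx).of_le two_le_smooth
  have hps : ∀ k, DifferentiableAt ℝ (p k) x := by
    intro k
    fin_cases k
    exacts [hp0.differentiableAt, hp1.differentiableAt, hp2.differentiableAt,
      hp3.differentiableAt]
  have hA : symConnection a Φ =ᶠ[𝓝 x]
      (1 / 2 : ℝ) • (mulFDeriv (p 0) (q 0) + mulFDeriv (p 1) (q 1)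
        + mulFDeriv (p 2) (q 2) + mulFDeriv (p 3) (q 3)) := by
    filter_upwards [isOpen_offAxis.mem_nhds hx] with y hy
    ext1 v
    rw [symConnection_apply, clm_complex_apply (a (zCoord y))]
    simp only [mulFDeriv, Pi.smul_apply, Pi.add_apply, smul_apply, add_apply,
      ContinuousLinearMap.comp_apply, (hq0 hy).fderiv, (hq1 hy).fderiv]
    change _ = (1 / 2 : ℝ) • ((a (zCoord y) 1 • Q y) * ((fderiv ℝ zCoord y v).re • 1)
      + (a (zCoord y) Complex.I • Q y) * ((fderiv ℝ zCoord y v).im • 1)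
      + ((Φ (zCoord y)).re • 1) * fderiv ℝ Q y v
      + (((Φ (zCoord y)).im - 1) • Q y) * fderiv ℝ Q y v)
    simp only [smul_mul_assoc, mul_smul_comm, mul_one, one_mul, smul_eq_mul]
    module
  have hd := fun k => differentiableAt_mulFDeriv (hps k) (hqs k)
  have hc := fun k => curl_mulFDeriv (hps k) (hqs k) v w
  have h0 := hc 0
  have h1 := hc 1
  have h2 := hc 2
  have h3 := hc 3
  rw [hA.fderiv_eq, ((((hd 0).hasFDerivAt.add (hd 1).hasFDerivAt).add
    (hd 2).hasFDerivAt).add (hd 3).hasFDerivAt).const_smul (1 / 2 : ℝ) |>.fderiv]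
  simp only [smul_apply, add_apply, ← smul_sub]
  congr 1
  rw [← curl_eq_curlAt]
  rw [(hq0 hx).fderiv, (show HasFDerivAt (p 0) _ x from hp0).fderiv] at h0
  rw [(hq1 hx).fderiv, (show HasFDerivAt (p 1) _ x from hp1).fderiv] at h1
  rw [(show HasFDerivAt (p 2) _ x from hp2).fderiv] at h2
  rw [(show HasFDerivAt (p 3) _ x from hp3).fderiv] at h3
  change _ = _ * fderiv ℝ Q x w - _ * fderiv ℝ Q x v at h2 h3
  rw [clm_complex_apply (a (zCoord x)) (fderiv ℝ zCoord x v),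
    clm_complex_apply (a (zCoord x)) (fderiv ℝ zCoord x w),
    clm_complex_apply (fderiv ℝ a (zCoord x) (fderiv ℝ zCoord x v)) (fderiv ℝ zCoord x w),
    clm_complex_apply (fderiv ℝ a (zCoord x) (fderiv ℝ zCoord x w)) (fderiv ℝ zCoord x v)]
  rw [show ∀ A B C D A' B' C' D' : ℍ[ℝ], A + B + C + D - (A' + B' + C' + D')
    = (A - A') + (B - B') + (C - C') + (D - D') by intros; abel, h0, h1, h2, h3]
  simp [add_mul]
  module

/-- The curvature of a symmetric connection. -/
theorem curvature_symConnection (h : IsSmoothPair a Φ) (hx : x ∈ offAxis) (v w : ℍ[ℝ]) :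
    curvature (symConnection a Φ) x v w
      = (1 / 2 : ℝ) • ((curlAt a (zCoord x) * ((fderiv ℝ zCoord x v).re * (fderiv ℝ zCoord x w).im
          - (fderiv ℝ zCoord x v).im * (fderiv ℝ zCoord x w).re)) • Q x
        + ((covAt a Φ x v).re • fderiv ℝ Q x w - (covAt a Φ x w).re • fderiv ℝ Q x v)
        + ((covAt a Φ x v).im • (Q x * fderiv ℝ Q x w)
          - (covAt a Φ x w).im • (Q x * fderiv ℝ Q x v))
        + ((‖Φ (zCoord x)‖ ^ 2 - 1) / 2) •
          (fderiv ℝ Q x v * fderiv ℝ Q x w - fderiv ℝ Q x w * fderiv ℝ Q x v)) := by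
  rw [curvature, curl_symConnection h hx, symConnection_apply, symConnection_apply,
    commutator_symmetric (Q_mul_self hx) (fderiv_Q_mul_Q hx v) (fderiv_Q_mul_Q hx w),
    ← smul_add]
  congr 1
  -- With `s = Re Φ` and `p = Im Φ - 1`, the coefficient `(s² + p²) / 2` from `A ∧ A` and `p` from
  -- `d(Q dQ)` add up to `(|Φ|² - 1) / 2`. Likewise the terms with `a` complete `dΦ` to `d_a Φ`.
  -- Both need the shift of `Φ` by `i`.
  simp only [covAt, covDeriv_apply, ← Complex.normSq_eq_norm_sq, Complex.normSq_apply]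
  simp
  module

end SymConnection

/-! ### Curvature components -/

/-- The axially symmetric tensor `½ (α P + β (1 - P) + γ q ×)` on `ℝ³`, where `P` is the
projection to the axis spanned by the unit vector `q`. -/
def axialTensor (α β γ : ℝ) (q v : ℍ[ℝ]) : ℍ[ℝ] :=
  (1 / 2 : ℝ) • ((α * dot q v) • q + β • (v.im - dot q v • q)
    + (γ / 2) • (q * v.im - v.im * q))

@[simp] theorem e_zero_re : (e 0).re = 1 := rfl
@[simp] theorem e_zero_imI : (e 0).imI = 0 := rfl
@[simp] theorem e_zero_imJ : (e 0).imJ = 0 := rfl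
@[simp] theorem e_zero_imK : (e 0).imK = 0 := rfl
@[simp] theorem e_one_re : (e 1).re = 0 := rfl
@[simp] theorem e_one_imI : (e 1).imI = 1 := rfl
@[simp] theorem e_one_imJ : (e 1).imJ = 0 := rfl
@[simp] theorem e_one_imK : (e 1).imK = 0 := rfl
@[simp] theorem e_two_re : (e 2).re = 0 := rfl
@[simp] theorem e_two_imI : (e 2).imI = 0 := rfl
@[simp] theorem e_two_imJ : (e 2).imJ = 1 := rfl
@[simp] theorem e_two_imK : (e 2).imK = 0 := rfl
@[simp] theorem e_three_re : (e 3).re = 0 := rfl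
@[simp] theorem e_three_imI : (e 3).imI = 0 := rfl
@[simp] theorem e_three_imJ : (e 3).imJ = 0 := rfl
@[simp] theorem e_three_imK : (e 3).imK = 1 := rfl

/-- Contracting the tensor twice with `q` isolates `α`, contracting its antisymmetric part with `q`
isolates `γ`, and the trace then gives `β`. -/
theorem axialTensor_eq_iff {q : ℍ[ℝ]} (h : dot q q = 1) (α β γ α' β' γ' : ℝ) :
    (axialTensor α β γ q (e 1) = axialTensor α' β' γ' q (e 1) ∧
      axialTensor α β γ q (e 2) = axialTensor α' β' γ' q (e 2) ∧
      axialTensor α β γ q (e 3) = axialTensor α' β' γ' q (e 3)) ↔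
      α = α' ∧ β = β' ∧ γ = γ' := by
  refine ⟨fun ⟨h1, h2, h3⟩ => ?_, fun ⟨h1, h2, h3⟩ => by rw [h1, h2, h3]; simp⟩
  simp only [dot] at h
  simp only [axialTensor, Quaternion.ext_iff, dot] at h1 h2 h3
  simp at h1 h2 h3
  obtain ⟨-, h11, h12, h13⟩ := h1
  obtain ⟨-, h21, h22, h23⟩ := h2
  obtain ⟨-, h31, h32, h33⟩ := h3
  set a := q.imI
  set b := q.imJ
  set c := q.imK
  have hα : α = α' := by
    linear_combination 2 * (a ^ 2 * h11 + a * b * h12 + a * c * h13 + b * a * h21 + b ^ 2 * h22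
      + b * c * h23 + c * a * h31 + c * b * h32 + c ^ 2 * h33)
      + ((β - β') * (a * a + b * b + c * c)
        - (α - α') * (a * a + b * b + c * c + 1)) * h
  have hγ : γ = γ' := by
    linear_combination (c * h12 - b * h13 - c * h21 + a * h23 + b * h31 - a * h32)
      - (γ - γ') * h
  refine ⟨hα, ?_, hγ⟩
  linear_combination (h11 + h22 + h33) - hα / 2 + ((β - β') - (α - α')) / 2 * h

/-- The tensors `P`, `1 - P` and `q ×` are orthogonal, with squared norms `1`, `2`, `2`. -/
theorem sum_norm_sq_axialTensor {q : ℍ[ℝ]} (h0 : q.re = 0) (h : dot q q = 1) (α β γ : ℝ) :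
    ‖axialTensor α β γ q (e 1)‖ ^ 2 + ‖axialTensor α β γ q (e 2)‖ ^ 2
      + ‖axialTensor α β γ q (e 3)‖ ^ 2 = (α ^ 2 + 2 * β ^ 2 + 2 * γ ^ 2) / 4 := by
  simp only [sq ‖_‖, ← Quaternion.normSq_eq_norm_mul_self, Quaternion.normSq_def']
  simp only [dot] at h
  simp [axialTensor, dot, h0]
  set a := q.imI
  set b := q.imJ
  set c := q.imK
  linear_combination (α ^ 2 * (a * a + b * b + c * c + 1) - 2 * α * β * (a * a + b * b + c * c)
    + β ^ 2 * (a * a + b * b + c * c - 1) + 2 * γ ^ 2) / 4 * h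

theorem sum_mul_axialTensor {q : ℍ[ℝ]} (h0 : q.re = 0) (h : dot q q = 1) (α β γ α' β' γ' : ℝ) :
    (axialTensor α β γ q (e 1) * axialTensor α' β' γ' q (e 1)
      + axialTensor α β γ q (e 2) * axialTensor α' β' γ' q (e 2)
      + axialTensor α β γ q (e 3) * axialTensor α' β' γ' q (e 3)).re
      = -(α * α' + 2 * β * β' + 2 * γ * γ') / 4 := by
  simp only [dot] at h
  simp [axialTensor, dot, h0]
  set a := q.imI
  set b := q.imJ
  set c := q.imK
  linear_combination -(α * α' * (a * a + b * b + c * c + 1)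
    - (α * β' + α' * β) * (a * a + b * b + c * c)
    + β * β' * (a * a + b * b + c * c - 1) + 2 * γ * γ') / 4 * h

section Components

variable {a : ℂ → ℂ →L[ℝ] ℝ} {Φ : ℂ → ℂ} {x : ℍ[ℝ]}

theorem covAt_e_zero (hx : x ∈ offAxis) : covAt a Φ x (e 0) = covDeriv a Φ (zCoord x) 1 := by
  rw [covAt, fderiv_zCoord hx]
  congr 1
  apply Complex.ext <;> simp [dot]

theorem covAt_of_re_eq_zero (hx : x ∈ offAxis) {v : ℍ[ℝ]} (hv : v.re = 0) :
    covAt a Φ x v = dot (Q x) v • covDeriv a Φ (zCoord x) Complex.I := by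
  rw [covAt, fderiv_zCoord hx, ← map_smul]
  congr 1
  apply Complex.ext <;> simp [hv]

theorem curvature_e_zero (h : IsSmoothPair a Φ) (hx : x ∈ offAxis) {v : ℍ[ℝ]} (hv : v.re = 0) :
    curvature (symConnection a Φ) x (e 0) v = axialTensor (curlAt a (zCoord x))
      (‖x.im‖⁻¹ * (covDeriv a Φ (zCoord x) 1).re) (‖x.im‖⁻¹ * (covDeriv a Φ (zCoord x) 1).im)
      (Q x) v := by
  have hQ := Q_mul_self hx
  have h0 : fderiv ℝ Q x (e 0) = 0 := by
    rw [fderiv_Q hx]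
    ext <;> simp [dot]
  have hQv : Q x * (v.im - dot (Q x) v • Q x) = (1 / 2 : ℝ) • (Q x * v.im - v.im * Q x) := by
    rw [mul_sub, mul_smul_comm, hQ]
    ext <;> simp [dot] <;> ring
  rw [curvature_symConnection h hx, covAt_e_zero hx, fderiv_zCoord hx, fderiv_zCoord hx, h0,
    fderiv_Q hx, axialTensor, mul_smul_comm, hQv, hv]
  simp [dot]
  module

/-- Here `u = v × w`, so this is the magnetic part. The identities `h1`, `h2`, `h3` are vector
algebra for the unit vector `Q`: the double product `Q × (v × w)`, its multiple by `Q`, and the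
cross product of the components of `v` and `w` orthogonal to `Q`. -/
theorem curvature_spatial (h : IsSmoothPair a Φ) (hx : x ∈ offAxis) {u v w : ℍ[ℝ]}
    (hv : v.re = 0) (hw : w.re = 0) (hu : (2 : ℝ) • u = v * w - w * v) :
    curvature (symConnection a Φ) x v w = axialTensor (‖x.im‖⁻¹ ^ 2 * (‖Φ (zCoord x)‖ ^ 2 - 1))
      (‖x.im‖⁻¹ * (covDeriv a Φ (zCoord x) Complex.I).im)
      (-(‖x.im‖⁻¹ * (covDeriv a Φ (zCoord x) Complex.I).re)) (Q x) u := by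
  have hq := dot_Q_self hx
  rw [dot] at hq
  have hu' : u = (1 / 2 : ℝ) • (v * w - w * v) := by rw [← hu]; module
  have h1 : dot (Q x) v • w.im - dot (Q x) w • v.im = -(1 / 2 : ℝ) • (Q x * u.im - u.im * Q x) := by
    rw [hu']
    ext <;> simp [dot, hv, hw] <;> ring
  have h2 : Q x * (dot (Q x) v • w.im - dot (Q x) w • v.im) = u.im - dot (Q x) u • Q x := by
    rw [hu']
    ext <;> simp [dot, hv, hw]
    · ring
    · linear_combination (v.imJ * w.imK - v.imK * w.imJ) * hq
    · linear_combination (v.imK * w.imI - v.imI * w.imK) * hq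
    · linear_combination (v.imI * w.imJ - v.imJ * w.imI) * hq
  have h3 : (v.im - dot (Q x) v • Q x) * (w.im - dot (Q x) w • Q x)
      - (w.im - dot (Q x) w • Q x) * (v.im - dot (Q x) v • Q x) = (2 * dot (Q x) u) • Q x := by
    rw [hu']
    ext <;> simp [dot, hv, hw]
    · ring
    · linear_combination -2 * (v.imJ * w.imK - v.imK * w.imJ) * hq
    · linear_combination -2 * (v.imK * w.imI - v.imI * w.imK) * hq
    · linear_combination -2 * (v.imI * w.imJ - v.imJ * w.imI) * hq
  rw [curvature_symConnection h hx, covAt_of_re_eq_zero hx hv, covAt_of_re_eq_zero hx hw,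
    fderiv_zCoord hx, fderiv_zCoord hx, fderiv_Q hx, fderiv_Q hx, axialTensor, hv, hw]
  generalize ‖x.im‖⁻¹ = ρ at *
  generalize covDeriv a Φ (zCoord x) Complex.I = D at *
  have e1 : (dot (Q x) v • D).re • ρ • (w.im - dot (Q x) w • Q x)
      - (dot (Q x) w • D).re • ρ • (v.im - dot (Q x) v • Q x)
      = (ρ * D.re) • (-(1 / 2 : ℝ) • (Q x * u.im - u.im * Q x)) := by
    rw [← h1]; simp; module
  have e2 : (dot (Q x) v • D).im • (Q x * ρ • (w.im - dot (Q x) w • Q x))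
      - (dot (Q x) w • D).im • (Q x * ρ • (v.im - dot (Q x) v • Q x))
      = (ρ * D.im) • (u.im - dot (Q x) u • Q x) := by
    rw [← h2]; simp [mul_sub]; module
  have e3 : (ρ • (v.im - dot (Q x) v • Q x)) * (ρ • (w.im - dot (Q x) w • Q x))
      - (ρ • (w.im - dot (Q x) w • Q x)) * (ρ • (v.im - dot (Q x) v • Q x))
      = (ρ ^ 2) • (2 * dot (Q x) u) • Q x := by
    rw [← h3]; simp only [smul_mul_assoc, mul_smul_comm]; module
  rw [e1, e2, e3]
  simp
  module

end Components

/-! ### The self-duality equations -/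

section Bilinear

variable (A : ℍ[ℝ] → ℍ[ℝ] →L[ℝ] ℍ[ℝ]) (x : ℍ[ℝ])

theorem curvature_swap (v w : ℍ[ℝ]) : curvature A x w v = -curvature A x v w := by
  simp only [curvature]; abel

theorem curvature_add_left (v v' w : ℍ[ℝ]) :
    curvature A x (v + v') w = curvature A x v w + curvature A x v' w := by
  simp only [curvature, map_add, add_apply, add_mul, mul_add]; abel

theorem curvature_smul_left (c : ℝ) (v w : ℍ[ℝ]) :
    curvature A x (c • v) w = c • curvature A x v w := by
  simp only [curvature, map_smul, smul_apply, smul_mul_assoc, mul_smul_comm]; module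

theorem curvature_add_right (v w w' : ℍ[ℝ]) :
    curvature A x v (w + w') = curvature A x v w + curvature A x v w' := by
  simp only [curvature_swap A x _ v, curvature_add_left]; abel

theorem curvature_smul_right (c : ℝ) (v w : ℍ[ℝ]) :
    curvature A x v (c • w) = c • curvature A x v w := by
  simp only [curvature_swap A x _ v, curvature_smul_left]; module

theorem curvature_self (v : ℍ[ℝ]) : curvature A x v v = 0 := by simp [curvature]

theorem eq_sum_e (v : ℍ[ℝ]) : v = v.re • e 0 + v.imI • e 1 + v.imJ • e 2 + v.imK • e 3 := by
  ext <;> simp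

theorem curvature_eq_sum (v w : ℍ[ℝ]) : curvature A x v w
    = (v.re * w.imI - v.imI * w.re) • curvature A x (e 0) (e 1)
      + (v.re * w.imJ - v.imJ * w.re) • curvature A x (e 0) (e 2)
      + (v.re * w.imK - v.imK * w.re) • curvature A x (e 0) (e 3)
      + (v.imJ * w.imK - v.imK * w.imJ) • curvature A x (e 2) (e 3)
      + (v.imK * w.imI - v.imI * w.imK) • curvature A x (e 3) (e 1)
      + (v.imI * w.imJ - v.imJ * w.imI) • curvature A x (e 1) (e 2) := by
  conv_lhs => rw [eq_sum_e v, eq_sum_e w]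
  simp only [curvature_add_left, curvature_add_right, curvature_smul_left, curvature_smul_right,
    curvature_self, curvature_swap A x (e 0) (e 1), curvature_swap A x (e 0) (e 2),
    curvature_swap A x (e 0) (e 3), curvature_swap A x (e 2) (e 3), curvature_swap A x (e 3) (e 1),
    curvature_swap A x (e 1) (e 2)]
  module

theorem selfDual_iff : (∀ v w, curvature A x v w = hodgeStar (curvature A x) v w) ↔
    curvature A x (e 0) (e 1) = curvature A x (e 2) (e 3) ∧
    curvature A x (e 0) (e 2) = curvature A x (e 3) (e 1) ∧
    curvature A x (e 0) (e 3) = curvature A x (e 1) (e 2) := by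
  refine ⟨fun h => ⟨?_, ?_, ?_⟩, fun ⟨h1, h2, h3⟩ v w => ?_⟩
  · simpa [hodgeStar] using h (e 0) (e 1)
  · simpa [hodgeStar] using h (e 0) (e 2)
  · simpa [hodgeStar] using h (e 0) (e 3)
  · rw [curvature_eq_sum, hodgeStar, h1, h2, h3]

theorem antiSelfDual_iff : (∀ v w, curvature A x v w = -hodgeStar (curvature A x) v w) ↔
    curvature A x (e 0) (e 1) = -curvature A x (e 2) (e 3) ∧
    curvature A x (e 0) (e 2) = -curvature A x (e 3) (e 1) ∧
    curvature A x (e 0) (e 3) = -curvature A x (e 1) (e 2) := by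
  refine ⟨fun h => ⟨?_, ?_, ?_⟩, fun ⟨h1, h2, h3⟩ v w => ?_⟩
  · simpa [hodgeStar] using h (e 0) (e 1)
  · simpa [hodgeStar] using h (e 0) (e 2)
  · simpa [hodgeStar] using h (e 0) (e 3)
  · rw [curvature_eq_sum, hodgeStar, h1, h2, h3]; module

theorem curvatureNormSq_eq : curvatureNormSq A x
    = (‖curvature A x (e 0) (e 1)‖ ^ 2 + ‖curvature A x (e 0) (e 2)‖ ^ 2
      + ‖curvature A x (e 0) (e 3)‖ ^ 2) + (‖curvature A x (e 2) (e 3)‖ ^ 2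
      + ‖curvature A x (e 3) (e 1)‖ ^ 2 + ‖curvature A x (e 1) (e 2)‖ ^ 2) := by
  rw [curvatureNormSq, curvature_swap A x (e 1) (e 3), norm_neg]
  simp [Fin.sum_univ_four]
  ring

theorem curvatureWedge_eq : curvatureWedge A x
    = 2 * (curvature A x (e 0) (e 1) * curvature A x (e 2) (e 3)
      + curvature A x (e 0) (e 2) * curvature A x (e 3) (e 1)
      + curvature A x (e 0) (e 3) * curvature A x (e 1) (e 2)).re := by
  rw [curvatureWedge, curvature_swap A x (e 1) (e 3)]
  simp
  ring

end Bilinear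

section Equations

variable {a : ℂ → ℂ →L[ℝ] ℝ} {Φ : ℂ → ℂ} {x : ℍ[ℝ]}

/-- A form of type `(0, 1)` is conjugate-linear, so its value at `1` determines it. -/
theorem dbar_eq (a : ℂ → ℂ →L[ℝ] ℝ) (Φ : ℂ → ℂ) (z v : ℂ) : dbar a Φ z v
    = (1 / 2) * ((starRingEnd ℂ) v) * (covDeriv a Φ z 1 + Complex.I * covDeriv a Φ z Complex.I) := by
  rw [dbar, clm_complex_apply (covDeriv a Φ z) v, clm_complex_apply _ (Complex.I * v)]
  apply Complex.ext <;> simp <;> ring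

theorem del_eq (a : ℂ → ℂ →L[ℝ] ℝ) (Φ : ℂ → ℂ) (z v : ℂ) : del a Φ z v
    = (1 / 2) * v * (covDeriv a Φ z 1 - Complex.I * covDeriv a Φ z Complex.I) := by
  rw [del, clm_complex_apply (covDeriv a Φ z) v, clm_complex_apply _ (Complex.I * v)]
  apply Complex.ext <;> simp <;> ring

theorem dbar_eq_zero_iff (a : ℂ → ℂ →L[ℝ] ℝ) (Φ : ℂ → ℂ) (z : ℂ) : (∀ v, dbar a Φ z v = 0) ↔
    (covDeriv a Φ z 1).re = (covDeriv a Φ z Complex.I).im ∧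
      (covDeriv a Φ z 1).im = -(covDeriv a Φ z Complex.I).re := by
  simp only [dbar_eq]
  constructor
  · intro h
    have h1 := h 1
    simp [Complex.ext_iff] at h1
    constructor <;> linarith [h1.1, h1.2]
  · intro h v
    have : covDeriv a Φ z 1 + Complex.I * covDeriv a Φ z Complex.I = 0 := by
      apply Complex.ext <;> simp [h.1, h.2]
    rw [this, mul_zero]

theorem del_eq_zero_iff (a : ℂ → ℂ →L[ℝ] ℝ) (Φ : ℂ → ℂ) (z : ℂ) : (∀ v, del a Φ z v = 0) ↔
    (covDeriv a Φ z 1).re = -(covDeriv a Φ z Complex.I).im ∧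
      (covDeriv a Φ z 1).im = (covDeriv a Φ z Complex.I).re := by
  simp only [del_eq]
  constructor
  · intro h
    have h1 := h 1
    simp [Complex.ext_iff] at h1
    constructor <;> linarith [h1.1, h1.2]
  · intro h v
    have : covDeriv a Φ z 1 - Complex.I * covDeriv a Φ z Complex.I = 0 := by
      apply Complex.ext <;> simp [h.1, h.2]
    rw [this, mul_zero]

theorem curvatureU1_one_I (a : ℂ → ℂ →L[ℝ] ℝ) (z : ℂ) :
    curvatureU1 a z 1 Complex.I = Complex.I * (curlAt a z : ℝ) := rfl

theorem hypStar_curvatureU1 (a : ℂ → ℂ →L[ℝ] ℝ) (z : ℂ) :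
    hypStar z (fun v w => Complex.I * curvatureU1 a z v w)
      = ((-(z.im ^ 2 * curlAt a z) : ℝ) : ℂ) := by
  rw [hypStar, curvatureU1_one_I, ← mul_assoc Complex.I, Complex.I_mul_I]
  push_cast
  ring

/-- The vortex equations at a point, in real components. -/
def VortexAt (a : ℂ → ℂ →L[ℝ] ℝ) (Φ : ℂ → ℂ) (z : ℂ) : Prop :=
  z.im ^ 2 * curlAt a z = ‖Φ z‖ ^ 2 - 1 ∧
    (covDeriv a Φ z 1).re = (covDeriv a Φ z Complex.I).im ∧
      (covDeriv a Φ z 1).im = -(covDeriv a Φ z Complex.I).re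

/-- The anti-vortex equations at a point, in real components. -/
def AntiVortexAt (a : ℂ → ℂ →L[ℝ] ℝ) (Φ : ℂ → ℂ) (z : ℂ) : Prop :=
  z.im ^ 2 * curlAt a z = -(‖Φ z‖ ^ 2 - 1) ∧
    (covDeriv a Φ z 1).re = -(covDeriv a Φ z Complex.I).im ∧
      (covDeriv a Φ z 1).im = (covDeriv a Φ z Complex.I).re

theorem isVortex_iff : IsVortex a Φ ↔ ∀ z ∈ halfPlane, VortexAt a Φ z := by
  refine forall₂_congr fun z _ => ?_
  rw [dbar_eq_zero_iff, hypStar_curvatureU1, and_comm, VortexAt]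
  refine and_congr_left fun _ => ?_
  rw [show (1 : ℂ) - (‖Φ z‖ : ℂ) ^ 2 = ((1 - ‖Φ z‖ ^ 2 : ℝ) : ℂ) by push_cast; ring,
    Complex.ofReal_inj]
  constructor <;> intro h <;> linarith

theorem isAntiVortex_iff : IsAntiVortex a Φ ↔ ∀ z ∈ halfPlane, AntiVortexAt a Φ z := by
  refine forall₂_congr fun z _ => ?_
  rw [del_eq_zero_iff, hypStar_curvatureU1, and_comm, AntiVortexAt]
  refine and_congr_left fun _ => ?_
  rw [show (‖Φ z‖ : ℂ) ^ 2 - 1 = ((‖Φ z‖ ^ 2 - 1 : ℝ) : ℂ) by push_cast; ring,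
    Complex.ofReal_inj]
  constructor <;> intro h <;> linarith

theorem zCoord_coeComplex {z : ℂ} (hz : z ∈ halfPlane) : zCoord (z : ℍ[ℝ]) = z := by
  have hz' : 0 < z.im := hz
  apply Complex.ext
  · simp
  · have := normSq_im (z : ℍ[ℝ])
    simp at this
    rw [zCoord_im]
    rwa [eq_comm, sq_eq_sq₀ (norm_nonneg _) hz'.le] at this

theorem coeComplex_mem_offAxis {z : ℂ} (hz : z ∈ halfPlane) : (z : ℍ[ℝ]) ∈ offAxis := by
  intro h
  have h1 : (z : ℍ[ℝ]).im.imI = 0 := by rw [h]; rfl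
  have hz' : 0 < z.im := hz
  simp at h1
  exact hz'.ne' h1

/-- The inclusion `ℂ ⊆ ℍ` is a section of `zCoord` over the half-plane, so `zCoord` maps `offAxis`
onto it. -/
theorem forall_halfPlane_iff {P : ℂ → Prop} :
    (∀ z ∈ halfPlane, P z) ↔ ∀ x ∈ offAxis, P (zCoord x) :=
  ⟨fun h _ hx => h _ (zCoord_mem hx), fun h z hz => by
    simpa [zCoord_coeComplex hz] using h _ (coeComplex_mem_offAxis hz)⟩

theorem curvature_components (h : IsSmoothPair a Φ) (hx : x ∈ offAxis) :
    let E := axialTensor (curlAt a (zCoord x))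
      (‖x.im‖⁻¹ * (covDeriv a Φ (zCoord x) 1).re) (‖x.im‖⁻¹ * (covDeriv a Φ (zCoord x) 1).im) (Q x)
    let B := axialTensor (‖x.im‖⁻¹ ^ 2 * (‖Φ (zCoord x)‖ ^ 2 - 1))
      (‖x.im‖⁻¹ * (covDeriv a Φ (zCoord x) Complex.I).im)
      (-(‖x.im‖⁻¹ * (covDeriv a Φ (zCoord x) Complex.I).re)) (Q x)
    (curvature (symConnection a Φ) x (e 0) (e 1) = E (e 1) ∧
      curvature (symConnection a Φ) x (e 0) (e 2) = E (e 2) ∧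
      curvature (symConnection a Φ) x (e 0) (e 3) = E (e 3)) ∧
    curvature (symConnection a Φ) x (e 2) (e 3) = B (e 1) ∧
      curvature (symConnection a Φ) x (e 3) (e 1) = B (e 2) ∧
      curvature (symConnection a Φ) x (e 1) (e 2) = B (e 3) := by
  refine ⟨⟨curvature_e_zero h hx (by simp), curvature_e_zero h hx (by simp),
    curvature_e_zero h hx (by simp)⟩, curvature_spatial h hx (by simp) (by simp) ?_,
    curvature_spatial h hx (by simp) (by simp) ?_, curvature_spatial h hx (by simp) (by simp) ?_⟩
  all_goals ext <;> simp <;> norm_num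

theorem neg_axialTensor (α β γ : ℝ) (q v : ℍ[ℝ]) :
    -axialTensor α β γ q v = axialTensor (-α) (-β) (-γ) q v := by
  simp only [axialTensor]
  module

/-- Equality of the coefficients `α` is the curvature equation, and equality of `β` and `γ` is the
Cauchy-Riemann system for `d_a Φ`. -/
theorem isSelfDualOn_symConnection_iff (h : IsSmoothPair a Φ) :
    IsSelfDualOn (symConnection a Φ) offAxis ↔ IsVortex a Φ := by
  rw [isVortex_iff, forall_halfPlane_iff]
  refine forall₂_congr fun x hx => ?_
  obtain ⟨⟨h1, h2, h3⟩, h4, h5, h6⟩ := curvature_components h hx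
  have hr := norm_im_pos hx
  rw [selfDual_iff, h1, h2, h3, h4, h5, h6, axialTensor_eq_iff (dot_Q_self hx), VortexAt]
  simp only [zCoord_im, ← mul_neg, mul_right_inj' (inv_ne_zero hr.ne'), inv_pow]
  rw [eq_inv_mul_iff_mul_eq₀ (pow_ne_zero 2 hr.ne')]

theorem isAntiSelfDualOn_symConnection_iff (h : IsSmoothPair a Φ) :
    IsAntiSelfDualOn (symConnection a Φ) offAxis ↔ IsAntiVortex a Φ := by
  rw [isAntiVortex_iff, forall_halfPlane_iff]
  refine forall₂_congr fun x hx => ?_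
  obtain ⟨⟨h1, h2, h3⟩, h4, h5, h6⟩ := curvature_components h hx
  have hr := norm_im_pos hx
  rw [antiSelfDual_iff, h1, h2, h3, h4, h5, h6]
  simp only [neg_axialTensor]
  rw [axialTensor_eq_iff (dot_Q_self hx), AntiVortexAt, neg_neg]
  simp only [zCoord_im, ← mul_neg, mul_right_inj' (inv_ne_zero hr.ne'), inv_pow]
  rw [eq_inv_mul_iff_mul_eq₀ (pow_ne_zero 2 hr.ne')]

/-- The Yang-Mills density, as a function on the half-plane. -/
def actionDensity (a : ℂ → ℂ →L[ℝ] ℝ) (Φ : ℂ → ℂ) (z : ℂ) : ℝ :=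
  (curlAt a z ^ 2 + 2 * z.im⁻¹ ^ 2 * (‖covDeriv a Φ z 1‖ ^ 2 + ‖covDeriv a Φ z Complex.I‖ ^ 2)
    + z.im⁻¹ ^ 4 * (1 - ‖Φ z‖ ^ 2) ^ 2) / 4

/-- The four-form `F_A ∧ F_A`, multiplied by `r²`, as a function on the half-plane. -/
def wedgeDensity (a : ℂ → ℂ →L[ℝ] ℝ) (Φ : ℂ → ℂ) (z : ℂ) : ℝ :=
  -(curlAt a z * (‖Φ z‖ ^ 2 - 1)
    + 2 * ((covDeriv a Φ z 1).re * (covDeriv a Φ z Complex.I).im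
      - (covDeriv a Φ z 1).im * (covDeriv a Φ z Complex.I).re)) / 2

theorem curvatureNormSq_symConnection (h : IsSmoothPair a Φ) (hx : x ∈ offAxis) :
    curvatureNormSq (symConnection a Φ) x = actionDensity a Φ (zCoord x) := by
  obtain ⟨⟨h1, h2, h3⟩, h4, h5, h6⟩ := curvature_components h hx
  rw [curvatureNormSq_eq, h1, h2, h3, h4, h5, h6,
    sum_norm_sq_axialTensor (Q_re x) (dot_Q_self hx),
    sum_norm_sq_axialTensor (Q_re x) (dot_Q_self hx), actionDensity,
    ← Complex.normSq_eq_norm_sq (covDeriv _ _ _ _), ← Complex.normSq_eq_norm_sq (covDeriv _ _ _ _),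
    Complex.normSq_apply, Complex.normSq_apply, zCoord_im]
  ring

theorem curvatureWedge_symConnection (h : IsSmoothPair a Φ) (hx : x ∈ offAxis) :
    curvatureWedge (symConnection a Φ) x
      = (zCoord x).im⁻¹ ^ 2 * wedgeDensity a Φ (zCoord x) := by
  obtain ⟨⟨h1, h2, h3⟩, h4, h5, h6⟩ := curvature_components h hx
  rw [curvatureWedge_eq, h1, h2, h3, h4, h5, h6,
    sum_mul_axialTensor (Q_re x) (dot_Q_self hx), wedgeDensity, zCoord_im]
  ring

end Equations

/-! ### Integration over `ℝ⁴` of functions of `z` -/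

open MeasureTheory Set in
-- Polar coordinates: the complement of the origin is the product of the unit sphere and the
-- half-line, and the sphere has measure `dim E` times that of the unit ball.
theorem lintegral_fun_norm_addHaar {E : Type*} [NormedAddCommGroup E] [NormedSpace ℝ E]
    [Nontrivial E] [FiniteDimensional ℝ E] [MeasurableSpace E] [BorelSpace E] (μ : Measure E)
    [μ.IsAddHaarMeasure] {f : ℝ → ENNReal} (hf : Measurable f) :
    ∫⁻ x, f ‖x‖ ∂μ = Module.finrank ℝ E * μ (Metric.ball 0 1) *
      ∫⁻ r in Ioi (0 : ℝ), ENNReal.ofReal (r ^ (Module.finrank ℝ E - 1)) * f r := by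
  calc
    ∫⁻ x, f ‖x‖ ∂μ = ∫⁻ x : ({(0)}ᶜ : Set E), f ‖x.1‖ ∂(μ.comap (↑)) := by
      rw [lintegral_subtype_comap (measurableSet_singleton _).compl fun x => f ‖x‖,
        restrict_compl_singleton]
    _ = ∫⁻ x, f x.2 ∂μ.toSphere.prod (.volumeIoiPow (Module.finrank ℝ E - 1)) := by
      simpa using μ.measurePreserving_homeomorphUnitSphereProd.lintegral_comp_emb
        (Homeomorph.measurableEmbedding _) (f ∘ Subtype.val ∘ Prod.snd)
    _ = μ.toSphere univ * ∫⁻ r : Ioi (0 : ℝ), f r ∂.volumeIoiPow (Module.finrank ℝ E - 1) := by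
      rw [lintegral_prod _ (by fun_prop)]
      simp [mul_comm]
    _ = _ := by
      rw [μ.toSphere_apply_univ, Measure.volumeIoiPow,
        lintegral_withDensity_eq_lintegral_mul _ (by fun_prop) (by fun_prop),
        ← lintegral_subtype_comap measurableSet_Ioi]
      rfl

open MeasureTheory Set in
-- Applied to the indicator of a set, polar coordinates give the density `3 · (4π / 3) · r²`.
theorem map_norm_euclideanSpace_three :
    Measure.map (fun y : EuclideanSpace ℝ (Fin 3) => ‖y‖) volume
      = (volume.restrict (Ioi 0)).withDensity fun r => ENNReal.ofReal (4 * Real.pi * r ^ 2) := by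
  ext s hs
  rw [Measure.map_apply measurable_norm hs, withDensity_apply _ hs]
  have h := lintegral_fun_norm_addHaar (volume : Measure (EuclideanSpace ℝ (Fin 3)))
    (f := s.indicator 1) (measurable_one.indicator hs)
  have h1 (y : EuclideanSpace ℝ (Fin 3)) :
      s.indicator (1 : ℝ → ENNReal) ‖y‖ = ((fun y => ‖y‖) ⁻¹' s).indicator 1 y := rfl
  simp only [h1] at h
  rw [lintegral_indicator_one (measurable_norm hs)] at h
  rw [h, finrank_euclideanSpace_fin, EuclideanSpace.volume_ball_fin_three,
    ← lintegral_indicator hs, ← lintegral_const_mul _ (by measurability)]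
  refine lintegral_congr fun r => ?_
  by_cases hr : r ∈ s
  · simp only [indicator_of_mem hr, Pi.one_apply, mul_one]
    rw [show ((3 : ℕ) : ENNReal) = ENNReal.ofReal 3 by simp, ← ENNReal.ofReal_pow zero_le_one,
      ← ENNReal.ofReal_mul (by positivity), ← ENNReal.ofReal_mul (by positivity),
      ← ENNReal.ofReal_mul (by positivity)]
    congr 1
    simp only [Nat.reduceSub]
    ring
  · simp [hr]

open MeasureTheory Set in
-- Up to identifications, `z` is `id × norm` on `ℝ × ℝ³`. This factorization through
-- measure-preserving maps gives measurability and push-forward together.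
theorem measurable_and_map_zCoord_ofCoord :
    Measurable (fun p : EuclideanSpace ℝ (Fin 4) => zCoord (ofCoord p)) ∧ Measure.map (fun p : EuclideanSpace ℝ (Fin 4) => zCoord (ofCoord p)) volume
      = (volume.restrict halfPlane).withDensity
          fun z => ENNReal.ofReal (4 * Real.pi * z.im ^ 2) := by
  have h1 := EuclideanSpace.volume_preserving_symm_measurableEquiv_toLp (Fin 4)
  have h2 := volume_preserving_piFinSuccAbove (fun _ : Fin 4 => ℝ) 0
  have h3 := ((MeasurePreserving.id (volume : Measure ℝ)).prod (PiLp.volume_preserving_toLp (Fin 3)))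
  have h4 := (MeasurePreserving.id (volume : Measure ℝ)).prod
    (measurable_norm.measurePreserving (volume : Measure (EuclideanSpace ℝ (Fin 3))))
  have h := (h4.comp h3).comp (h2.comp h1)
  have h5 := Complex.volume_preserving_equiv_real_prod
  rw [map_norm_euclideanSpace_three, prod_withDensity_right (by fun_prop)] at h
  have hF : (fun p : EuclideanSpace ℝ (Fin 4) => Complex.measurableEquivRealProd
      (zCoord (ofCoord p))) = (Prod.map id norm ∘ Prod.map id (WithLp.toLp 2)) ∘
        (MeasurableEquiv.piFinSuccAbove (fun _ : Fin 4 => ℝ) 0) ∘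
          (MeasurableEquiv.toLp 2 (Fin 4 → ℝ)).symm := by
    funext p
    refine Prod.ext rfl ?_
    have hn : ‖(ofCoord p).im‖ = √(p 1 ^ 2 + p 2 ^ 2 + p 3 ^ 2) := by
      rw [← Real.sqrt_sq (norm_nonneg _), ← normSq_im]
      rfl
    change ‖(ofCoord p).im‖ = ‖(WithLp.toLp 2 (Fin.tail p.ofLp) : EuclideanSpace ℝ (Fin 3))‖
    rw [hn, EuclideanSpace.norm_eq]
    simp [Fin.sum_univ_three, Fin.tail]
  have hS : MeasurePreserving Complex.measurableEquivRealProd (volume.restrict halfPlane)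
      ((volume : Measure ℝ).prod (volume.restrict (Ioi 0))) := by
    have := h5.restrict_preimage_emb Complex.measurableEquivRealProd.measurableEmbedding
      (univ ×ˢ Ioi 0)
    rw [Measure.volume_eq_prod, ← Measure.prod_restrict, Measure.restrict_univ] at this
    have hp : Complex.measurableEquivRealProd ⁻¹' univ ×ˢ Ioi 0 = halfPlane := by
      ext z
      simp [halfPlane]
    rwa [hp] at this
  have hm : Measurable fun p : EuclideanSpace ℝ (Fin 4) => zCoord (ofCoord p) := by
    have := Complex.measurableEquivRealProd.symm.measurable.comp (hF ▸ h.measurable)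
    exact this
  refine ⟨hm, ?_⟩
  ext s hs
  have hs' := Complex.measurableEquivRealProd.symm.measurable hs
  rw [← hF] at h
  have h6 := h.measure_preimage hs'.nullMeasurableSet
  rw [withDensity_apply _ hs', ← hS.setLIntegral_comp_preimage_emb
    Complex.measurableEquivRealProd.measurableEmbedding] at h6
  rw [Measure.map_apply hm hs, withDensity_apply _ hs]
  exact h6

theorem measurable_zCoord_ofCoord :
    Measurable fun p : EuclideanSpace ℝ (Fin 4) => zCoord (ofCoord p) :=
  measurable_and_map_zCoord_ofCoord.1

theorem map_zCoord_ofCoord :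
    MeasureTheory.Measure.map (fun p : EuclideanSpace ℝ (Fin 4) => zCoord (ofCoord p))
        MeasureTheory.volume
      = (MeasureTheory.volume.restrict halfPlane).withDensity
          fun z => ENNReal.ofReal (4 * Real.pi * z.im ^ 2) :=
  measurable_and_map_zCoord_ofCoord.2

theorem measurable_im_sq : Measurable fun z : ℂ => ENNReal.ofReal (4 * Real.pi * z.im ^ 2) :=
  ((Complex.measurable_im.pow_const 2).const_mul _).ennreal_ofReal

/-- The push-forward measure is carried by the open half-plane, so the axis, its complement's
preimage, is null. -/
theorem ae_ofCoord_mem_offAxis :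
    ∀ᵐ p : EuclideanSpace ℝ (Fin 4), ofCoord p ∈ offAxis := by
  have h : ∀ᵐ z ∂(MeasureTheory.Measure.map
      (fun p : EuclideanSpace ℝ (Fin 4) => zCoord (ofCoord p)) MeasureTheory.volume),
      z ∈ halfPlane := by
    rw [map_zCoord_ofCoord]
    exact (MeasureTheory.withDensity_absolutelyContinuous _ _).ae_le
      (MeasureTheory.ae_restrict_mem isOpen_halfPlane.measurableSet)
  filter_upwards [MeasureTheory.ae_of_ae_map measurable_zCoord_ofCoord.aemeasurable h] with p hp
  exact norm_pos_iff.1 hp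

/-! ### Reduction of the action and of the Chern integral to the half-plane -/

section Reduction

variable {a : ℂ → ℂ →L[ℝ] ℝ} {Φ : ℂ → ℂ}

theorem IsSmoothPair.continuousOn_curlAt (h : IsSmoothPair a Φ) :
    ContinuousOn (curlAt a) halfPlane := by
  have := h.1.continuousOn_fderiv_of_isOpen isOpen_halfPlane (by simp)
  unfold curlAt
  fun_prop

theorem IsSmoothPair.continuousOn_covDeriv (h : IsSmoothPair a Φ) :
    ContinuousOn (covDeriv a Φ) halfPlane := by
  have h1 := h.2.continuousOn_fderiv_of_isOpen isOpen_halfPlane (by simp)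
  have h2 := h.2.continuousOn
  have h3 := h.1.continuousOn
  unfold covDeriv
  fun_prop

theorem IsSmoothPair.continuousOn_wedgeDensity (h : IsSmoothPair a Φ) :
    ContinuousOn (wedgeDensity a Φ) halfPlane := by
  have h1 := h.continuousOn_curlAt
  have h2 := h.continuousOn_covDeriv
  have h3 := h.2.continuousOn
  have h4 (v : ℂ) : ContinuousOn (fun z => (covDeriv a Φ z v).re) halfPlane :=
    Complex.continuous_re.comp_continuousOn (h2.clm_apply continuousOn_const)
  have h5 (v : ℂ) : ContinuousOn (fun z => (covDeriv a Φ z v).im) halfPlane :=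
    Complex.continuous_im.comp_continuousOn (h2.clm_apply continuousOn_const)
  unfold wedgeDensity
  fun_prop

theorem aemeasurable_of_continuousOn_halfPlane {f : ℂ → ℝ} (hf : ContinuousOn f halfPlane) :
    AEMeasurable f (MeasureTheory.volume.restrict halfPlane) :=
  hf.aemeasurable isOpen_halfPlane.measurableSet

open MeasureTheory in
theorem lintegral_comp_zCoord {f : ℂ → ℝ} (hf : ContinuousOn f halfPlane) :
    ∫⁻ p : EuclideanSpace ℝ (Fin 4), ENNReal.ofReal (f (zCoord (ofCoord p)))
      = ∫⁻ z in halfPlane, ENNReal.ofReal (4 * Real.pi * z.im ^ 2 * f z) := by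
  have hm := (aemeasurable_of_continuousOn_halfPlane hf).ennreal_ofReal
  rw [← lintegral_map' (f := fun z => ENNReal.ofReal (f z)) _
    measurable_zCoord_ofCoord.aemeasurable, map_zCoord_ofCoord,
    lintegral_withDensity_eq_lintegral_mul₀ measurable_im_sq.aemeasurable hm]
  · refine lintegral_congr fun z => ?_
    rw [Pi.mul_apply, ENNReal.ofReal_mul (p := 4 * Real.pi * z.im ^ 2) (by positivity)]
  · rw [map_zCoord_ofCoord]
    exact hm.mono_ac (withDensity_absolutelyContinuous _ _)

open MeasureTheory in
theorem lintegral_hypArea {f : ℂ → ℝ} (hf : ContinuousOn f halfPlane) :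
    ∫⁻ z, ENNReal.ofReal (f z) ∂hypArea
      = ∫⁻ z in halfPlane, ENNReal.ofReal (z.im⁻¹ ^ 2 * f z) := by
  have hm := (aemeasurable_of_continuousOn_halfPlane hf).ennreal_ofReal
  rw [hypArea, lintegral_withDensity_eq_lintegral_mul₀ _ hm]
  · refine lintegral_congr fun z => ?_
    rw [Pi.mul_apply, ← ENNReal.ofReal_mul (by positivity)]
    simp
  · exact (Measurable.const_div (Complex.measurable_im.pow_const 2) _).ennreal_ofReal.aemeasurable

theorem norm_hypStar_curvatureU1 (a : ℂ → ℂ →L[ℝ] ℝ) (z : ℂ) :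
    ‖hypStar z (curvatureU1 a z)‖ ^ 2 = (z.im ^ 2 * curlAt a z) ^ 2 := by
  rw [hypStar, curvatureU1_one_I, ← sq_abs (z.im ^ 2 * curlAt a z)]
  simp

theorem continuousOn_inv_im : ContinuousOn (fun z : ℂ => z.im⁻¹) halfPlane :=
  Complex.continuous_im.continuousOn.inv₀ fun _ hz => ne_of_gt hz

open MeasureTheory in
-- The weight `4π r²` cancels the `¼` of the density and turns it into `π r⁻²` times the hyperbolic
-- densities. All integrands are nonnegative, so the identity holds in `[0, ∞]` without any
-- integrability.
theorem yangMills_symConnection (h : IsSmoothPair a Φ) :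
    yangMills (symConnection a Φ) = ENNReal.ofReal Real.pi * yangMillsHiggs a Φ := by
  have h1 := h.continuousOn_curlAt
  have h2 := h.continuousOn_covDeriv
  have h3 := h.2.continuousOn
  have h4 := continuousOn_inv_im
  have h5 : ContinuousOn (fun z : ℂ => z.im) halfPlane := Complex.continuous_im.continuousOn
  have hc : ContinuousOn (actionDensity a Φ) halfPlane := by
    unfold actionDensity
    fun_prop
  have hA : yangMills (symConnection a Φ) = ∫⁻ z in halfPlane,
      ENNReal.ofReal (4 * Real.pi * z.im ^ 2 * actionDensity a Φ z) := by
    rw [← lintegral_comp_zCoord hc, yangMills]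
    refine lintegral_congr_ae ?_
    filter_upwards [ae_ofCoord_mem_offAxis] with p hp
    rw [curvatureNormSq_symConnection h hp]
  simp only [hA, yangMillsHiggs, norm_hypStar_curvatureU1]
  rw [lintegral_hypArea (by fun_prop), lintegral_hypArea (by fun_prop),
    lintegral_hypArea (by fun_prop), show (2 : ENNReal) = ENNReal.ofReal 2 by simp,
    ← lintegral_const_mul' _ _ (by simp), ← lintegral_add_left', ← lintegral_add_left',
    ← lintegral_const_mul' _ _ (by simp)]
  · refine setLIntegral_congr_fun isOpen_halfPlane.measurableSet fun z hz => ?_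
    have hz' : z.im ≠ 0 := ne_of_gt hz
    rw [← ENNReal.ofReal_mul (by positivity), ← ENNReal.ofReal_add (by positivity) (by positivity),
      ← ENNReal.ofReal_add (by positivity) (by positivity), ← ENNReal.ofReal_mul (by positivity)]
    congr 1
    rw [actionDensity]
    field_simp
  · refine (aemeasurable_of_continuousOn_halfPlane ?_).ennreal_ofReal.add
      ((aemeasurable_of_continuousOn_halfPlane ?_).ennreal_ofReal.const_mul _) <;> fun_prop
  · refine (aemeasurable_of_continuousOn_halfPlane ?_).ennreal_ofReal
    fun_prop

open MeasureTheory in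
theorem curvatureWedge_ae_eq (h : IsSmoothPair a Φ) :
    (fun p : EuclideanSpace ℝ (Fin 4) => curvatureWedge (symConnection a Φ) (ofCoord p))
      =ᵐ[volume] fun p => (fun z : ℂ => z.im⁻¹ ^ 2 * wedgeDensity a Φ z) (zCoord (ofCoord p)) := by
  filter_upwards [ae_ofCoord_mem_offAxis] with p hp
  exact curvatureWedge_symConnection h hp

open MeasureTheory in
theorem aestronglyMeasurable_wedge (h : IsSmoothPair a Φ) :
    AEStronglyMeasurable (fun z : ℂ => z.im⁻¹ ^ 2 * wedgeDensity a Φ z)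
      ((volume.restrict halfPlane).withDensity
          fun z => ENNReal.ofReal (4 * Real.pi * z.im ^ 2)) := by
  have h1 := h.continuousOn_wedgeDensity
  have h2 := continuousOn_inv_im
  have h3 : ContinuousOn (fun z : ℂ => z.im⁻¹ ^ 2 * wedgeDensity a Φ z) halfPlane := by fun_prop
  exact (h3.aestronglyMeasurable isOpen_halfPlane.measurableSet).mono_ac
    (withDensity_absolutelyContinuous _ _)

theorem smul_wedge_eqOn : Set.EqOn (fun z : ℂ => (ENNReal.ofReal (4 * Real.pi * z.im ^ 2)).toReal •
    (z.im⁻¹ ^ 2 * wedgeDensity a Φ z)) (fun z => 4 * Real.pi * wedgeDensity a Φ z) halfPlane := by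
  intro z hz
  have hz' : z.im ≠ 0 := ne_of_gt hz
  simp only
  rw [ENNReal.toReal_ofReal (by positivity), smul_eq_mul]
  field_simp

open MeasureTheory in
theorem hasSecondChern_symConnection_iff (h : IsSmoothPair a Φ) :
    HasSecondChern (symConnection a Φ) ↔ IntegrableOn (wedgeDensity a Φ) halfPlane := by
  rw [HasSecondChern, integrable_congr (curvatureWedge_ae_eq h)]
  have h1 := aestronglyMeasurable_wedge h
  rw [← map_zCoord_ofCoord] at h1
  have h2 := integrable_map_measure h1 measurable_zCoord_ofCoord.aemeasurable
  rw [← Function.comp_def (fun z : ℂ => z.im⁻¹ ^ 2 * wedgeDensity a Φ z), ← h2,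
    map_zCoord_ofCoord, integrable_withDensity_iff_integrable_smul' measurable_im_sq (by simp),
    ← IntegrableOn, integrableOn_congr_fun smul_wedge_eqOn isOpen_halfPlane.measurableSet,
    IntegrableOn, integrable_const_mul_iff (isUnit_iff_ne_zero.2 (by positivity)), IntegrableOn]

open MeasureTheory in
theorem secondChern_symConnection (h : IsSmoothPair a Φ) :
    secondChern (symConnection a Φ) = -(1 / Real.pi) * ∫ z in halfPlane, wedgeDensity a Φ z := by
  have h1 := aestronglyMeasurable_wedge h
  rw [← map_zCoord_ofCoord] at h1
  rw [secondChern, integral_congr_ae (curvatureWedge_ae_eq h),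
    ← integral_map measurable_zCoord_ofCoord.aemeasurable h1, map_zCoord_ofCoord,
    integral_withDensity_eq_integral_toReal_smul measurable_im_sq (by simp),
    setIntegral_congr_fun isOpen_halfPlane.measurableSet smul_wedge_eqOn, integral_const_mul]
  field_simp

end Reduction

/-! ### Stokes' theorem for the current -/

/-- The real one-form `Im (Φ̄ d_a Φ)`. -/
def current (a : ℂ → ℂ →L[ℝ] ℝ) (Φ : ℂ → ℂ) (v z : ℂ) : ℝ :=
  ((starRingEnd ℂ) (Φ z) * covDeriv a Φ z v).im

/-- The coefficient of `d (Im (Φ̄ d_a Φ))`. -/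
def currentCurl (a : ℂ → ℂ →L[ℝ] ℝ) (Φ : ℂ → ℂ) (z : ℂ) : ℝ :=
  curlAt a z * ‖Φ z‖ ^ 2 + 2 * ((covDeriv a Φ z 1).re * (covDeriv a Φ z Complex.I).im
    - (covDeriv a Φ z 1).im * (covDeriv a Φ z Complex.I).re)

section Current

variable {a : ℂ → ℂ →L[ℝ] ℝ} {Φ : ℂ → ℂ}

theorem hasFDerivAt_current {z : ℂ} (ha : DifferentiableAt ℝ a z) (hΦ : ContDiffAt ℝ 2 Φ z)
    (v : ℂ) : ∃ L : ℂ →L[ℝ] ℝ, HasFDerivAt (current a Φ v) L z ∧ ∀ w, L w =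
      ((starRingEnd ℂ) (fderiv ℝ Φ z w) * covDeriv a Φ z v
        + (starRingEnd ℂ) (Φ z) * (fderiv ℝ (fderiv ℝ Φ) z w v
          + Complex.I * fderiv ℝ Φ z w * a z v + Complex.I * Φ z * fderiv ℝ a z w v)).im := by
  have h1 : HasFDerivAt Φ (fderiv ℝ Φ z) z := (hΦ.differentiableAt (by simp)).hasFDerivAt
  have h2 : HasFDerivAt (fderiv ℝ Φ) (fderiv ℝ (fderiv ℝ Φ) z) z :=
    ((hΦ.fderiv_right (m := 1) (by norm_num)).differentiableAt (by norm_num)).hasFDerivAt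
  have h3 : HasFDerivAt (fun y => ((a y v : ℝ) : ℂ)) _ z :=
    Complex.ofRealCLM.hasFDerivAt.comp z (ha.hasFDerivAt.clm_apply (hasFDerivAt_const v z))
  have h4 : HasFDerivAt (fun y => (starRingEnd ℂ) (Φ y))
      ((Complex.conjCLE : ℂ →L[ℝ] ℂ).comp (fderiv ℝ Φ z)) z :=
    (Complex.conjCLE : ℂ →L[ℝ] ℂ).hasFDerivAt.comp z h1
  have h5 : HasFDerivAt (𝕜 := ℝ) (fun y => fderiv ℝ Φ y v + Complex.I * Φ y * a y v) _ z :=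
    (h2.clm_apply (hasFDerivAt_const v z)).add ((h1.const_mul Complex.I).mul h3)
  simp only [← covDeriv_apply] at h5
  refine ⟨_, Complex.imCLM.hasFDerivAt.comp z (h4.mul h5), fun w => ?_⟩
  simp
  ring

/-- The second derivatives of `Φ` cancel by symmetry. What remains is `|Φ|² da` and the wedge
product of the conjugate of `d_a Φ` with `d_a Φ`. -/
theorem fderiv_current_sub {z : ℂ} (ha : DifferentiableAt ℝ a z) (hΦ : ContDiffAt ℝ 2 Φ z) :
    fderiv ℝ (current a Φ Complex.I) z 1 - fderiv ℝ (current a Φ 1) z Complex.I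
      = currentCurl a Φ z := by
  obtain ⟨L, hL, hL'⟩ := hasFDerivAt_current ha hΦ Complex.I
  obtain ⟨M, hM, hM'⟩ := hasFDerivAt_current ha hΦ 1
  have hsymm : fderiv ℝ (fderiv ℝ Φ) z 1 Complex.I = fderiv ℝ (fderiv ℝ Φ) z Complex.I 1 :=
    (hΦ.isSymmSndFDerivAt (by simp)).eq 1 Complex.I
  rw [hL.fderiv, hM.fderiv, hL', hM', hsymm, currentCurl, ← Complex.normSq_eq_norm_sq,
    Complex.normSq_apply, curlAt]
  simp [covDeriv_apply]
  ring

theorem abs_current_le (a : ℂ → ℂ →L[ℝ] ℝ) (Φ : ℂ → ℂ) {v : ℂ} (hv : ‖v‖ = 1) (z : ℂ) :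
    |current a Φ v z| ≤ ‖(Complex.I * (starRingEnd ℂ) (Φ z)) • covDeriv a Φ z‖ := by
  refine (Complex.abs_im_le_norm _).trans ?_
  have := ((Complex.I * (starRingEnd ℂ) (Φ z)) • covDeriv a Φ z).le_opNorm v
  simpa [hv] using this

/-- The continuous function `|t| + r + r⁻¹` is bounded on every compact set, so points where it is
large lie outside a given one. This makes the cocompact filter usable on the sides of large
rectangles. -/
theorem CurrentVanishesAtInfinity.exists_bound (h : CurrentVanishesAtInfinity a Φ) {ε : ℝ}
    (hε : 0 < ε) : ∃ C : ℝ, ∀ z : ℂ, 0 < z.im → C < |z.re| + z.im + z.im⁻¹ →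
      ‖(Complex.I * (starRingEnd ℂ) (Φ z)) • covDeriv a Φ z‖ ≤ 2 * ε / (‖z + Complex.I‖ ^ 2) := by
  have h1 := h.eventually (gt_mem_nhds hε)
  obtain ⟨K, hK, hK'⟩ := Filter.mem_cocompact.1 h1
  have hc : Continuous fun z : UpperHalfPlane => |z.re| + z.im + z.im⁻¹ :=
    (UpperHalfPlane.continuous_re.abs.add UpperHalfPlane.continuous_im).add
      (UpperHalfPlane.continuous_im.inv₀ fun z => z.im_pos.ne')
  obtain ⟨C, hC⟩ := hK.exists_bound_of_continuousOn hc.continuousOn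
  refine ⟨C, fun z hz hzC => ?_⟩
  have hzK : (⟨z, hz⟩ : UpperHalfPlane) ∉ K := fun hmem =>
    (hzC.trans_le (le_abs_self _)).not_ge (hC _ hmem)
  have h2 := hK' hzK
  have h3 : 0 < ‖z + Complex.I‖ ^ 2 := by
    have : z + Complex.I ≠ 0 := fun h0 => by
      have := congrArg Complex.im h0
      simp at this
      linarith
    positivity
  rw [le_div_iff₀ h3]
  have h4 : ‖(Complex.I * (starRingEnd ℂ) (Φ z)) • covDeriv a Φ z‖
      * (‖z + Complex.I‖ ^ 2 / 2) < ε := h2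
  linarith

/-- The whole line carries `∫ (1 + x²)⁻¹ = π`, so the bound does not depend on the length of the
side. -/
theorem abs_intervalIntegral_le_of_le_inv {φ : ℝ → ℝ} {s t ε : ℝ} (hst : s ≤ t) (hε : 0 < ε)
    (h : ∀ x ∈ Set.Icc s t, |φ x| ≤ 2 * ε * (1 + x ^ 2)⁻¹) :
    |∫ x in s..t, φ x| ≤ 2 * ε * Real.pi := by
  have hc : Continuous fun x : ℝ => 2 * ε * (1 + x ^ 2)⁻¹ :=
    continuous_const.mul ((by fun_prop : Continuous fun x : ℝ => 1 + x ^ 2).inv₀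
      fun x => by positivity)
  refine (intervalIntegral.norm_integral_le_of_norm_le hst
    (Filter.Eventually.of_forall fun x hx => show ‖φ x‖ ≤ 2 * ε * (1 + x ^ 2)⁻¹ from
      h x (Set.Ioc_subset_Icc_self hx))
    (hc.intervalIntegrable s t)).trans ?_
  rw [intervalIntegral.integral_const_mul, integral_inv_one_add_sq]
  have h1 := Real.arctan_lt_pi_div_two t
  have h2 := Real.neg_pi_div_two_lt_arctan s
  gcongr
  linarith

/-- The rectangle `[-n, n] × [n⁻¹, n]`. -/
def rectangle (n : ℝ) : Set ℂ := Set.Icc (-n) n ×ℂ Set.Icc n⁻¹ n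

theorem rectangle_subset {n : ℝ} (hn : 0 < n) : rectangle n ⊆ halfPlane := fun _ hz =>
  (inv_pos.2 hn).trans_le hz.2.1

open MeasureTheory Set in
theorem setIntegral_rectangle {f : ℂ → ℝ} {n : ℝ} (hn : 1 ≤ n)
    (hf : ContinuousOn f (rectangle n)) :
    ∫ z in rectangle n, f z = ∫ x in (-n)..n, ∫ y in n⁻¹..n, f ⟨x, y⟩ := by
  have h := Complex.volume_preserving_equiv_real_prod.symm
  have hp : Complex.measurableEquivRealProd.symm ⁻¹' rectangle n = Icc (-n) n ×ˢ Icc n⁻¹ n := by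
    ext p
    simp only [rectangle, Complex.mem_reProdIm, Set.mem_preimage, mem_prod]
    rfl
  have hK : IsCompact (Icc (-n) n ×ˢ Icc n⁻¹ n) := isCompact_Icc.prod isCompact_Icc
  have hc : ContinuousOn (fun p : ℝ × ℝ => f (Complex.measurableEquivRealProd.symm p))
      (Icc (-n) n ×ˢ Icc n⁻¹ n) := by
    have hcm : Continuous fun p : ℝ × ℝ => Complex.measurableEquivRealProd.symm p :=
      Complex.equivRealProdCLM.symm.continuous
    exact hf.comp hcm.continuousOn fun p hp' => by rwa [← hp] at hp'
  rw [← h.setIntegral_preimage_emb Complex.measurableEquivRealProd.symm.measurableEmbedding, hp,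
    Measure.volume_eq_prod, setIntegral_prod _ (hc.integrableOn_compact hK),
    intervalIntegral.integral_of_le (by linarith), integral_Icc_eq_integral_Ioc]
  refine setIntegral_congr_fun measurableSet_Ioc fun x _ => ?_
  rw [intervalIntegral.integral_of_le ((inv_le_one_of_one_le₀ hn).trans hn),
    integral_Icc_eq_integral_Ioc]
  rfl

theorem IsSmoothPair.continuousOn_current (h : IsSmoothPair a Φ) (v : ℂ) :
    ContinuousOn (current a Φ v) halfPlane :=
  Complex.continuous_im.comp_continuousOn ((Complex.continuous_conj.comp_continuousOn
    h.2.continuousOn).mul (h.continuousOn_covDeriv.clm_apply continuousOn_const))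

theorem IsSmoothPair.continuousOn_currentCurl (h : IsSmoothPair a Φ) :
    ContinuousOn (currentCurl a Φ) halfPlane := by
  have he : currentCurl a Φ = fun z => curlAt a z - 2 * wedgeDensity a Φ z := by
    funext z; rw [currentCurl, wedgeDensity]; ring
  rw [he]
  exact h.continuousOn_curlAt.sub (continuousOn_const.mul h.continuousOn_wedgeDensity)

theorem IsSmoothPair.hasFDerivAt_current (h : IsSmoothPair a Φ) {z : ℂ} (hz : z ∈ halfPlane)
    (v : ℂ) : HasFDerivAt (current a Φ v) (fderiv ℝ (current a Φ v) z) z := by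
  obtain ⟨L, hL, -⟩ := DimRed.hasFDerivAt_current
    ((h.contDiffAt_fst hz).differentiableAt (by simp))
    ((h.contDiffAt_snd hz).of_le two_le_smooth) v
  exact hL.differentiableAt.hasFDerivAt

open MeasureTheory Set in
-- Green's formula, from the divergence theorem for the field `(J_r, -J_t)`, whose divergence is the
-- curl of the current `J`.
theorem setIntegral_rectangle_currentCurl (h : IsSmoothPair a Φ) {n : ℝ} (hn : 1 ≤ n) :
    ∫ z in rectangle n, currentCurl a Φ z
      = (((∫ x in (-n)..n, -current a Φ 1 ⟨x, n⟩) - ∫ x in (-n)..n, -current a Φ 1 ⟨x, n⁻¹⟩)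
        + ∫ y in n⁻¹..n, current a Φ Complex.I ⟨n, y⟩)
        - ∫ y in n⁻¹..n, current a Φ Complex.I ⟨-n, y⟩ := by
  have hn0 : 0 < n := by linarith
  have hsub := rectangle_subset hn0
  have hmk : Continuous fun p : ℝ × ℝ => (⟨p.1, p.2⟩ : ℂ) :=
    Complex.equivRealProdCLM.symm.continuous
  have hmk' (p : ℝ × ℝ) : HasFDerivAt (fun p : ℝ × ℝ => (⟨p.1, p.2⟩ : ℂ))
      (Complex.equivRealProdCLM.symm : ℝ × ℝ →L[ℝ] ℂ) p :=
    Complex.equivRealProdCLM.symm.hasFDerivAt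
  have hu1 : uIcc (-n) n = Icc (-n) n := uIcc_of_le (by linarith)
  have hn1 : n⁻¹ ≤ n := (inv_le_one_of_one_le₀ hn).trans hn
  have hu2 : uIcc n⁻¹ n = Icc n⁻¹ n := uIcc_of_le hn1
  have hmem : ∀ p ∈ uIcc (-n) n ×ˢ uIcc n⁻¹ n, (⟨p.1, p.2⟩ : ℂ) ∈ halfPlane := fun p hp => by
    rw [hu1, hu2] at hp
    exact hsub ⟨hp.1, hp.2⟩
  have hmem' : ∀ p ∈ Ioo (min (-n) n) (max (-n) n) ×ˢ Ioo (min n⁻¹ n) (max n⁻¹ n),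
      (⟨p.1, p.2⟩ : ℂ) ∈ halfPlane := fun p hp =>
    hmem p ⟨Ioo_subset_Icc_self hp.1, Ioo_subset_Icc_self hp.2⟩
  have hcurl (z : ℂ) (hz : z ∈ halfPlane) := fderiv_current_sub
    ((h.contDiffAt_fst hz).differentiableAt (by simp))
    ((h.contDiffAt_snd hz).of_le two_le_smooth)
  have he (z : ℂ) (hz : z ∈ halfPlane) : ((fderiv ℝ (current a Φ Complex.I) z).comp
      (Complex.equivRealProdCLM.symm : ℝ × ℝ →L[ℝ] ℂ)) (1, 0)
      + (-(fderiv ℝ (current a Φ 1) z).comp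
        (Complex.equivRealProdCLM.symm : ℝ × ℝ →L[ℝ] ℂ)) (0, 1) = currentCurl a Φ z := by
    rw [← hcurl z hz, sub_eq_add_neg]
    congr 1
  rw [← integral2_divergence_prod_of_hasFDerivAt
    (fun p : ℝ × ℝ => current a Φ Complex.I ⟨p.1, p.2⟩)
    (fun p : ℝ × ℝ => -current a Φ 1 ⟨p.1, p.2⟩)
    (fun p => (fderiv ℝ (current a Φ Complex.I) ⟨p.1, p.2⟩).comp
      (Complex.equivRealProdCLM.symm : ℝ × ℝ →L[ℝ] ℂ))
    (fun p => -(fderiv ℝ (current a Φ 1) ⟨p.1, p.2⟩).comp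
      (Complex.equivRealProdCLM.symm : ℝ × ℝ →L[ℝ] ℂ)) (-n) n⁻¹ n n
    ((h.continuousOn_current _).comp hmk.continuousOn hmem)
    ((h.continuousOn_current _).comp hmk.continuousOn hmem).neg
    (fun p hp => HasFDerivAt.comp (g := current a Φ _) p (h.hasFDerivAt_current (hmem' p hp) _) (hmk' p))
    (fun p hp => (HasFDerivAt.comp (g := current a Φ _) p
      (h.hasFDerivAt_current (hmem' p hp) _) (hmk' p)).neg),
    setIntegral_rectangle hn (h.continuousOn_currentCurl.mono hsub)]
  · refine intervalIntegral.integral_congr fun x hx => intervalIntegral.integral_congr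
      fun y hy => ?_
    exact (he _ (hmem (x, y) ⟨hx, hy⟩)).symm
  · refine ContinuousOn.integrableOn_compact (isCompact_uIcc.prod isCompact_uIcc) ?_
    refine ContinuousOn.congr (f := fun p : ℝ × ℝ => currentCurl a Φ ⟨p.1, p.2⟩)
      (h.continuousOn_currentCurl.comp hmk.continuousOn hmem) fun p hp => he _ (hmem p hp)

open MeasureTheory Set in
-- On each side one of `|t|`, `r`, `r⁻¹` equals `n > C`, and `|z + i|² = t² + (r + 1)²` is at least
-- `1 + s²` for the running coordinate `s`. Each of the four sides thus contributes at most `2πε`.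
theorem abs_setIntegral_rectangle_le (h : IsSmoothPair a Φ) {ε C n : ℝ} (hε : 0 < ε)
    (hC : ∀ z : ℂ, 0 < z.im → C < |z.re| + z.im + z.im⁻¹ →
      ‖(Complex.I * (starRingEnd ℂ) (Φ z)) • covDeriv a Φ z‖ ≤ 2 * ε / (‖z + Complex.I‖ ^ 2))
    (hn : 1 ≤ n) (hCn : C < n) :
    |∫ z in rectangle n, currentCurl a Φ z| ≤ 8 * Real.pi * ε := by
  have hn0 : 0 < n := by linarith
  have hn1 : n⁻¹ ≤ n := (inv_le_one_of_one_le₀ hn).trans hn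
  have hni : 0 < n⁻¹ := inv_pos.2 hn0
  have key (z : ℂ) (hz : 0 < z.im) (hzC : n ≤ |z.re| + z.im + z.im⁻¹) (s : ℝ)
      (hs : 1 + s ^ 2 ≤ z.re ^ 2 + (z.im + 1) ^ 2) (v : ℂ) (hv : ‖v‖ = 1) :
      |current a Φ v z| ≤ 2 * ε * (1 + s ^ 2)⁻¹ := by
    refine (abs_current_le a Φ hv z).trans ((hC z hz (hCn.trans_le hzC)).trans ?_)
    rw [← div_eq_mul_inv, ← Complex.normSq_eq_norm_sq, Complex.normSq_apply]
    have : 0 < 1 + s ^ 2 := by positivity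
    refine div_le_div_of_nonneg_left (by positivity) this ?_
    simp
    linarith
  have k1 := abs_intervalIntegral_le_of_le_inv (φ := fun x => -current a Φ 1 ⟨x, n⟩)
    (s := -n) (t := n) (by linarith) hε fun x _ => by
      rw [abs_neg]
      refine key _ hn0 ?_ x ?_ 1 (by simp)
      · simp only
        linarith [abs_nonneg x]
      · simp only
        nlinarith
  have k2 := abs_intervalIntegral_le_of_le_inv (φ := fun x => -current a Φ 1 ⟨x, n⁻¹⟩)
    (s := -n) (t := n) (by linarith) hε fun x _ => by
      rw [abs_neg]
      refine key _ hni ?_ x ?_ 1 (by simp)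
      · simp only [inv_inv]
        linarith [abs_nonneg x]
      · simp only
        nlinarith
  have k3 := abs_intervalIntegral_le_of_le_inv (φ := fun y => current a Φ Complex.I ⟨n, y⟩)
    hn1 hε fun y hy => by
      have hy0 : 0 < y := hni.trans_le hy.1
      refine key _ hy0 ?_ y ?_ Complex.I (by simp)
      · simp only [abs_of_pos hn0]
        linarith [inv_pos.2 hy0]
      · simp only
        nlinarith
  have k4 := abs_intervalIntegral_le_of_le_inv (φ := fun y => current a Φ Complex.I ⟨-n, y⟩)
    hn1 hε fun y hy => by
      have hy0 : 0 < y := hni.trans_le hy.1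
      refine key _ hy0 ?_ y ?_ Complex.I (by simp)
      · simp only [abs_neg, abs_of_pos hn0]
        linarith [inv_pos.2 hy0]
      · simp only
        nlinarith
  rw [setIntegral_rectangle_currentCurl h hn]
  rw [abs_le] at *
  constructor <;> linarith [k1.1, k1.2, k2.1, k2.2, k3.1, k3.2, k4.1, k4.2]

theorem iUnion_rectangle : ⋃ n : ℕ, rectangle (n + 1) = halfPlane := by
  refine Set.Subset.antisymm (Set.iUnion_subset fun n => rectangle_subset (by positivity))
    fun z hz => ?_
  have hz' : 0 < z.im := hz
  obtain ⟨n, hn⟩ := exists_nat_ge (|z.re| + z.im + z.im⁻¹)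
  have hi := inv_pos.2 hz'
  have h0 := abs_nonneg z.re
  have h1 := abs_le.1 (show |z.re| ≤ n + 1 by linarith)
  refine Set.mem_iUnion.2 ⟨n, ⟨h1.1, h1.2⟩, ?_, ?_⟩
  · exact inv_le_of_inv_le₀ hz' (by linarith)
  · linarith

theorem monotone_rectangle : Monotone fun n : ℕ => rectangle ((n : ℝ) + 1) := by
  intro m n hmn z hz
  have h : (m : ℝ) + 1 ≤ n + 1 := by exact_mod_cast Nat.add_le_add_right hmn 1
  exact ⟨⟨(neg_le_neg h).trans hz.1.1, hz.1.2.trans h⟩,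
    (inv_anti₀ (by positivity) h).trans hz.2.1, hz.2.2.trans h⟩

open MeasureTheory in
theorem integral_currentCurl_eq_zero (h : IsSmoothPair a Φ)
    (hi : IntegrableOn (currentCurl a Φ) halfPlane) (hv : CurrentVanishesAtInfinity a Φ) :
    ∫ z in halfPlane, currentCurl a Φ z = 0 := by
  have hm (n : ℕ) : MeasurableSet (rectangle ((n : ℝ) + 1)) :=
    (Complex.measurable_re measurableSet_Icc).inter (Complex.measurable_im measurableSet_Icc)
  have ht := tendsto_setIntegral_of_monotone hm monotone_rectangle (by rwa [iUnion_rectangle])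
  rw [iUnion_rectangle] at ht
  refine tendsto_nhds_unique ht (Metric.tendsto_atTop.2 fun δ hδ => ?_)
  -- With this `ε` the bound `8πε` is `δ / 2`.
  have hε : 0 < δ / (16 * Real.pi) := by positivity
  obtain ⟨C, hC⟩ := hv.exists_bound hε
  obtain ⟨N, hN⟩ := exists_nat_gt C
  refine ⟨N, fun n hn => ?_⟩
  have hn' : (N : ℝ) ≤ n := by exact_mod_cast hn
  have := abs_setIntegral_rectangle_le h hε hC (n := n + 1) (by linarith [n.cast_nonneg (α := ℝ)])
    (by linarith)
  rw [Real.dist_0_eq_abs]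
  refine this.trans_lt ?_
  rw [show 8 * Real.pi * (δ / (16 * Real.pi)) = δ / 2 by field_simp; norm_num]
  linarith

open MeasureTheory in
-- As `currentCurl` is the curl of `a` minus twice `wedgeDensity` and integrates to zero, both Chern
-- numbers equal `-1 / 2π` times the integral of `da`.
theorem secondChern_eq_firstChern (h : IsSmoothPair a Φ)
    (h2 : HasSecondChern (symConnection a Φ)) (h1 : HasFirstChern a)
    (hv : CurrentVanishesAtInfinity a Φ) :
    (secondChern (symConnection a Φ) : ℂ) = firstChern a := by
  rw [hasSecondChern_symConnection_iff h] at h2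
  have h1' : IntegrableOn (curlAt a) halfPlane := by
    have := h1.const_mul (-Complex.I)
    simp only [curvatureU1_one_I, ← mul_assoc, neg_mul, Complex.I_mul_I, neg_neg, one_mul] at this
    exact this.re
  have he (z : ℂ) : currentCurl a Φ z = curlAt a z - 2 * wedgeDensity a Φ z := by
    rw [currentCurl, wedgeDensity]; ring
  have hi : IntegrableOn (currentCurl a Φ) halfPlane := by
    simp only [funext he]
    exact h1'.sub (h2.const_mul 2)
  have h0 := integral_currentCurl_eq_zero h hi hv
  simp only [he] at h0
  rw [integral_sub h1' (h2.const_mul 2), integral_const_mul] at h0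
  rw [secondChern_symConnection h, firstChern]
  simp only [curvatureU1_one_I]
  rw [integral_const_mul, integral_complex_ofReal, show ∫ z in halfPlane, wedgeDensity a Φ z
    = (∫ z in halfPlane, curlAt a z) / 2 by linarith, ← mul_assoc, div_mul_eq_mul_div,
    Complex.I_mul_I]
  push_cast
  field_simp

end Current

/-! ### Invariant connections off the fixed circle -/

section Conjugation

theorem re_mul_comm (x y : ℍ[ℝ]) : (x * y).re = (y * x).re := by
  simp
  ring

theorem re_conj {g : ℍ[ℝ]} (hg : g ≠ 0) (x : ℍ[ℝ]) : (g * x * g⁻¹).re = x.re := by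
  rw [re_mul_comm, ← mul_assoc, inv_mul_cancel₀ hg, one_mul]

theorem im_conj {g : ℍ[ℝ]} (hg : g ≠ 0) (x : ℍ[ℝ]) : (g * x * g⁻¹).im = g * x.im * g⁻¹ := by
  rw [← Quaternion.sub_re_self, re_conj hg, ← Quaternion.sub_re_self x, mul_sub, sub_mul,
    ← Quaternion.coe_commutes, mul_assoc (x.re : ℍ[ℝ]), mul_inv_cancel₀ hg, mul_one]

theorem norm_conj {g : ℍ[ℝ]} (hg : g ≠ 0) (x : ℍ[ℝ]) : ‖g * x * g⁻¹‖ = ‖x‖ := by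
  have := norm_pos_iff.2 hg
  rw [norm_mul, norm_mul, norm_inv]
  field_simp

theorem dot_conj {g : ℍ[ℝ]} (hg : g ≠ 0) (x y : ℍ[ℝ]) :
    dot (g * x * g⁻¹) (g * y * g⁻¹) = dot x y := by
  have h (x y : ℍ[ℝ]) : dot x y = -(x.im * y.im).re := by simp [dot]; ring
  rw [h, h, im_conj hg, im_conj hg, show g * x.im * g⁻¹ * (g * y.im * g⁻¹)
    = g * (x.im * y.im) * g⁻¹ by simp [mul_assoc, hg], re_conj hg]

theorem conj_mem_offAxis {g x : ℍ[ℝ]} (hg : g ≠ 0) (hx : x ∈ offAxis) :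
    g * x * g⁻¹ ∈ offAxis := by
  intro h
  rw [im_conj hg] at h
  simp [hg] at h
  exact hx h

theorem zCoord_conj {g : ℍ[ℝ]} (hg : g ≠ 0) (x : ℍ[ℝ]) : zCoord (g * x * g⁻¹) = zCoord x := by
  apply Complex.ext
  · exact re_conj hg x
  · rw [zCoord_im, zCoord_im, im_conj hg, norm_conj hg]

theorem smul_conj (c : ℝ) (g x : ℍ[ℝ]) : g * (c • x) * g⁻¹ = c • (g * x * g⁻¹) := by
  rw [mul_smul_comm, smul_mul_assoc]

theorem Q_conj {g : ℍ[ℝ]} (hg : g ≠ 0) (x : ℍ[ℝ]) : Q (g * x * g⁻¹) = g * Q x * g⁻¹ := by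
  rw [Q, Q, im_conj hg, norm_conj hg, smul_conj]

theorem fderiv_zCoord_conj {g x : ℍ[ℝ]} (hg : g ≠ 0) (hx : x ∈ offAxis) (v : ℍ[ℝ]) :
    fderiv ℝ zCoord (g * x * g⁻¹) (g * v * g⁻¹) = fderiv ℝ zCoord x v := by
  rw [fderiv_zCoord (conj_mem_offAxis hg hx), fderiv_zCoord hx, re_conj hg, Q_conj hg, dot_conj hg]

theorem fderiv_Q_conj {g x : ℍ[ℝ]} (hg : g ≠ 0) (hx : x ∈ offAxis) (v : ℍ[ℝ]) :
    fderiv ℝ Q (g * x * g⁻¹) (g * v * g⁻¹) = g * fderiv ℝ Q x v * g⁻¹ := by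
  rw [fderiv_Q (conj_mem_offAxis hg hx), fderiv_Q hx, Q_conj hg, dot_conj hg, im_conj hg,
    im_conj hg, norm_conj hg, smul_conj, mul_sub, sub_mul, smul_conj]

theorem isInvariantOn_symConnection (a : ℂ → ℂ →L[ℝ] ℝ) (Φ : ℂ → ℂ) :
    IsInvariantOn (symConnection a Φ) offAxis := by
  intro g hg1 x hx v
  have hg : g ≠ 0 := norm_pos_iff.1 (by rw [hg1]; exact one_pos)
  rw [symConnection_apply, symConnection_apply, zCoord_conj hg, fderiv_zCoord_conj hg hx,
    fderiv_Q_conj hg hx, Q_conj hg, show g * Q x * g⁻¹ * (g * fderiv ℝ Q x v * g⁻¹)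
      = g * (Q x * fderiv ℝ Q x v) * g⁻¹ by simp [mul_assoc, hg], smul_conj]
  simp only [mul_add, add_mul, smul_conj]

/-- Conjugation does not see the norm of `g`, so invariance extends to every `g ≠ 0`. The form
without inverses suits unnormalized elements such as `1 + i`. -/
theorem IsInvariantOn.mul_eq {A : ℍ[ℝ] → ℍ[ℝ] →L[ℝ] ℍ[ℝ]} {U : Set ℍ[ℝ]}
    (hA : IsInvariantOn A U) {g x x' v v' : ℍ[ℝ]} (hg : g ≠ 0) (hx : x ∈ U)
    (hx' : x' * g = g * x) (hv : v' * g = g * v) : A x' v' * g = g * A x v := by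
  have hn : ‖g‖ ≠ 0 := norm_ne_zero_iff.2 hg
  have key (y : ℍ[ℝ]) : (‖g‖⁻¹ • g) * y * (‖g‖⁻¹ • g)⁻¹ = g * y * g⁻¹ := by
    rw [smul_inv₀, inv_inv, smul_mul_assoc, smul_mul_assoc, mul_smul_comm, smul_smul,
      inv_mul_cancel₀ hn, one_smul]
  have h := hA (‖g‖⁻¹ • g) (by rw [norm_smul, norm_inv, norm_norm, inv_mul_cancel₀ hn]) x hx v
  rw [key, key, key, ← hx', ← hv, mul_inv_cancel_right₀ hg, mul_inv_cancel_right₀ hg] at h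
  rw [h, inv_mul_cancel_right₀ hg]

end Conjugation

section Smooth

variable {a : ℂ → ℂ →L[ℝ] ℝ} {Φ : ℂ → ℂ}

theorem contDiffAt_fderiv {E F : Type*} [NormedAddCommGroup E] [NormedSpace ℝ E]
    [NormedAddCommGroup F] [NormedSpace ℝ F] {f : E → F} {x : E} (h : ContDiffAt ℝ ∞ f x) :
    ContDiffAt ℝ ∞ (fderiv ℝ f) x := h.fderiv_right (by simp)

theorem contDiffOn_symConnection (h : IsSmoothPair a Φ) :
    ContDiffOn ℝ ∞ (symConnection a Φ) offAxis := by
  intro x hx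
  have hz := zCoord_mem hx
  have h1 := (h.contDiffAt_fst hz).comp x (contDiffAt_zCoord hx)
  have h2 := (h.contDiffAt_snd hz).comp x (contDiffAt_zCoord hx)
  have h3 := Complex.reCLM.contDiff.contDiffAt.comp x h2
  have h4 := Complex.imCLM.contDiff.contDiffAt.comp x h2
  have h5 := contDiffAt_fderiv (contDiffAt_zCoord hx)
  have h6 := contDiffAt_fderiv (contDiffAt_Q hx)
  have h7 := contDiffAt_Q hx
  have h8 := (ContinuousLinearMap.mul ℝ ℍ[ℝ]).contDiff.contDiffAt.comp x h7
  exact ((contDiffAt_const (c := (1 / 2 : ℝ))).smul ((((h1.clm_comp h5).smulRight h7).add (h3.smul h6)).add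
    ((h4.sub (contDiffAt_const (c := (1 : ℝ)))).smul (h8.clm_comp h6)))).contDiffWithinAt

theorem isImaginaryOn_symConnection (a : ℂ → ℂ →L[ℝ] ℝ) (Φ : ℂ → ℂ) :
    IsImaginaryOn (symConnection a Φ) offAxis := by
  intro x hx v
  have hq := dot_Q_self hx
  rw [symConnection_apply, fderiv_Q hx, mul_smul_comm]
  simp [dot] at *
  right; right
  linear_combination ((Q x).imI * v.imI + (Q x).imJ * v.imJ + (Q x).imK * v.imK) * hq

end Smooth

/-! ### The pair of an invariant connection -/

/-- The one-form `a` of the pair of the connection form `A`. -/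
def pairForm (A : ℍ[ℝ] → ℍ[ℝ] →L[ℝ] ℍ[ℝ]) (z : ℂ) : ℂ →L[ℝ] ℝ :=
  (2 : ℝ) • (innerSL ℝ (e 1)).comp
    ((A (z : ℍ[ℝ])).comp Quaternion.ofComplex.toLinearMap.toContinuousLinearMap)

/-- The function `Φ` of the pair of the connection form `A`. -/
def pairField (A : ℍ[ℝ] → ℍ[ℝ] →L[ℝ] ℍ[ℝ]) (z : ℂ) : ℂ :=
  ((2 * z.im * inner ℝ (e 2) (A (z : ℍ[ℝ]) (e 2)) : ℝ) : ℂ)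
    + ((2 * z.im * inner ℝ (e 3) (A (z : ℍ[ℝ]) (e 2)) + 1 : ℝ) : ℂ) * Complex.I

section Pair

variable {A : ℍ[ℝ] → ℍ[ℝ] →L[ℝ] ℍ[ℝ]}

theorem inner_e_one (v : ℍ[ℝ]) : inner ℝ (e 1) v = v.imI := by simp [Quaternion.inner_def]
theorem inner_e_two (v : ℍ[ℝ]) : inner ℝ (e 2) v = v.imJ := by simp [Quaternion.inner_def]
theorem inner_e_three (v : ℍ[ℝ]) : inner ℝ (e 3) v = v.imK := by simp [Quaternion.inner_def]

theorem pairForm_apply (A : ℍ[ℝ] → ℍ[ℝ] →L[ℝ] ℍ[ℝ]) (z v : ℂ) :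
    pairForm A z v = 2 * (A (z : ℍ[ℝ]) (v : ℍ[ℝ])).imI := by
  rw [← inner_e_one]
  rfl

theorem pairField_re (A : ℍ[ℝ] → ℍ[ℝ] →L[ℝ] ℍ[ℝ]) (z : ℂ) :
    (pairField A z).re = 2 * z.im * (A (z : ℍ[ℝ]) (e 2)).imJ := by
  simp [pairField, inner_e_two]

theorem pairField_im (A : ℍ[ℝ] → ℍ[ℝ] →L[ℝ] ℍ[ℝ]) (z : ℂ) :
    (pairField A z).im = 2 * z.im * (A (z : ℍ[ℝ]) (e 2)).imK + 1 := by
  simp [pairField, inner_e_three]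

theorem contDiff_coeComplex : ContDiff ℝ ∞ (fun z : ℂ => (z : ℍ[ℝ])) :=
  Quaternion.ofComplex.toLinearMap.toContinuousLinearMap.contDiff

theorem contDiffAt_pairForm {z : ℂ} (h : ContDiffAt ℝ ∞ A (z : ℍ[ℝ])) :
    ContDiffAt ℝ ∞ (pairForm A) z :=
  (contDiffAt_const (c := (2 : ℝ))).smul ((contDiffAt_const (c := innerSL ℝ (e 1))).clm_comp
    ((h.comp z contDiff_coeComplex.contDiffAt).clm_comp (contDiffAt_const
      (c := Quaternion.ofComplex.toLinearMap.toContinuousLinearMap))))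

theorem contDiffAt_pairField {z : ℂ} (h : ContDiffAt ℝ ∞ A (z : ℍ[ℝ])) :
    ContDiffAt ℝ ∞ (pairField A) z := by
  have h1 := (h.comp z contDiff_coeComplex.contDiffAt).clm_apply (contDiffAt_const (c := e 2))
  have h2 : ContDiffAt ℝ ∞ (fun z : ℂ => 2 * z.im) z :=
    contDiffAt_const.mul Complex.imCLM.contDiff.contDiffAt
  have h3 := h2.mul ((contDiffAt_const (c := e 2)).inner ℝ h1)
  have h4 := (h2.mul ((contDiffAt_const (c := e 3)).inner ℝ h1)).add
    (contDiffAt_const (c := (1 : ℝ)))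
  exact (Complex.ofRealCLM.contDiff.contDiffAt.comp z h3).add
    ((Complex.ofRealCLM.contDiff.contDiffAt.comp z h4).mul contDiffAt_const)

theorem isSmoothPair_pair (h : ContDiffOn ℝ ∞ A offAxis) :
    IsSmoothPair (pairForm A) (pairField A) :=
  ⟨fun _ hz => (contDiffAt_pairForm (h.contDiffAt (isOpen_offAxis.mem_nhds
      (coeComplex_mem_offAxis hz)))).contDiffWithinAt,
    fun _ hz => (contDiffAt_pairField (h.contDiffAt (isOpen_offAxis.mem_nhds
      (coeComplex_mem_offAxis hz)))).contDiffWithinAt⟩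

theorem norm_im_coeComplex {z : ℂ} (hz : z ∈ halfPlane) : ‖(z : ℍ[ℝ]).im‖ = z.im :=
  congrArg Complex.im (zCoord_coeComplex hz)

theorem Q_coeComplex {z : ℂ} (hz : z ∈ halfPlane) : Q (z : ℍ[ℝ]) = e 1 := by
  have hz' : z.im ≠ 0 := ne_of_gt hz
  rw [Q, norm_im_coeComplex hz]
  ext <;> simp [hz']

theorem symConnection_coeComplex (a : ℂ → ℂ →L[ℝ] ℝ) (Φ : ℂ → ℂ) {z : ℂ} (hz : z ∈ halfPlane)
    (v : ℍ[ℝ]) : symConnection a Φ (z : ℍ[ℝ]) v = (1 / 2 : ℝ) • (a z ⟨v.re, v.imI⟩ • e 1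
      + (z.im⁻¹ * ((Φ z).re * v.imJ - ((Φ z).im - 1) * v.imK)) • e 2
      + (z.im⁻¹ * ((Φ z).re * v.imK + ((Φ z).im - 1) * v.imJ)) • e 3) := by
  have hx := coeComplex_mem_offAxis hz
  rw [symConnection_apply, fderiv_zCoord hx, fderiv_Q hx, norm_im_coeComplex hz,
    zCoord_coeComplex hz, Q_coeComplex hz]
  have h : dot (e 1) v = v.imI := by simp [dot]
  rw [h]
  congr 1
  ext <;> simp
  · ring
  · ring

/-- At a real or complex point, an invariant connection form commutes with the rotations
about the `i`-axis. -/
theorem IsInvariantOn.apply_coeComplex {U : Set ℍ[ℝ]} (hA : IsInvariantOn A U) {z : ℂ}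
    (hz : (z : ℍ[ℝ]) ∈ U) :
    (∀ v : ℂ, (A z v).imJ = 0 ∧ (A z v).imK = 0) ∧ (A z (e 2)).imI = 0 ∧
      (A z (e 3)).imI = 0 ∧ (A z (e 3)).imJ = -(A z (e 2)).imK ∧
      (A z (e 3)).imK = (A z (e 2)).imJ := by
  -- Two elements of the stabilizer suffice: `i`, the half turn, separates the axis from `span (j,
  -- k)`; `1 + i`, the quarter turn `j ↦ k`, forces complex linearity on that span.
  have he : e 1 ≠ 0 := fun h => by simpa using congrArg (fun q => q.imI) h
  have he' : 1 + e 1 ≠ 0 := fun h => by simpa using congrArg (fun q => q.imI) h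
  have hz1 : (z : ℍ[ℝ]) * e 1 = e 1 * z := by ext <;> simp
  have hz2 : (z : ℍ[ℝ]) * (1 + e 1) = (1 + e 1) * z := by rw [mul_add, hz1, add_mul]; simp
  have h2 := hA.mul_eq (v := e 2) (v' := -e 2) he hz hz1 (by ext <;> simp)
  have h3 := hA.mul_eq (v := e 3) (v' := -e 3) he hz hz1 (by ext <;> simp)
  have h4 := hA.mul_eq (v := e 2) (v' := e 3) he' hz hz2 (by ext <;> simp)
  simp only [map_neg, Quaternion.ext_iff] at h2 h3 h4
  simp at h2 h3 h4
  refine ⟨fun v => ?_, ?_⟩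
  · have h1 := hA.mul_eq (v := (v : ℍ[ℝ])) (v' := v) he hz hz1 (by ext <;> simp)
    simp only [Quaternion.ext_iff] at h1
    simp at h1
    constructor <;> linarith [h1.1, h1.2]
  · obtain ⟨h21, h22⟩ := h2
    obtain ⟨h31, h32⟩ := h3
    obtain ⟨h41, h42, h43, h44⟩ := h4
    refine ⟨?_, ?_, ?_, ?_⟩ <;> linarith

theorem eq_symConnection_coeComplex {U : Set ℍ[ℝ]} (hA : IsInvariantOn A U)
    (hi : IsImaginaryOn A U) {z : ℂ} (hz : z ∈ halfPlane) (hzU : (z : ℍ[ℝ]) ∈ U) (v : ℍ[ℝ]) :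
    A (z : ℍ[ℝ]) v = symConnection (pairForm A) (pairField A) (z : ℍ[ℝ]) v := by
  have hz' : z.im ≠ 0 := ne_of_gt hz
  obtain ⟨h1, h2, h3, h4, h5⟩ := hA.apply_coeComplex hzU
  rw [symConnection_coeComplex _ _ hz, pairForm_apply, pairField_re, pairField_im]
  have hv : v = ((⟨v.re, v.imI⟩ : ℂ) : ℍ[ℝ]) + v.imJ • e 2 + v.imK • e 3 := by ext <;> simp
  conv_lhs => rw [hv]
  rw [map_add, map_add, map_smul, map_smul]
  have h6 := h1 ⟨v.re, v.imI⟩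
  ext
  · simp [hi _ hzU]
  · simp [h2, h3]
  · simp [h6.1, h4]
    field_simp
    ring
  · simp [h6.2, h5]
    field_simp
    ring

/-- Since `Q² = i² = -1`, the element `Q + i` satisfies `Q (Q + i) = (Q + i) i`. It vanishes only
for `Q = -i`, where `j` serves instead. -/
theorem exists_conj_coeComplex {x : ℍ[ℝ]} (hx : x ∈ offAxis) :
    ∃ g : ℍ[ℝ], g ≠ 0 ∧ x * g = g * (zCoord x : ℍ[ℝ]) := by
  have h : ∃ g : ℍ[ℝ], g ≠ 0 ∧ Q x * g = g * e 1 := by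
    have h1 : e 1 * e 1 = -1 := by ext <;> simp
    by_cases h : Q x + e 1 = 0
    · refine ⟨e 2, fun h => by simpa using congrArg (fun q => q.imJ) h, ?_⟩
      rw [eq_neg_of_add_eq_zero_left h]
      ext <;> simp
    · exact ⟨_, h, by rw [mul_add, add_mul, Q_mul_self hx, h1, add_comm]⟩
  obtain ⟨g, hg, hQ⟩ := h
  refine ⟨g, hg, ?_⟩
  have hc : (zCoord x : ℍ[ℝ]) = (x.re : ℍ[ℝ]) + ‖x.im‖ • e 1 := by ext <;> simp
  rw [hc]
  conv_lhs => rw [← Quaternion.re_add_im x, ← smul_Q hx]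
  rw [add_mul, mul_add, Quaternion.coe_commutes, smul_mul_assoc, hQ, mul_smul_comm]

/-- Both sides are invariant and agree on the slice, which meets every orbit. -/
theorem eqOn_symConnection (hA : IsInvariantOn A offAxis) (hi : IsImaginaryOn A offAxis) :
    Set.EqOn A (symConnection (pairForm A) (pairField A)) offAxis := by
  intro x hx
  obtain ⟨g, hg, hgx⟩ := exists_conj_coeComplex hx
  have hz := coeComplex_mem_offAxis (zCoord_mem hx)
  ext1 w
  have hw : w * g = g * (g⁻¹ * w * g) := by simp [mul_assoc, hg]
  refine mul_right_cancel₀ hg ?_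
  rw [hA.mul_eq hg hz hgx hw, (isInvariantOn_symConnection _ _).mul_eq hg hz hgx hw,
    eq_symConnection_coeComplex hA hi (zCoord_mem hx) hz]

theorem isInvariantOn_congr {A B : ℍ[ℝ] → ℍ[ℝ] →L[ℝ] ℍ[ℝ]} (h : Set.EqOn A B offAxis)
    (hB : IsInvariantOn B offAxis) : IsInvariantOn A offAxis := by
  intro g hg x hx v
  have hg0 : g ≠ 0 := norm_pos_iff.1 (by rw [hg]; exact one_pos)
  rw [h hx, h (conj_mem_offAxis hg0 hx), hB g hg x hx]

theorem invariant_iff_exists_pair (A : ℍ[ℝ] → ℍ[ℝ] →L[ℝ] ℍ[ℝ]) :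
    (ContDiffOn ℝ ∞ A offAxis ∧ IsImaginaryOn A offAxis ∧ IsInvariantOn A offAxis) ↔
      ∃ (a : ℂ → ℂ →L[ℝ] ℝ) (Φ : ℂ → ℂ), IsSmoothPair a Φ ∧
        Set.EqOn A (symConnection a Φ) offAxis := by
  constructor
  · rintro ⟨h1, h2, h3⟩
    exact ⟨_, _, isSmoothPair_pair h1, eqOn_symConnection h3 h2⟩
  · rintro ⟨a, Φ, h, hA⟩
    refine ⟨(contDiffOn_symConnection h).congr hA, fun x hx v => ?_,
      isInvariantOn_congr hA (isInvariantOn_symConnection a Φ)⟩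
    rw [hA hx, isImaginaryOn_symConnection a Φ x hx v]

theorem pair_unique (a a' : ℂ → ℂ →L[ℝ] ℝ) (Φ Φ' : ℂ → ℂ)
    (h : Set.EqOn (symConnection a Φ) (symConnection a' Φ') offAxis) :
    Set.EqOn a a' halfPlane ∧ Set.EqOn Φ Φ' halfPlane := by
  have key {z : ℂ} (hz : z ∈ halfPlane) (v : ℍ[ℝ]) :=
    DFunLike.congr_fun (h (coeComplex_mem_offAxis hz)) v
  simp only [forall_comm (α := _ ∈ halfPlane)] at key
  refine ⟨fun z hz => ContinuousLinearMap.ext fun v => ?_, fun z hz => ?_⟩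
  · have := congrArg (fun q => q.imI) (key v hz)
    simp only [symConnection_coeComplex _ _ hz] at this
    simpa using this
  · have hz' : z.im ≠ 0 := ne_of_gt hz
    have := key (e 2) hz
    simp only [symConnection_coeComplex _ _ hz, Quaternion.ext_iff] at this
    simp [hz'] at this
    exact Complex.ext this.2.1 this.2.2

end Pair

/-! ### Pairs on the plane, related by inversion and a gauge transformation -/

theorem continuous_curlAt {a : ℂ → ℂ →L[ℝ] ℝ} (ha : ContDiff ℝ ∞ a) : Continuous (curlAt a) := by
  have := ha.continuous_fderiv (by simp)
  unfold curlAt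
  fun_prop

theorem continuous_covDeriv {a : ℂ → ℂ →L[ℝ] ℝ} {Φ : ℂ → ℂ} (ha : ContDiff ℝ ∞ a)
    (hΦ : ContDiff ℝ ∞ Φ) : Continuous (covDeriv a Φ) := by
  have h1 := hΦ.continuous_fderiv (by simp)
  have h2 := hΦ.continuous
  have h3 := ha.continuous
  unfold covDeriv
  fun_prop

theorem continuous_wedgeDensity {a : ℂ → ℂ →L[ℝ] ℝ} {Φ : ℂ → ℂ} (ha : ContDiff ℝ ∞ a)
    (hΦ : ContDiff ℝ ∞ Φ) : Continuous (wedgeDensity a Φ) := by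
  have h1 := continuous_curlAt ha
  have h2 := continuous_covDeriv ha hΦ
  have h3 := hΦ.continuous
  have h4 (v : ℂ) : Continuous (fun z => (covDeriv a Φ z v).re) :=
    Complex.continuous_re.comp (h2.clm_apply continuous_const)
  have h5 (v : ℂ) : Continuous (fun z => (covDeriv a Φ z v).im) :=
    Complex.continuous_im.comp (h2.clm_apply continuous_const)
  unfold wedgeDensity
  fun_prop

/-- The derivative of the inversion. -/
theorem hasFDerivAt_inv_complex {z : ℂ} (hz : z ≠ 0) :
    HasFDerivAt (fun z : ℂ => z⁻¹) (-ContinuousLinearMap.mulLeftRight ℝ ℂ z⁻¹ z⁻¹) z :=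
  hasFDerivAt_inv' hz

/-- The exterior derivative of a pull-back of a one-form. -/
theorem curlAt_pullback {a : ℂ → ℂ →L[ℝ] ℝ} {σ : ℂ → ℂ} {z : ℂ}
    (ha : DifferentiableAt ℝ a (σ z)) (hσ : ContDiffAt ℝ 2 σ z) :
    curlAt (fun y => (a (σ y)).comp (fderiv ℝ σ y)) z
      = curlAt a (σ z) * ((fderiv ℝ σ z 1).re * (fderiv ℝ σ z Complex.I).im
        - (fderiv ℝ σ z 1).im * (fderiv ℝ σ z Complex.I).re) := by
  have h2 : DifferentiableAt ℝ (fderiv ℝ σ) z :=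
    (hσ.fderiv_right (m := 1) (by norm_num)).differentiableAt (by norm_num)
  have hsymm : fderiv ℝ (fderiv ℝ σ) z 1 Complex.I = fderiv ℝ (fderiv ℝ σ) z Complex.I 1 :=
    (hσ.isSymmSndFDerivAt (by simp)).eq 1 Complex.I
  have h1 : HasFDerivAt σ (fderiv ℝ σ z) z := (hσ.differentiableAt (by simp)).hasFDerivAt
  have hc : HasFDerivAt (fun y => a (σ y)) _ z := ha.hasFDerivAt.comp z h1
  rw [← curl_eq_curlAt, curlAt, (hc.clm_comp h2.hasFDerivAt).fderiv]
  simp [hsymm]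

theorem curlAt_sub {a b : ℂ → ℂ →L[ℝ] ℝ} {z : ℂ} (ha : DifferentiableAt ℝ a z)
    (hb : DifferentiableAt ℝ b z) : curlAt (a - b) z = curlAt a z - curlAt b z := by
  rw [curlAt, fderiv_sub ha hb, curlAt, curlAt]
  simp only [sub_apply]
  ring

/-- The real one-form `Im (c̄ dc)`. -/
def imLogDeriv (c : ℂ → ℂ) (z : ℂ) : ℂ →L[ℝ] ℝ :=
  Complex.imCLM.comp (mulFDeriv (fun z => (starRingEnd ℂ) (c z)) c z)

theorem imLogDeriv_apply (c : ℂ → ℂ) (z v : ℂ) :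
    imLogDeriv c z v = ((starRingEnd ℂ) (c z) * fderiv ℝ c z v).im := rfl

/-! ### Functions of modulus one -/

section UnitModulus

variable {c : ℂ → ℂ} {z : ℂ}

theorem re_conj_mul_fderiv_eq_zero (hc : DifferentiableAt ℝ c z) (hn : ∀ᶠ y in 𝓝 z, ‖c y‖ = 1)
    (v : ℂ) : ((starRingEnd ℂ) (c z) * fderiv ℝ c z v).re = 0 := by
  have h1 : HasFDerivAt (fun y => ‖c y‖ ^ 2) _ z := hc.hasFDerivAt.norm_sq
  have h2 : HasFDerivAt (fun y => ‖c y‖ ^ 2) (0 : ℂ →L[ℝ] ℝ) z := by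
    refine (hasFDerivAt_const (1 : ℝ) z).congr_of_eventuallyEq ?_
    filter_upwards [hn] with y hy
    rw [hy, one_pow]
  have h3 := DFunLike.congr_fun (h1.unique h2) v
  simp [Complex.inner] at h3 ⊢
  linarith

theorem differentiableAt_conj_comp (hc : DifferentiableAt ℝ c z) :
    HasFDerivAt (fun z => (starRingEnd ℂ) (c z))
      ((Complex.conjCLE : ℂ →L[ℝ] ℂ).comp (fderiv ℝ c z)) z :=
  (Complex.conjCLE : ℂ →L[ℝ] ℂ).hasFDerivAt.comp z hc.hasFDerivAt

theorem differentiableAt_imLogDeriv (hc : ContDiffAt ℝ 2 c z) :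
    DifferentiableAt ℝ (imLogDeriv c) z :=
  (differentiableAt_const _).clm_comp (differentiableAt_mulFDeriv
    (differentiableAt_conj_comp (hc.differentiableAt (by simp))).differentiableAt hc)

/-- Locally `c = exp (iθ)` and the form is `dθ`. The proof needs no logarithm: the curl is twice the
Jacobian of `c`, which vanishes because both partial derivatives are orthogonal to `c ≠ 0`. -/
theorem curlAt_imLogDeriv (hc : ContDiffAt ℝ 2 c z) (hn : ∀ᶠ y in 𝓝 z, ‖c y‖ = 1) :
    curlAt (imLogDeriv c) z = 0 := by
  have hd := hc.differentiableAt (by simp)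
  have h1 := differentiableAt_conj_comp hd
  have hm := differentiableAt_mulFDeriv h1.differentiableAt hc
  have hk := curl_mulFDeriv h1.differentiableAt hc 1 Complex.I
  have hI : HasFDerivAt (imLogDeriv c) (((ContinuousLinearMap.compL ℝ ℂ ℂ ℝ)
      Complex.imCLM).comp (fderiv ℝ (mulFDeriv (fun z => (starRingEnd ℂ) (c z)) c) z)) z :=
    ((ContinuousLinearMap.compL ℝ ℂ ℂ ℝ) Complex.imCLM).hasFDerivAt.comp z hm.hasFDerivAt
  rw [curlAt, hI.fderiv]
  have hk' := congrArg Complex.im hk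
  rw [h1.fderiv] at hk'
  simp at hk' ⊢
  rw [hk']
  have p1 := re_conj_mul_fderiv_eq_zero hd hn 1
  have p2 := re_conj_mul_fderiv_eq_zero hd hn Complex.I
  have hn1 : (c z).re * (c z).re + (c z).im * (c z).im = 1 := by
    rw [← Complex.normSq_apply, Complex.normSq_eq_norm_sq, hn.self_of_nhds, one_pow]
  simp at p1 p2
  set x := (c z).re
  set y := (c z).im
  set s := (fderiv ℝ c z 1).re
  set t := (fderiv ℝ c z 1).im
  set s' := (fderiv ℝ c z Complex.I).re
  set t' := (fderiv ℝ c z Complex.I).im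
  have q1 : s * t' - t * s' = 0 := by
    have e1 : x * (s * t' - t * s') = 0 := by linear_combination t' * p1 - t * p2
    have e2 : y * (s * t' - t * s') = 0 := by linear_combination s * p2 - s' * p1
    linear_combination x * e1 + y * e2 - (s * t' - t * s') * hn1
  linear_combination 2 * q1

end UnitModulus

theorem vortexAt_iff {a : ℂ → ℂ →L[ℝ] ℝ} {Φ : ℂ → ℂ} {z : ℂ} : VortexAt a Φ z ↔
    z.im ^ 2 * curlAt a z = ‖Φ z‖ ^ 2 - 1 ∧
      covDeriv a Φ z 1 + Complex.I * covDeriv a Φ z Complex.I = 0 := by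
  rw [VortexAt, Complex.ext_iff]
  simp [add_eq_zero_iff_eq_neg]

theorem antiVortexAt_iff {a : ℂ → ℂ →L[ℝ] ℝ} {Φ : ℂ → ℂ} {z : ℂ} : AntiVortexAt a Φ z ↔
    z.im ^ 2 * curlAt a z = -(‖Φ z‖ ^ 2 - 1) ∧
      covDeriv a Φ z 1 - Complex.I * covDeriv a Φ z Complex.I = 0 := by
  rw [AntiVortexAt, Complex.ext_iff]
  simp [sub_eq_zero, add_eq_zero_iff_eq_neg]

/-- The pairs `(a₀, Φ₀)` and `(a₁, Φ₁)` are smooth on the plane, and related by the inversion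
`z ↦ z⁻¹` and the gauge transformation `c`. -/
structure InversionRelated (a₀ : ℂ → ℂ →L[ℝ] ℝ) (Φ₀ : ℂ → ℂ) (a₁ : ℂ → ℂ →L[ℝ] ℝ) (Φ₁ : ℂ → ℂ)
    (c : ℂ → ℂ) : Prop where
  form₀ : ContDiff ℝ ∞ a₀
  field₀ : ContDiff ℝ ∞ Φ₀
  form₁ : ContDiff ℝ ∞ a₁
  field₁ : ContDiff ℝ ∞ Φ₁
  smooth : ∀ z, z ≠ 0 → ContDiffAt ℝ ∞ c z
  norm_eq : ∀ z, z ≠ 0 → ‖c z‖ = 1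
  field_inv : ∀ z, z ≠ 0 → Φ₁ z⁻¹ = c z ^ 2 * Φ₀ z
  form_inv : ∀ z, z ≠ 0 → ∀ v, a₁ z⁻¹ (-(z⁻¹ * v * z⁻¹)) = a₀ z v - 2 * imLogDeriv c z v

/-! ### Transformation of densities and equations under inversion -/

namespace InversionRelated

variable {a₀ a₁ : ℂ → ℂ →L[ℝ] ℝ} {Φ₀ Φ₁ c : ℂ → ℂ} (h : InversionRelated a₀ Φ₀ a₁ Φ₁ c)
  {z : ℂ} (hz : z ≠ 0)

include h hz

theorem eventually_norm_eq : ∀ᶠ y in 𝓝 z, ‖c y‖ = 1 := by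
  filter_upwards [isOpen_ne.mem_nhds hz] with y hy
  exact h.norm_eq y hy

/-- Gauge covariance: since `c̄ dc = i Im (c̄ dc)` for unit modulus, the derivative of the factor
`c²` is compensated by the term `-2 Im (c̄ dc)` in the one-form. -/
theorem covDeriv_inv (v : ℂ) :
    covDeriv a₁ Φ₁ z⁻¹ (-(z⁻¹ * v * z⁻¹)) = c z ^ 2 * covDeriv a₀ Φ₀ z v := by
  have hc := ((h.smooth z hz).differentiableAt (by simp)).hasFDerivAt
  have h0 := (h.field₀.differentiable (by simp) z).hasFDerivAt
  have h1 : HasFDerivAt (fun y => Φ₁ y⁻¹) _ z :=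
    (h.field₁.differentiable (by simp) z⁻¹).hasFDerivAt.comp z (hasFDerivAt_inv_complex hz)
  have h2 := ((hc.pow 2).mul h0).congr_of_eventuallyEq (f₁ := fun y => Φ₁ y⁻¹) (by
    filter_upwards [isOpen_ne.mem_nhds hz] with y hy
    exact h.field_inv y hy)
  have h3 := DFunLike.congr_fun (h1.unique h2) v
  have h4 := re_conj_mul_fderiv_eq_zero hc.differentiableAt (h.eventually_norm_eq hz) v
  have h5 : (starRingEnd ℂ) (c z) * fderiv ℝ c z v = imLogDeriv c z v * Complex.I := by
    apply Complex.ext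
    · simp [h4]
    · simp [imLogDeriv_apply]
  have h6 : c z * (starRingEnd ℂ) (c z) = 1 := by
    rw [Complex.mul_conj, Complex.normSq_eq_norm_sq, h.norm_eq z hz]
    simp
  rw [covDeriv_apply, covDeriv_apply, h.form_inv z hz, h.field_inv z hz]
  simp at h3
  rw [map_neg, h3]
  push_cast
  linear_combination 2 * c z ^ 2 * Φ₀ z * h5 - 2 * c z * Φ₀ z * fderiv ℝ c z v * h6

/-- The gauge term is closed, and inversion has Jacobian `|z|⁻⁴`. -/
theorem curlAt_inv : curlAt a₀ z = ‖z⁻¹‖ ^ 4 * curlAt a₁ z⁻¹ := by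
  have hc2 := (h.smooth z hz).of_le two_le_smooth
  have hi : ContDiffAt ℝ 2 (fun z : ℂ => z⁻¹) z := contDiffAt_id.inv hz
  have ha1 : DifferentiableAt ℝ a₁ z⁻¹ := h.form₁.differentiable (by simp) _
  have he : (fun y => (a₁ y⁻¹).comp (fderiv ℝ (fun z : ℂ => z⁻¹) y))
      =ᶠ[𝓝 z] a₀ - (2 : ℝ) • imLogDeriv c := by
    filter_upwards [isOpen_ne.mem_nhds hz] with y hy
    ext v
    have := h.form_inv y hy v
    simp [(hasFDerivAt_inv_complex hy).fderiv] at this ⊢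
    exact this
  have hk := curlAt_pullback (a := a₁) (σ := fun z : ℂ => z⁻¹) (z := z) ha1 hi
  have hl := differentiableAt_imLogDeriv hc2
  have hs : curlAt ((2 : ℝ) • imLogDeriv c) z = 0 := by
    have := curlAt_imLogDeriv hc2 (h.eventually_norm_eq hz)
    rw [curlAt] at this ⊢
    rw [fderiv_const_smul hl]
    simp only [smul_apply, smul_eq_mul]
    linear_combination 2 * this
  rw [curlAt, he.fderiv_eq, ← curlAt, curlAt_sub (h.form₀.differentiable (by simp) z)
    (hl.const_smul (2 : ℝ)), hs, (hasFDerivAt_inv_complex hz).fderiv, sub_zero] at hk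
  rw [hk, show ‖z⁻¹‖ ^ 4 = (‖z⁻¹‖ ^ 2) ^ 2 by ring, ← Complex.normSq_eq_norm_sq,
    Complex.normSq_apply]
  simp only [neg_apply, ContinuousLinearMap.mulLeftRight_apply, mul_one]
  simp only [Complex.neg_re, Complex.neg_im, Complex.mul_re, Complex.mul_im, Complex.I_re,
    Complex.I_im]
  ring

theorem norm_field_inv : ‖Φ₁ z⁻¹‖ = ‖Φ₀ z‖ := by
  rw [h.field_inv z hz, norm_mul, norm_pow, h.norm_eq z hz]
  simp

theorem norm_covDeriv_inv : ‖covDeriv a₀ Φ₀ z‖ = ‖z⁻¹‖ ^ 2 * ‖covDeriv a₁ Φ₁ z⁻¹‖ := by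
  have hn : 0 < ‖z‖ := norm_pos_iff.2 hz
  have key (v : ℂ) : ‖covDeriv a₀ Φ₀ z v‖ = ‖covDeriv a₁ Φ₁ z⁻¹ (-(z⁻¹ * v * z⁻¹))‖ := by
    rw [h.covDeriv_inv hz, norm_mul, norm_pow, h.norm_eq z hz]
    simp
  apply le_antisymm
  · refine ContinuousLinearMap.opNorm_le_bound _ (by positivity) fun v => ?_
    rw [key]
    refine (ContinuousLinearMap.le_opNorm _ _).trans (le_of_eq ?_)
    rw [norm_neg, norm_mul, norm_mul]
    ring
  · rw [norm_inv, inv_pow, inv_mul_le_iff₀ (by positivity)]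
    refine ContinuousLinearMap.opNorm_le_bound _ (by positivity) fun v => ?_
    have h1 := key (-(z * v * z))
    rw [show -(z⁻¹ * -(z * v * z) * z⁻¹) = v by field_simp] at h1
    rw [← h1]
    refine (ContinuousLinearMap.le_opNorm _ _).trans (le_of_eq ?_)
    rw [norm_neg, norm_mul, norm_mul]
    ring

theorem covDeriv_one_and_I :
    c z ^ 2 * covDeriv a₀ Φ₀ z 1 = -((z⁻¹ ^ 2).re * covDeriv a₁ Φ₁ z⁻¹ 1
      + (z⁻¹ ^ 2).im * covDeriv a₁ Φ₁ z⁻¹ Complex.I) ∧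
    c z ^ 2 * covDeriv a₀ Φ₀ z Complex.I = (z⁻¹ ^ 2).im * covDeriv a₁ Φ₁ z⁻¹ 1
      - (z⁻¹ ^ 2).re * covDeriv a₁ Φ₁ z⁻¹ Complex.I := by
  rw [← h.covDeriv_inv hz, ← h.covDeriv_inv hz,
    clm_complex_apply _ (-(z⁻¹ * 1 * z⁻¹)), clm_complex_apply _ (-(z⁻¹ * Complex.I * z⁻¹)),
    show z⁻¹ * 1 * z⁻¹ = z⁻¹ ^ 2 by ring, show z⁻¹ * Complex.I * z⁻¹ = Complex.I * z⁻¹ ^ 2 by ring]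
  constructor <;> apply Complex.ext <;> simp <;> ring

theorem wedgeDensity_inv :
    wedgeDensity a₀ Φ₀ z = ‖z⁻¹‖ ^ 4 * wedgeDensity a₁ Φ₁ z⁻¹ := by
  obtain ⟨h1, h2⟩ := h.covDeriv_one_and_I hz
  have hz4 : ‖z⁻¹‖ ^ 4 = (z⁻¹ ^ 2).re * (z⁻¹ ^ 2).re + (z⁻¹ ^ 2).im * (z⁻¹ ^ 2).im := by
    rw [← Complex.normSq_apply, Complex.normSq_eq_norm_sq, norm_pow]
    ring
  have hcn : (c z ^ 2).re * (c z ^ 2).re + (c z ^ 2).im * (c z ^ 2).im = 1 := by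
    rw [← Complex.normSq_apply, Complex.normSq_eq_norm_sq, norm_pow, h.norm_eq z hz]
    simp
  rw [wedgeDensity, wedgeDensity, h.curlAt_inv hz, h.norm_field_inv hz, hz4]
  generalize c z ^ 2 = u at *
  generalize z⁻¹ ^ 2 = k at *
  simp only [Complex.ext_iff] at h1 h2
  simp at h1 h2
  obtain ⟨h11, h12⟩ := h1
  obtain ⟨h21, h22⟩ := h2
  generalize covDeriv a₀ Φ₀ z 1 = X at *
  generalize covDeriv a₀ Φ₀ z Complex.I = Y at *
  generalize covDeriv a₁ Φ₁ z⁻¹ 1 = V at *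
  generalize covDeriv a₁ Φ₁ z⁻¹ Complex.I = W at *
  have e1 : (u.re * X.re - u.im * X.im) * (u.re * Y.im + u.im * Y.re)
      - (u.re * X.im + u.im * X.re) * (u.re * Y.re - u.im * Y.im)
      = (k.re * k.re + k.im * k.im) * (V.re * W.im - V.im * W.re) := by
    rw [h11, h12, h21, h22]
    ring
  have e2 : X.re * Y.im - X.im * Y.re
      = (k.re * k.re + k.im * k.im) * (V.re * W.im - V.im * W.re) := by
    linear_combination e1 - (X.re * Y.im - X.im * Y.re) * hcn
  linear_combination -e2

theorem im_sq_mul_curlAt_inv : z⁻¹.im ^ 2 * curlAt a₁ z⁻¹ = z.im ^ 2 * curlAt a₀ z := by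
  rw [h.curlAt_inv hz, Complex.inv_im, show ‖z⁻¹‖ ^ 4 = (‖z⁻¹‖ ^ 2) ^ 2 by ring,
    ← Complex.normSq_eq_norm_sq, Complex.normSq_inv]
  ring

/-- Inversion is holomorphic, so up to sign and the phase `c²` the `(0, 1)`-part only changes by the
nonzero factor conjugate to `z⁻²`. The curvature equation involves `r` only through `r²`, so it also
makes sense in the lower half-plane. -/
theorem vortexAt_inv (hv : VortexAt a₀ Φ₀ z) : VortexAt a₁ Φ₁ z⁻¹ := by
  obtain ⟨h1, h2⟩ := h.covDeriv_one_and_I hz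
  rw [vortexAt_iff] at hv ⊢
  rw [h.im_sq_mul_curlAt_inv hz, h.norm_field_inv hz]
  refine ⟨hv.1, ?_⟩
  have hk : (starRingEnd ℂ) (z⁻¹ ^ 2) ≠ 0 := by simpa using hz
  refine (mul_eq_zero.1 ?_).resolve_left hk
  have e (k : ℂ) : (starRingEnd ℂ) k = k.re - k.im * Complex.I := by
    apply Complex.ext <;> simp
  rw [e]
  linear_combination h1 + Complex.I * h2 - c z ^ 2 * hv.2
    - ((z⁻¹ ^ 2).im * covDeriv a₁ Φ₁ z⁻¹ Complex.I) * Complex.I_sq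

theorem antiVortexAt_inv (hv : AntiVortexAt a₀ Φ₀ z) : AntiVortexAt a₁ Φ₁ z⁻¹ := by
  obtain ⟨h1, h2⟩ := h.covDeriv_one_and_I hz
  rw [antiVortexAt_iff] at hv ⊢
  rw [h.im_sq_mul_curlAt_inv hz, h.norm_field_inv hz]
  refine ⟨hv.1, ?_⟩
  have hk : z⁻¹ ^ 2 ≠ 0 := by simpa using hz
  refine (mul_eq_zero.1 ?_).resolve_left hk
  have e : z⁻¹ ^ 2 = (z⁻¹ ^ 2).re + (z⁻¹ ^ 2).im * Complex.I := (Complex.re_add_im _).symm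
  linear_combination (covDeriv a₁ Φ₁ z⁻¹ 1 - Complex.I * covDeriv a₁ Φ₁ z⁻¹ Complex.I) * e
    + h1 - Complex.I * h2 - c z ^ 2 * hv.2
    - ((z⁻¹ ^ 2).im * covDeriv a₁ Φ₁ z⁻¹ Complex.I) * Complex.I_sq

end InversionRelated

/-! ### Behaviour at infinity -/

/-- The function is bounded on the unit disc and of size `|z|⁻⁴` outside it, so it is compared with
`(1 + |z|²)⁻²`. The constant `4` comes from `(1 + |z|²)² ≤ 4 max(1, |z|⁴)`. -/
theorem integrable_of_inversion {f g : ℂ → ℝ} (hf : Continuous f) (hg : Continuous g)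
    (h : ∀ z, z ≠ 0 → f z = ‖z⁻¹‖ ^ 4 * g z⁻¹) : MeasureTheory.Integrable f := by
  obtain ⟨M, hM⟩ := (isCompact_closedBall (0 : ℂ) 1).exists_bound_of_continuousOn hf.continuousOn
  obtain ⟨N, hN⟩ := (isCompact_closedBall (0 : ℂ) 1).exists_bound_of_continuousOn hg.continuousOn
  have hi : MeasureTheory.Integrable (fun z : ℂ => (1 + ‖z‖ ^ 2) ^ (-(4 : ℝ) / 2)) :=
    integrable_rpow_neg_one_add_norm_sq (by rw [Complex.finrank_real_complex]; norm_num)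
  refine (hi.const_mul (4 * max M N)).mono' hf.aestronglyMeasurable
    (Filter.Eventually.of_forall fun z => ?_)
  have e : (1 + ‖z‖ ^ 2) ^ (-(4 : ℝ) / 2) = ((1 + ‖z‖ ^ 2) ^ 2)⁻¹ := by
    rw [show -(4 : ℝ) / 2 = -(2 : ℕ) by norm_num, Real.rpow_neg (by positivity),
      Real.rpow_natCast]
  rw [e, ← div_eq_mul_inv, le_div_iff₀ (by positivity)]
  rcases le_total ‖z‖ 1 with hz | hz
  · have h1 := hM z (by simpa using hz)
    have h2 : ‖f z‖ ≤ max M N := h1.trans (le_max_left _ _)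
    have h3 : ‖z‖ ^ 2 ≤ 1 := pow_le_one₀ (norm_nonneg _) hz
    have h4 : (1 + ‖z‖ ^ 2) ^ 2 ≤ 4 := by nlinarith [sq_nonneg ‖z‖]
    calc ‖f z‖ * (1 + ‖z‖ ^ 2) ^ 2 ≤ max M N * 4 :=
        mul_le_mul h2 h4 (by positivity) ((norm_nonneg _).trans h2)
      _ = _ := mul_comm _ _
  · have hz0 : z ≠ 0 := norm_pos_iff.1 (by linarith)
    have hzp : 0 < ‖z‖ := by linarith
    have h1 := hN z⁻¹ (by simpa using inv_le_one_of_one_le₀ hz)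
    have h2 : ‖g z⁻¹‖ ≤ max M N := h1.trans (le_max_right _ _)
    have h3 : 1 ≤ ‖z‖ ^ 2 := one_le_pow₀ hz
    have h4 : (1 + ‖z‖ ^ 2) ^ 2 ≤ 4 * ‖z‖ ^ 4 := by nlinarith
    rw [h z hz0, norm_mul, norm_pow, norm_norm, norm_inv]
    calc ‖z‖⁻¹ ^ 4 * ‖g z⁻¹‖ * (1 + ‖z‖ ^ 2) ^ 2
        ≤ ‖z‖⁻¹ ^ 4 * ‖g z⁻¹‖ * (4 * ‖z‖ ^ 4) := by gcongr
      _ = 4 * ‖g z⁻¹‖ := by field_simp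
      _ ≤ 4 * max M N := by gcongr

namespace InversionRelated

variable {a₀ a₁ : ℂ → ℂ →L[ℝ] ℝ} {Φ₀ Φ₁ c : ℂ → ℂ}

theorem integrable_curlAt (h : InversionRelated a₀ Φ₀ a₁ Φ₁ c) :
    MeasureTheory.Integrable (curlAt a₀) :=
  integrable_of_inversion (continuous_curlAt h.form₀) (continuous_curlAt h.form₁)
    fun _ hz => h.curlAt_inv hz

theorem integrable_wedgeDensity (h : InversionRelated a₀ Φ₀ a₁ Φ₁ c) :
    MeasureTheory.Integrable (wedgeDensity a₀ Φ₀) :=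
  integrable_of_inversion (continuous_wedgeDensity h.form₀ h.field₀)
    (continuous_wedgeDensity h.form₁ h.field₁) fun _ hz => h.wedgeDensity_inv hz

/-- The norm `G` of the current in the disc coordinate extends continuously to the real axis, and to
infinity through `H` in the inverted coordinate. It vanishes on this boundary circle, so `{G ≥ ε}`
is compact in the open half-plane. -/
theorem currentVanishesAtInfinity (h : InversionRelated a₀ Φ₀ a₁ Φ₁ c)
    (h₀ : ∀ t : ℝ, covDeriv a₀ Φ₀ t = 0) (h₁ : ∀ t : ℝ, covDeriv a₁ Φ₁ t = 0) :
    CurrentVanishesAtInfinity a₀ Φ₀ := by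
  have hc₀ := continuous_covDeriv h.form₀ h.field₀
  have hc₁ := continuous_covDeriv h.form₁ h.field₁
  have hf₀ := h.field₀.continuous
  have hf₁ := h.field₁.continuous
  refine Metric.tendsto_nhds.2 fun ε hε => ?_
  let G (z : ℂ) : ℝ := ‖Φ₀ z‖ * ‖covDeriv a₀ Φ₀ z‖ * (‖z + Complex.I‖ ^ 2 / 2)
  let H (w : ℂ) : ℝ := ‖Φ₁ w‖ * ‖covDeriv a₁ Φ₁ w‖ * (‖1 + Complex.I * w‖ ^ 2 / 2)
  have hG : Continuous G := by fun_prop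
  have hH : Continuous H := by fun_prop
  have hreal {z : ℂ} (hz : z.im = 0) : z = (z.re : ℂ) := by apply Complex.ext <;> simp [hz]
  have hG0 {z : ℂ} (hz : z.im = 0) : G z = 0 := by
    simp only [G]
    rw [hreal hz, h₀]
    simp
  have hH0 {z : ℂ} (hz : z.im = 0) : H z = 0 := by
    simp only [H]
    rw [hreal hz, h₁]
    simp
  have hGH {z : ℂ} (hz : z ≠ 0) : G z = H z⁻¹ := by
    have hn : 0 < ‖z‖ := norm_pos_iff.2 hz
    simp only [G, H]
    rw [h.norm_covDeriv_inv hz, h.norm_field_inv hz, show z + Complex.I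
      = z * (1 + Complex.I * z⁻¹) by field_simp, norm_mul, norm_inv]
    field_simp
  -- `S` covers `|z| ≤ 1`. For `|z| ≥ 1` the condition is read at `z⁻¹`, which lies in the lower
  -- half-plane; hence the reversed sign in `T`.
  let S : Set ℂ := Metric.closedBall 0 1 ∩ ({z | 0 ≤ z.im} ∩ {z | ε ≤ G z})
  let T : Set ℂ := Metric.closedBall 0 1 ∩ ({z | z.im ≤ 0} ∩ {z | ε ≤ H z})
  have hS : IsCompact S := (isCompact_closedBall 0 1).inter_right
    ((isClosed_le continuous_const Complex.continuous_im).inter (isClosed_le continuous_const hG))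
  have hT : IsCompact T := (isCompact_closedBall 0 1).inter_right
    ((isClosed_le Complex.continuous_im continuous_const).inter (isClosed_le continuous_const hH))
  have hSim : ∀ z ∈ S, 0 < z.im := fun z hz =>
    lt_of_le_of_ne hz.2.1 fun h0 => by
      have := hz.2.2
      rw [Set.mem_ofPred_eq, hG0 h0.symm] at this
      linarith
  have hTim : ∀ z ∈ T, z.im < 0 := fun z hz =>
    lt_of_le_of_ne hz.2.1 fun h0 => by
      have := hz.2.2
      rw [Set.mem_ofPred_eq, hH0 h0] at this
      linarith
  have hT0 : ∀ z ∈ T, z ≠ 0 := fun z hz h0 => by simpa [h0] using hTim z hz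
  have hT' : IsCompact ((fun z : ℂ => z⁻¹) '' T) :=
    hT.image_of_continuousOn fun z hz => (continuousAt_inv₀ (hT0 z hz)).continuousWithinAt
  have hK : IsCompact ((fun z : UpperHalfPlane => (z : ℂ)) ⁻¹' (S ∪ (fun z : ℂ => z⁻¹) '' T)) := by
    refine (UpperHalfPlane.isOpenEmbedding_coe.isInducing.isCompact_preimage_iff ?_).2
      (hS.union hT')
    rintro z (hz | ⟨w, hw, rfl⟩)
    · exact ⟨⟨z, hSim z hz⟩, rfl⟩
    · refine ⟨⟨w⁻¹, ?_⟩, rfl⟩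
      rw [Complex.inv_im]
      have := hTim w hw
      exact div_pos (by linarith) (Complex.normSq_pos.2 (hT0 w hw))
  refine Filter.mem_cocompact.2 ⟨_, hK, fun z hz => ?_⟩
  have hGz : ‖(Complex.I * (starRingEnd ℂ) (Φ₀ (z : ℂ))) • covDeriv a₀ Φ₀ (z : ℂ)‖
      * (‖(z : ℂ) + Complex.I‖ ^ 2 / 2) = G z := by
    simp [G, norm_smul]
  rw [Set.mem_ofPred_eq, Real.dist_0_eq_abs, hGz, abs_of_nonneg (by positivity)]
  by_contra hcon
  refine hz ?_
  have him : 0 < (z : ℂ).im := z.im_pos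
  rcases le_total ‖(z : ℂ)‖ 1 with h1 | h1
  · exact Or.inl ⟨by simpa using h1, him.le, not_lt.1 hcon⟩
  · refine Or.inr ⟨(z : ℂ)⁻¹, ⟨by simpa using inv_le_one_of_one_le₀ h1, ?_, ?_⟩, inv_inv _⟩
    · rw [Set.mem_ofPred_eq, Complex.inv_im]
      exact div_nonpos_of_nonpos_of_nonneg (by linarith) (Complex.normSq_nonneg _)
    · rw [Set.mem_ofPred_eq, ← hGH (norm_pos_iff.1 (by linarith))]
      exact not_lt.1 hcon

end InversionRelated

/-! ### Invariant connection forms on `ℝ⁴` -/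

section Global

variable {A : ℍ[ℝ] → ℍ[ℝ] →L[ℝ] ℍ[ℝ]}

theorem contDiff_pairForm (h : ContDiff ℝ ∞ A) : ContDiff ℝ ∞ (pairForm A) :=
  contDiff_iff_contDiffAt.2 fun _ => contDiffAt_pairForm h.contDiffAt

/-- The defining formula multiplies by `r` and never divides by it, so it stays smooth across the
real axis. -/
theorem contDiff_pairField (h : ContDiff ℝ ∞ A) : ContDiff ℝ ∞ (pairField A) :=
  contDiff_iff_contDiffAt.2 fun _ => contDiffAt_pairField h.contDiffAt

theorem e_two_ne_zero : e 2 ≠ 0 := fun h => by simpa using congrArg (fun q => q.imJ) h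

/-- Conjugation by `j` acts on `ℂ` as complex conjugation and sends `i` to `-i`. This reflection
carries the equations from the lower half-plane back to the upper one. -/
theorem pairForm_conj (hA : IsInvariantOn A Set.univ) (z v : ℂ) :
    pairForm A ((starRingEnd ℂ) z) ((starRingEnd ℂ) v) = -pairForm A z v := by
  have h := hA.mul_eq (g := e 2) (x := (z : ℍ[ℝ])) (x' := ((starRingEnd ℂ) z : ℂ)) (v := (v : ℍ[ℝ]))
    (v' := ((starRingEnd ℂ) v : ℂ)) e_two_ne_zero trivial
    (by ext <;> simp) (by ext <;> simp)
  rw [pairForm_apply, pairForm_apply]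
  have := congrArg (fun q => q.imK) h
  simp at this
  rw [this]
  ring

theorem pairField_conj (hA : IsInvariantOn A Set.univ) (z : ℂ) :
    pairField A ((starRingEnd ℂ) z) = -(starRingEnd ℂ) (pairField A z) := by
  have h := hA.mul_eq (g := e 2) (x := (z : ℍ[ℝ])) (x' := ((starRingEnd ℂ) z : ℂ)) (v := e 2)
    (v' := e 2) e_two_ne_zero trivial (by ext <;> simp) rfl
  have h1 := congrArg (fun q => q.re) h
  have h2 := congrArg (fun q => q.imI) h
  simp at h1 h2
  apply Complex.ext
  · rw [Complex.neg_re, Complex.conj_re, pairField_re, pairField_re, h1]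
    simp
  · rw [Complex.neg_im, Complex.conj_im, pairField_im, pairField_im]
    simp
    linear_combination 2 * z.im * h2

theorem covDeriv_conj (hs : ContDiff ℝ ∞ A) (hA : IsInvariantOn A Set.univ) (z v : ℂ) :
    covDeriv (pairForm A) (pairField A) ((starRingEnd ℂ) z) ((starRingEnd ℂ) v)
      = -(starRingEnd ℂ) (covDeriv (pairForm A) (pairField A) z v) := by
  have hd := (contDiff_pairField hs).differentiable (by simp)
  have h1 : HasFDerivAt (fun z => pairField A ((starRingEnd ℂ) z))
      ((fderiv ℝ (pairField A) ((starRingEnd ℂ) z)).comp (Complex.conjCLE : ℂ →L[ℝ] ℂ)) z :=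
    HasFDerivAt.comp z (hd _).hasFDerivAt (Complex.conjCLE : ℂ →L[ℝ] ℂ).hasFDerivAt
  have h2 : HasFDerivAt (fun z => -(starRingEnd ℂ) (pairField A z))
      (-(Complex.conjCLE : ℂ →L[ℝ] ℂ).comp (fderiv ℝ (pairField A) z)) z :=
    (differentiableAt_conj_comp (hd z)).neg
  rw [funext (pairField_conj hA)] at h1
  have h3 := DFunLike.congr_fun (h1.unique h2) v
  simp at h3
  rw [covDeriv_apply, covDeriv_apply, pairForm_conj hA, pairField_conj hA, h3]
  simp
  ring

theorem curlAt_conj (hs : ContDiff ℝ ∞ A) (hA : IsInvariantOn A Set.univ) (z : ℂ) :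
    curlAt (pairForm A) ((starRingEnd ℂ) z) = curlAt (pairForm A) z := by
  have hf (y : ℂ) : fderiv ℝ (fun z : ℂ => (starRingEnd ℂ) z) y = (Complex.conjCLE : ℂ →L[ℝ] ℂ) :=
    (Complex.conjCLE : ℂ →L[ℝ] ℂ).hasFDerivAt.fderiv
  have hd := (contDiff_pairForm hs).differentiable (by simp)
  have h := curlAt_pullback (a := pairForm A) (σ := fun z : ℂ => (starRingEnd ℂ) z) (z := z)
    (hd _) (Complex.conjCLE : ℂ →L[ℝ] ℂ).contDiff.contDiffAt
  have he : (fun y => (pairForm A ((starRingEnd ℂ) y)).comp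
      (fderiv ℝ (fun z : ℂ => (starRingEnd ℂ) z) y)) = fun y => -pairForm A y := by
    funext y
    ext v
    rw [hf]
    exact pairForm_conj hA y v
  rw [he, curlAt, fderiv_fun_neg, hf] at h
  simp at h
  have h' : curlAt (pairForm A) z
      = fderiv ℝ (pairForm A) z 1 Complex.I - fderiv ℝ (pairForm A) z Complex.I 1 := rfl
  linarith

theorem vortexAt_conj (hs : ContDiff ℝ ∞ A) (hA : IsInvariantOn A Set.univ) {z : ℂ}
    (h : VortexAt (pairForm A) (pairField A) ((starRingEnd ℂ) z)) :
    VortexAt (pairForm A) (pairField A) z := by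
  have h1 := covDeriv_conj hs hA z 1
  have h2 := covDeriv_conj hs hA z Complex.I
  rw [VortexAt] at h ⊢
  simp [curlAt_conj hs hA, pairField_conj hA, Complex.ext_iff] at h h1 h2
  exact ⟨h.1, by linarith [h.2.1, h1.1, h2.2], by linarith [h.2.2, h1.2, h2.1]⟩

theorem antiVortexAt_conj (hs : ContDiff ℝ ∞ A) (hA : IsInvariantOn A Set.univ) {z : ℂ}
    (h : AntiVortexAt (pairForm A) (pairField A) ((starRingEnd ℂ) z)) :
    AntiVortexAt (pairForm A) (pairField A) z := by
  have h1 := covDeriv_conj hs hA z 1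
  have h2 := covDeriv_conj hs hA z Complex.I
  rw [AntiVortexAt] at h ⊢
  simp [curlAt_conj hs hA, pairField_conj hA, Complex.ext_iff] at h h1 h2
  exact ⟨by linarith [h.1], by linarith [h.2.1, h1.1, h2.2], by linarith [h.2.2, h1.2, h2.1]⟩

/-- A real point is fixed by the whole group, so `A` kills `1` there and acts on imaginary
quaternions by a scalar `λ`, up to real parts. With `Φ = 2 r κ + i` this gives `dΦ = 2 λ dr` and `i
a Φ = -a = -2 λ dr`, which cancel. -/
theorem covDeriv_ofReal_eq_zero (hs : ContDiff ℝ ∞ A) (hA : IsInvariantOn A Set.univ) (t : ℝ) :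
    covDeriv (pairForm A) (pairField A) t = 0 := by
  let κ (z : ℂ) : ℂ := ⟨(A (z : ℍ[ℝ]) (e 2)).imJ, (A (z : ℍ[ℝ]) (e 2)).imK⟩
  have hpair : pairField A = fun z => (2 * z.im) • κ z + Complex.I := by
    funext z
    apply Complex.ext <;> simp [pairField_re, pairField_im, κ]
  have hκ : DifferentiableAt ℝ κ t := by
    have h1 : DifferentiableAt ℝ (fun z : ℂ => A (z : ℍ[ℝ]) (e 2)) t :=
      ((hs.comp contDiff_coeComplex).differentiable (by simp) _).clm_apply
        (differentiableAt_const _)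
    have h2 := (innerSL ℝ (e 2)).differentiableAt.comp (t : ℂ) h1
    have h3 := (innerSL ℝ (e 3)).differentiableAt.comp (t : ℂ) h1
    have he : κ = fun z : ℂ => Complex.equivRealProdCLM.symm
        (inner ℝ (e 2) (A (z : ℍ[ℝ]) (e 2)), inner ℝ (e 3) (A (z : ℍ[ℝ]) (e 2))) := by
      funext z
      apply Complex.ext <;> simp [κ, inner_e_two, inner_e_three]
    rw [he]
    exact Complex.equivRealProdCLM.symm.differentiableAt.comp (t : ℂ) (h2.prodMk h3)
  have hd : HasFDerivAt (pairField A)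
      (((2 * (t : ℂ).im) • fderiv ℝ κ t + ((2 : ℝ) • Complex.imCLM).smulRight (κ t))) t := by
    rw [hpair]
    exact ((Complex.imCLM.hasFDerivAt.const_mul (2 : ℝ)).smul hκ.hasFDerivAt).add_const _
  have hx (g : ℍ[ℝ]) : ((t : ℂ) : ℍ[ℝ]) * g = g * ((t : ℂ) : ℍ[ℝ]) := by
    rw [Quaternion.coeComplex_coe, Quaternion.coe_commutes]
  have he : e 1 + e 2 ≠ 0 := fun h => by simpa using congrArg (fun q => q.imJ) h
  have g1 := hA.mul_eq (g := e 2) (v := ((1 : ℂ) : ℍ[ℝ])) (v' := ((1 : ℂ) : ℍ[ℝ]))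
    e_two_ne_zero trivial (hx _) (by simp)
  have g2 := hA.mul_eq (g := e 2) (v := e 2) (v' := e 2) e_two_ne_zero trivial (hx _) rfl
  have g3 := hA.mul_eq (g := e 1 + e 2) (v := ((Complex.I : ℂ) : ℍ[ℝ])) (v' := e 2) he trivial
    (hx _) (by ext <;> simp)
  have k1 := congrArg (fun q => q.imK) g1
  have k2 := congrArg (fun q => q.imI) g2
  have k3 := congrArg (fun q => q.re) g3
  have k4 := hA.apply_coeComplex (z := (t : ℂ)) trivial
  have k5 := (k4.1 Complex.I).1
  have k6 := k4.2.1
  simp at k1 k2 k3 k5 k6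
  have hv (v : ℂ) : covDeriv (pairForm A) (pairField A) t v
      = (2 * v.im) • κ t - ((pairForm A t v : ℝ) : ℂ) := by
    rw [covDeriv_apply, hd.fderiv, hpair]
    simp
    ring
  ext v
  have hk : κ t = ((A (t : ℍ[ℝ]) (e 2)).imJ : ℂ) := by
    apply Complex.ext
    · simp [κ]
    · simp [κ]
      linarith
  rw [hv, clm_complex_apply, pairForm_apply, pairForm_apply, hk]
  apply Complex.ext
  · simp
    linear_combination -2 * v.re * (1 / 2) * k1 + 2 * v.im * (k5 - k6 - k3)
  · simp

end Global

/-! ### The transition function of an invariant bundle -/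

theorem conj_eq_of_mul_eq {g x x' : ℍ[ℝ]} (hg : g ≠ 0) (h : x' * g = g * x) :
    (‖g‖⁻¹ • g) * x * (‖g‖⁻¹ • g)⁻¹ = x' := by
  have hn : ‖g‖ ≠ 0 := norm_ne_zero_iff.2 hg
  rw [smul_inv₀, inv_inv, smul_mul_assoc, smul_mul_assoc, mul_smul_comm, smul_smul,
    inv_mul_cancel₀ hn, one_smul, ← h, mul_inv_cancel_right₀ hg]

theorem fderiv_quaternion_inv {x : ℍ[ℝ]} (hx : x ≠ 0) (v : ℍ[ℝ]) :
    fderiv ℝ (fun y : ℍ[ℝ] => y⁻¹) x v = -(x⁻¹ * v * x⁻¹) := by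
  rw [(hasFDerivAt_inv' hx).fderiv]
  simp

theorem inv_coeComplex (z : ℂ) : (z : ℍ[ℝ])⁻¹ = ((z⁻¹ : ℂ) : ℍ[ℝ]) :=
  (map_inv₀ Quaternion.ofComplex z).symm

theorem coeComplex_ne_zero {z : ℂ} (hz : z ≠ 0) : (z : ℍ[ℝ]) ≠ 0 := fun h =>
  hz (Quaternion.ofComplex.injective (h.trans (map_zero _).symm))

theorem norm_coeComplex (z : ℂ) : ‖(z : ℍ[ℝ])‖ = ‖z‖ := by
  have h : ‖(z : ℍ[ℝ])‖ * ‖(z : ℍ[ℝ])‖ = ‖z‖ * ‖z‖ := by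
    rw [← Quaternion.normSq_eq_norm_mul_self, Complex.norm_mul_self_eq_normSq,
      Quaternion.normSq_def', Complex.normSq_apply]
    simp
    ring
  exact (mul_self_inj (norm_nonneg _) (norm_nonneg _)).1 h

/-- The rotation by the angle `2 θ` about the axis `k`, applied to a point of `ℂ ⊆ ℍ`. -/
def rotate (z : ℂ) (θ : ℝ) : ℍ[ℝ] :=
  z.re • e 0 + (z.im * Real.cos (2 * θ)) • e 1 + (z.im * Real.sin (2 * θ)) • e 2

theorem rotate_mul (z : ℂ) (θ : ℝ) :
    rotate z θ * (Real.cos θ • e 0 + Real.sin θ • e 3)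
      = (Real.cos θ • e 0 + Real.sin θ • e 3) * (z : ℍ[ℝ]) := by
  have h := Real.sin_sq_add_cos_sq θ
  ext
  · simp [rotate, mul_comm]
  · simp [rotate, Real.cos_two_mul, Real.sin_two_mul]
    linear_combination 2 * z.im * Real.cos θ * h
  · simp [rotate, Real.cos_two_mul, Real.sin_two_mul]
    ring
  · simp [rotate, mul_comm]

theorem cos_add_sin_ne_zero (θ : ℝ) : Real.cos θ • e 0 + Real.sin θ • e 3 ≠ 0 := fun h => by
  have h1 := congrArg (fun q => q.re) h
  have h2 := congrArg (fun q => q.imK) h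
  simp at h1 h2
  simpa [h1, h2] using Real.sin_sq_add_cos_sq θ

theorem hasDerivAt_rotate (z : ℂ) : HasDerivAt (rotate z) ((2 * z.im) • e 2) 0 := by
  have h2 : HasDerivAt (fun θ : ℝ => 2 * θ) 2 0 := by simpa using (hasDerivAt_id (0 : ℝ)).const_mul 2
  have hc := ((h2.cos.const_mul z.im).smul_const (e 1)).const_add (z.re • e 0)
  have hs := (h2.sin.const_mul z.im).smul_const (e 2)
  have hd : (2 * z.im) • e 2 = (z.im * (-Real.sin (2 * 0) * 2)) • e 1
      + (z.im * (Real.cos (2 * 0) * 2)) • e 2 := by simp [mul_comm]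
  rw [hd]
  exact hc.add hs

theorem rotate_zero (z : ℂ) : rotate z 0 = z := by
  ext <;> simp [rotate]

namespace ConnectionS4

variable {C : ConnectionS4}

/-- The transition function of an invariant bundle on the complex plane `ℂ ⊆ ℍ`. -/
def axialTransition (C : ConnectionS4) (z : ℂ) : ℂ := ⟨(C.u z).re, (C.u z).imI⟩

theorem contDiffAt_u (C : ConnectionS4) {x : ℍ[ℝ]} (hx : x ≠ 0) : ContDiffAt ℝ ∞ C.u x :=
  C.smooth_u.contDiffAt (isOpen_ne.mem_nhds hx)

theorem contDiffAt_axialTransition (C : ConnectionS4) {z : ℂ} (hz : z ≠ 0) :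
    ContDiffAt ℝ ∞ C.axialTransition z := by
  have h := (C.contDiffAt_u (coeComplex_ne_zero hz)).comp z contDiff_coeComplex.contDiffAt
  have h1 := reCLM.contDiff.contDiffAt.comp z h
  have h2 := (contDiffAt_const (c := e 1)).inner ℝ h
  have he : C.axialTransition = fun z : ℂ => Complex.equivRealProdCLM.symm
      (reCLM (C.u z), inner ℝ (e 1) (C.u z)) := by
    funext y
    apply Complex.ext
    · rfl
    · simp [axialTransition, inner_e_one]
  rw [he]
  exact Complex.equivRealProdCLM.symm.contDiff.contDiffAt.comp z (h1.prodMk h2)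

namespace IsInvariant

theorem u_mul_eq (hC : C.IsInvariant) {g x x' : ℍ[ℝ]} (hg : g ≠ 0) (hx : x ≠ 0)
    (h : x' * g = g * x) : C.u x' * g = g * C.u x := by
  have hn : ‖g‖ ≠ 0 := norm_ne_zero_iff.2 hg
  have hg' : ‖g‖⁻¹ • g ≠ 0 := smul_ne_zero (inv_ne_zero hn) hg
  have := hC.transition (‖g‖⁻¹ • g) (by rw [norm_smul, norm_inv, norm_norm, inv_mul_cancel₀ hn]) x hx
  rw [conj_eq_of_mul_eq hg h] at this
  have h2 : C.u x' * (‖g‖⁻¹ • g) = (‖g‖⁻¹ • g) * C.u x := by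
    rw [this, inv_mul_cancel_right₀ hg']
  rw [mul_smul_comm, smul_mul_assoc] at h2
  exact smul_right_injective _ (inv_ne_zero hn) h2

/-- As `i` fixes `z` under conjugation, equivariance makes `u z` commute with `i`. -/
theorem u_coeComplex (hC : C.IsInvariant) {z : ℂ} (hz : z ≠ 0) :
    C.u z = (C.axialTransition z : ℍ[ℝ]) := by
  have he : e 1 ≠ 0 := fun h => by simpa using congrArg (fun q => q.imI) h
  have h := hC.u_mul_eq (x := (z : ℍ[ℝ])) (x' := (z : ℍ[ℝ])) he (coeComplex_ne_zero hz)
    (by ext <;> simp)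
  have h1 := congrArg (fun q => q.imJ) h
  have h2 := congrArg (fun q => q.imK) h
  simp at h1 h2
  ext
  · rfl
  · rfl
  · simp; linarith
  · simp; linarith

theorem norm_axialTransition (hC : C.IsInvariant) {z : ℂ} (hz : z ≠ 0) :
    ‖C.axialTransition z‖ = 1 := by
  rw [← norm_coeComplex, ← hC.u_coeComplex hz, C.norm_u _ (coeComplex_ne_zero hz)]

theorem fderiv_u_coeComplex (hC : C.IsInvariant) {z : ℂ} (hz : z ≠ 0) (v : ℂ) :
    fderiv ℝ C.u z v = (fderiv ℝ C.axialTransition z v : ℂ) := by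
  let ι : ℂ →L[ℝ] ℍ[ℝ] := Quaternion.ofComplex.toLinearMap.toContinuousLinearMap
  have h1 : HasFDerivAt (fun y => C.u (ι y)) ((fderiv ℝ C.u (ι z)).comp ι) z :=
    HasFDerivAt.comp z ((C.contDiffAt_u (coeComplex_ne_zero hz)).differentiableAt
      (by simp)).hasFDerivAt ι.hasFDerivAt
  have h2 : HasFDerivAt (fun y => ι (C.axialTransition y))
      (ι.comp (fderiv ℝ C.axialTransition z)) z :=
    HasFDerivAt.comp z ι.hasFDerivAt
      ((C.contDiffAt_axialTransition hz).differentiableAt (by simp)).hasFDerivAt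
  have h3 : (fun y => C.u (ι y)) =ᶠ[𝓝 z] fun y => ι (C.axialTransition y) := by
    filter_upwards [isOpen_ne.mem_nhds hz] with y hy
    exact hC.u_coeComplex hy
  exact DFunLike.congr_fun (h1.unique (h2.congr_of_eventuallyEq h3)) v

/-- Equivariance sends the orbit curve of `z` under rotations about `k` to that of its image.
Differentiating at angle `0` gives the derivative transverse to the slice. -/
theorem fderiv_u_e_two (hC : C.IsInvariant) {z : ℂ} (hz : z ≠ 0) :
    z.im • fderiv ℝ C.u z (e 2) = (C.axialTransition z).im • e 2 := by
  have h0 : rotate z 0 = z := rotate_zero z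
  have h1 : HasDerivAt (fun θ => C.u (rotate z θ)) (fderiv ℝ C.u z ((2 * z.im) • e 2)) 0 := by
    have := ((C.contDiffAt_u (coeComplex_ne_zero hz)).differentiableAt (by simp)).hasFDerivAt
    rw [← h0] at this ⊢
    exact this.comp_hasDerivAt 0 (hasDerivAt_rotate z)
  have h2 : (fun θ => C.u (rotate z θ)) = rotate (C.axialTransition z) := by
    funext θ
    have h3 := hC.u_mul_eq (cos_add_sin_ne_zero θ) (coeComplex_ne_zero hz) (rotate_mul z θ)
    rw [hC.u_coeComplex hz, ← rotate_mul] at h3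
    exact mul_right_cancel₀ (cos_add_sin_ne_zero θ) h3
  rw [h2] at h1
  have h3 := h1.unique (hasDerivAt_rotate _)
  rw [map_smul, mul_smul, mul_smul] at h3
  exact smul_right_injective _ (two_ne_zero (α := ℝ)) h3

theorem form_inv_mul (x : ℍ[ℝ]) (hx : x ≠ 0) (v : ℍ[ℝ]) :
    C.A₁ x⁻¹ (-(x⁻¹ * v * x⁻¹)) * C.u x = C.u x * C.A₀ x v - fderiv ℝ C.u x v := by
  have hu : C.u x ≠ 0 := fun h => by simpa [h] using C.norm_u x hx
  rw [← fderiv_quaternion_inv hx, C.glue x hx, sub_mul, inv_mul_cancel_right₀ hu,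
    inv_mul_cancel_right₀ hu]

/-- Along the slice the terms of the gluing law all lie in `ℂ` and commute, so only the
inhomogeneous term changes the `i`-component. -/
theorem pairForm_inv (hC : C.IsInvariant) {z : ℂ} (hz : z ≠ 0) (v : ℂ) :
    pairForm C.A₁ z⁻¹ (-(z⁻¹ * v * z⁻¹))
      = pairForm C.A₀ z v - 2 * imLogDeriv C.axialTransition z v := by
  have h := form_inv_mul (C := C) z (coeComplex_ne_zero hz) v
  have hw : -((z : ℍ[ℝ])⁻¹ * v * (z : ℍ[ℝ])⁻¹) = ((-(z⁻¹ * v * z⁻¹) : ℂ) : ℍ[ℝ]) := by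
    rw [inv_coeComplex, ← Quaternion.coeComplex_mul, ← Quaternion.coeComplex_mul]
    ext <;> simp
  rw [hw, inv_coeComplex, hC.fderiv_u_coeComplex hz, hC.u_coeComplex hz] at h
  have h0 := (hC.form₀.apply_coeComplex (z := z) trivial).1 v
  have h1 := (hC.form₁.apply_coeComplex (z := z⁻¹) trivial).1 (-(z⁻¹ * v * z⁻¹))
  have r0 := C.imaginary₀ z trivial v
  have r1 := C.imaginary₁ (z⁻¹ : ℂ) trivial (-(z⁻¹ * v * z⁻¹) : ℂ)
  have hn : (C.axialTransition z).re ^ 2 + (C.axialTransition z).im ^ 2 = 1 := by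
    rw [← one_pow 2, ← hC.norm_axialTransition hz, ← Complex.normSq_eq_norm_sq,
      Complex.normSq_apply]
    ring
  have k1 := congrArg (fun q => q.re) h
  have k2 := congrArg (fun q => q.imI) h
  rw [pairForm_apply, pairForm_apply, imLogDeriv_apply]
  generalize -(z⁻¹ * v * z⁻¹) = w at *
  simp [h0.1, h0.2, h1.1, h1.2, r0, r1] at k1 k2 ⊢
  linear_combination 2 * (C.axialTransition z).re * k2 - 2 * (C.axialTransition z).im * k1
    - 2 * ((C.A₁ (z⁻¹ : ℂ) w).imI - (C.A₀ z v).imI) * hn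

theorem pairField_inv (hC : C.IsInvariant) {z : ℂ} (hz : z ≠ 0) :
    pairField C.A₁ z⁻¹ = C.axialTransition z ^ 2 * pairField C.A₀ z := by
  have h := form_inv_mul (C := C) z (coeComplex_ne_zero hz) (e 2)
  have hw : -((z : ℍ[ℝ])⁻¹ * e 2 * (z : ℍ[ℝ])⁻¹) = (-(Complex.normSq z)⁻¹) • e 2 := by
    have := Complex.normSq_inv z
    rw [Complex.normSq_apply] at this
    rw [inv_coeComplex]
    ext <;> simp [-Complex.inv_re, -Complex.inv_im, ← this] <;> ring
  rw [hw, inv_coeComplex, map_smul, hC.u_coeComplex hz] at h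
  have hd := hC.fderiv_u_e_two hz
  have h0 := (hC.form₀.apply_coeComplex (z := z) trivial).2.1
  have h1 := (hC.form₁.apply_coeComplex (z := z⁻¹) trivial).2.1
  have r0 := C.imaginary₀ z trivial (e 2)
  have r1 := C.imaginary₁ (z⁻¹ : ℂ) trivial (e 2)
  have hn : C.axialTransition z * (starRingEnd ℂ) (C.axialTransition z) = 1 := by
    rw [Complex.mul_conj, Complex.normSq_eq_norm_sq, hC.norm_axialTransition hz]
    simp
  have d2 := congrArg (fun q => q.imJ) hd
  have d3 := congrArg (fun q => q.imK) hd
  have k2 := congrArg (fun q => q.imJ) h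
  have k3 := congrArg (fun q => q.imK) h
  simp [h0, h1, r0, r1] at k2 k3 d2
  simp [-mul_eq_zero] at d3
  have hi : z⁻¹.im = -z.im * (Complex.normSq z)⁻¹ := by rw [Complex.inv_im, div_eq_mul_inv]
  have hs : C.axialTransition z - (starRingEnd ℂ) (C.axialTransition z)
      = 2 * (C.axialTransition z).im * Complex.I := by
    apply Complex.ext <;> simp
    ring
  -- This is the gluing law on `j`, with `c` acting on `span (j, k)`. The term `-2 Im c` from `du`
  -- is absorbed by the two shifts by `i`, since `c - c̄ = 2 i Im c`; what is left is `Φ₁ c̄ = c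
  -- Φ₀`.
  have key : (pairField C.A₁ z⁻¹ - Complex.I) * (starRingEnd ℂ) (C.axialTransition z)
      = C.axialTransition z * (pairField C.A₀ z - Complex.I)
        - 2 * (C.axialTransition z).im := by
    apply Complex.ext
    · simp [pairField_re, pairField_im, -Complex.inv_im, hi]
      linear_combination 2 * z.im * k2 - 2 * d2
    · simp [pairField_re, pairField_im, -Complex.inv_im, hi]
      linear_combination 2 * z.im * k3 - 2 * d3
  have hI := Complex.I_mul_I
  linear_combination C.axialTransition z * key - pairField C.A₁ z⁻¹ * hn
    - Complex.I * C.axialTransition z * hs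
    - 2 * C.axialTransition z * (C.axialTransition z).im * hI

theorem inversionRelated (hC : C.IsInvariant) : InversionRelated (pairForm C.A₀) (pairField C.A₀)
    (pairForm C.A₁) (pairField C.A₁) C.axialTransition where
  form₀ := contDiff_pairForm C.smooth₀
  field₀ := contDiff_pairField C.smooth₀
  form₁ := contDiff_pairForm C.smooth₁
  field₁ := contDiff_pairField C.smooth₁
  smooth _ hz := C.contDiffAt_axialTransition hz
  norm_eq _ hz := hC.norm_axialTransition hz
  field_inv _ hz := hC.pairField_inv hz
  form_inv _ hz v := hC.pairForm_inv hz v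

end IsInvariant

end ConnectionS4

/-! ### Invariant connections on the four-sphere -/

section Extension

variable {A B : ℍ[ℝ] → ℍ[ℝ] →L[ℝ] ℍ[ℝ]}

theorem dense_offAxis : Dense offAxis := fun x => by
  by_cases hx : x.im = 0
  · have h : Filter.Tendsto (fun s : ℝ => x + s • e 1) (𝓝[≠] 0) (𝓝 x) := by
      have h1 : Continuous fun s : ℝ => x + s • e 1 := by fun_prop
      have h2 := h1.tendsto 0
      rw [zero_smul, add_zero] at h2
      exact h2.mono_left nhdsWithin_le_nhds
    refine mem_closure_of_tendsto h ?_
    filter_upwards [self_mem_nhdsWithin] with s hs h0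
    rw [Quaternion.im_add, hx, zero_add] at h0
    exact hs (by simpa using congrArg (fun q => q.imI) h0)
  · exact subset_closure hx

theorem curvature_congr (h : Set.EqOn A B offAxis) {x : ℍ[ℝ]} (hx : x ∈ offAxis) :
    curvature A x = curvature B x := by
  have he : A =ᶠ[𝓝 x] B := by
    filter_upwards [isOpen_offAxis.mem_nhds hx] with y hy using h hy
  funext v w
  rw [curvature, curvature, he.fderiv_eq, he.eq_of_nhds]

theorem isSelfDualOn_congr (h : Set.EqOn A B offAxis) :
    IsSelfDualOn A offAxis ↔ IsSelfDualOn B offAxis :=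
  forall₂_congr fun x hx => by rw [curvature_congr h hx]

theorem isAntiSelfDualOn_congr (h : Set.EqOn A B offAxis) :
    IsAntiSelfDualOn A offAxis ↔ IsAntiSelfDualOn B offAxis :=
  forall₂_congr fun x hx => by rw [curvature_congr h hx]

theorem continuous_curvature (h : ContDiff ℝ ∞ A) (v w : ℍ[ℝ]) :
    Continuous fun x => curvature A x v w := by
  have h1 := h.continuous
  have h2 := h.continuous_fderiv (by simp)
  unfold curvature
  fun_prop

theorem continuous_hodgeStar_curvature (h : ContDiff ℝ ∞ A) (v w : ℍ[ℝ]) :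
    Continuous fun x => hodgeStar (curvature A x) v w := by
  have := continuous_curvature h
  unfold hodgeStar
  fun_prop

/-- Both sides of the equation are continuous and the complement of the axis is dense. -/
theorem isSelfDualOn_univ_iff (h : ContDiff ℝ ∞ A) :
    IsSelfDualOn A Set.univ ↔ IsSelfDualOn A offAxis :=
  ⟨fun hA x _ => hA x trivial, fun hA x _ v w => congrFun ((continuous_curvature h v w).ext_on
    dense_offAxis (continuous_hodgeStar_curvature h v w) fun y hy => hA y hy v w) x⟩

theorem isAntiSelfDualOn_univ_iff (h : ContDiff ℝ ∞ A) :
    IsAntiSelfDualOn A Set.univ ↔ IsAntiSelfDualOn A offAxis :=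
  ⟨fun hA x _ => hA x trivial, fun hA x _ v w => congrFun ((continuous_curvature h v w).ext_on
    dense_offAxis (continuous_hodgeStar_curvature h v w).neg fun y hy => hA y hy v w) x⟩

theorem yangMills_congr (h : Set.EqOn A B offAxis) : yangMills A = yangMills B := by
  refine MeasureTheory.lintegral_congr_ae ?_
  filter_upwards [ae_ofCoord_mem_offAxis] with p hp
  rw [curvatureNormSq, curvatureNormSq, curvature_congr h hp]

theorem curvatureWedge_ae_congr (h : Set.EqOn A B offAxis) :
    (fun p : EuclideanSpace ℝ (Fin 4) => curvatureWedge A (ofCoord p))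
      =ᵐ[MeasureTheory.volume] fun p => curvatureWedge B (ofCoord p) := by
  filter_upwards [ae_ofCoord_mem_offAxis] with p hp
  rw [curvatureWedge, curvatureWedge, curvature_congr h hp]

theorem hasSecondChern_congr (h : Set.EqOn A B offAxis) : HasSecondChern A ↔ HasSecondChern B :=
  MeasureTheory.integrable_congr (curvatureWedge_ae_congr h)

theorem secondChern_congr (h : Set.EqOn A B offAxis) : secondChern A = secondChern B := by
  rw [secondChern, secondChern, MeasureTheory.integral_congr_ae (curvatureWedge_ae_congr h)]

theorem IsInvariantOn.mono {U V : Set ℍ[ℝ]} (h : IsInvariantOn A V) (hUV : U ⊆ V) :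
    IsInvariantOn A U := fun g hg x hx => h g hg x (hUV hx)

theorem IsImaginaryOn.mono {U V : Set ℍ[ℝ]} (h : IsImaginaryOn A V) (hUV : U ⊆ V) :
    IsImaginaryOn A U := fun x hx => h x (hUV hx)

theorem eqOn_symConnection_of_univ (hA : IsInvariantOn A Set.univ) (hi : IsImaginaryOn A Set.univ) :
    Set.EqOn A (symConnection (pairForm A) (pairField A)) offAxis :=
  eqOn_symConnection (hA.mono (Set.subset_univ _)) (hi.mono (Set.subset_univ _))

theorem isSelfDualOn_univ_iff_isVortex (hs : ContDiff ℝ ∞ A) (hA : IsInvariantOn A Set.univ)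
    (hi : IsImaginaryOn A Set.univ) :
    IsSelfDualOn A Set.univ ↔ IsVortex (pairForm A) (pairField A) := by
  rw [isSelfDualOn_univ_iff hs, isSelfDualOn_congr (eqOn_symConnection_of_univ hA hi),
    isSelfDualOn_symConnection_iff (isSmoothPair_pair hs.contDiffOn)]

theorem isAntiSelfDualOn_univ_iff_isAntiVortex (hs : ContDiff ℝ ∞ A)
    (hA : IsInvariantOn A Set.univ) (hi : IsImaginaryOn A Set.univ) :
    IsAntiSelfDualOn A Set.univ ↔ IsAntiVortex (pairForm A) (pairField A) := by
  rw [isAntiSelfDualOn_univ_iff hs, isAntiSelfDualOn_congr (eqOn_symConnection_of_univ hA hi),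
    isAntiSelfDualOn_symConnection_iff (isSmoothPair_pair hs.contDiffOn)]

end Extension

theorem conj_inv_mem_halfPlane {z : ℂ} (hz : z ∈ halfPlane) :
    ((starRingEnd ℂ) z)⁻¹ ∈ halfPlane := by
  have h0 : 0 < Complex.normSq z := Complex.normSq_pos.2 fun h => by simp [h, halfPlane] at hz
  change 0 < (((starRingEnd ℂ) z)⁻¹).im
  rw [Complex.inv_im, Complex.conj_im, neg_neg, Complex.normSq_conj]
  exact div_pos hz h0

theorem ne_zero_of_mem_halfPlane {z : ℂ} (hz : z ∈ halfPlane) : z ≠ 0 := fun h => by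
  simp [h, halfPlane] at hz

namespace ConnectionS4.IsInvariant

variable {C : ConnectionS4}

/-- To reach `z` in the second chart, start at `1 / z̄` in the upper half-plane of the first, invert
to `z̄` in the second, and reflect. -/
theorem isSelfDual_iff (hC : C.IsInvariant) :
    C.IsSelfDual ↔ IsVortex (pairForm C.A₀) (pairField C.A₀) := by
  rw [IsSelfDual, isSelfDualOn_univ_iff_isVortex C.smooth₀ hC.form₀ C.imaginary₀,
    isSelfDualOn_univ_iff_isVortex C.smooth₁ hC.form₁ C.imaginary₁, and_iff_left_iff_imp,
    isVortex_iff, isVortex_iff]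
  intro h z hz
  refine vortexAt_conj C.smooth₁ hC.form₁ ?_
  have hz' := conj_inv_mem_halfPlane hz
  rw [← inv_inv ((starRingEnd ℂ) z)]
  exact hC.inversionRelated.vortexAt_inv (ne_zero_of_mem_halfPlane hz') (h _ hz')

theorem isAntiSelfDual_iff (hC : C.IsInvariant) :
    C.IsAntiSelfDual ↔ IsAntiVortex (pairForm C.A₀) (pairField C.A₀) := by
  rw [IsAntiSelfDual, isAntiSelfDualOn_univ_iff_isAntiVortex C.smooth₀ hC.form₀ C.imaginary₀,
    isAntiSelfDualOn_univ_iff_isAntiVortex C.smooth₁ hC.form₁ C.imaginary₁, and_iff_left_iff_imp,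
    isAntiVortex_iff, isAntiVortex_iff]
  intro h z hz
  refine antiVortexAt_conj C.smooth₁ hC.form₁ ?_
  have hz' := conj_inv_mem_halfPlane hz
  rw [← inv_inv ((starRingEnd ℂ) z)]
  exact hC.inversionRelated.antiVortexAt_inv (ne_zero_of_mem_halfPlane hz') (h _ hz')

theorem hasFirstChern (hC : C.IsInvariant) : HasFirstChern (pairForm C.A₀) := by
  have h := hC.inversionRelated.integrable_curlAt.integrableOn (s := halfPlane)
  exact (MeasureTheory.Integrable.ofReal h).const_mul Complex.I

theorem currentVanishesAtInfinity (hC : C.IsInvariant) :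
    CurrentVanishesAtInfinity (pairForm C.A₀) (pairField C.A₀) :=
  hC.inversionRelated.currentVanishesAtInfinity (covDeriv_ofReal_eq_zero C.smooth₀ hC.form₀)
    (covDeriv_ofReal_eq_zero C.smooth₁ hC.form₁)

theorem exists_pair (hC : C.IsInvariant) :
    ∃ (a : ℂ → ℂ →L[ℝ] ℝ) (Φ : ℂ → ℂ), IsSmoothPair a Φ ∧
      Set.EqOn C.A₀ (symConnection a Φ) offAxis ∧
      (C.IsSelfDual ↔ IsVortex a Φ) ∧ (C.IsAntiSelfDual ↔ IsAntiVortex a Φ) ∧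
      yangMills C.A₀ = ENNReal.ofReal Real.pi * yangMillsHiggs a Φ ∧
      HasSecondChern C.A₀ ∧ HasFirstChern a ∧ CurrentVanishesAtInfinity a Φ ∧
      (secondChern C.A₀ : ℂ) = firstChern a := by
  have he := eqOn_symConnection_of_univ hC.form₀ C.imaginary₀
  have hs := isSmoothPair_pair C.smooth₀.contDiffOn
  have h2 := (hasSecondChern_symConnection_iff hs).2
    hC.inversionRelated.integrable_wedgeDensity.integrableOn
  refine ⟨pairForm C.A₀, pairField C.A₀, hs, he, hC.isSelfDual_iff, hC.isAntiSelfDual_iff, ?_,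
    (hasSecondChern_congr he).2 h2, hC.hasFirstChern, hC.currentVanishesAtInfinity, ?_⟩
  · rw [yangMills_congr he, yangMills_symConnection hs]
  · rw [secondChern_congr he]
    exact secondChern_eq_firstChern hs h2 hC.hasFirstChern hC.currentVanishesAtInfinity

end ConnectionS4.IsInvariant

end DimRed

end

theorem mainTheorem7 :
    -- The invariant connections off the fixed circle are exactly the symmetric ones.
    (∀ A : ℍ[ℝ] → ℍ[ℝ] →L[ℝ] ℍ[ℝ],
      (ContDiffOn ℝ ∞ A DimRed.offAxis ∧ DimRed.IsImaginaryOn A DimRed.offAxis ∧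
          DimRed.IsInvariantOn A DimRed.offAxis) ↔
        ∃ (a : ℂ → ℂ →L[ℝ] ℝ) (Φ : ℂ → ℂ), DimRed.IsSmoothPair a Φ ∧
          Set.EqOn A (DimRed.symConnection a Φ) DimRed.offAxis) ∧
    -- The pair is determined by the connection.
    (∀ (a a' : ℂ → ℂ →L[ℝ] ℝ) (Φ Φ' : ℂ → ℂ),
      Set.EqOn (DimRed.symConnection a Φ) (DimRed.symConnection a' Φ') DimRed.offAxis →
        Set.EqOn a a' DimRed.halfPlane ∧ Set.EqOn Φ Φ' DimRed.halfPlane) ∧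
    -- The reduction off the fixed circle.
    (∀ (a : ℂ → ℂ →L[ℝ] ℝ) (Φ : ℂ → ℂ), DimRed.IsSmoothPair a Φ →
      (DimRed.IsSelfDualOn (DimRed.symConnection a Φ) DimRed.offAxis ↔ DimRed.IsVortex a Φ) ∧
      (DimRed.IsAntiSelfDualOn (DimRed.symConnection a Φ) DimRed.offAxis ↔
        DimRed.IsAntiVortex a Φ) ∧
      DimRed.yangMills (DimRed.symConnection a Φ)
        = ENNReal.ofReal Real.pi * DimRed.yangMillsHiggs a Φ ∧
      (DimRed.HasSecondChern (DimRed.symConnection a Φ) → DimRed.HasFirstChern a →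
        DimRed.CurrentVanishesAtInfinity a Φ →
        (DimRed.secondChern (DimRed.symConnection a Φ) : ℂ) = DimRed.firstChern a)) ∧
    -- The reduction for invariant connections on the whole of the four-sphere.
    (∀ C : DimRed.ConnectionS4, C.IsInvariant →
      ∃ (a : ℂ → ℂ →L[ℝ] ℝ) (Φ : ℂ → ℂ), DimRed.IsSmoothPair a Φ ∧
        Set.EqOn C.A₀ (DimRed.symConnection a Φ) DimRed.offAxis ∧
        (C.IsSelfDual ↔ DimRed.IsVortex a Φ) ∧
        (C.IsAntiSelfDual ↔ DimRed.IsAntiVortex a Φ) ∧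
        DimRed.yangMills C.A₀ = ENNReal.ofReal Real.pi * DimRed.yangMillsHiggs a Φ ∧
        DimRed.HasSecondChern C.A₀ ∧ DimRed.HasFirstChern a ∧
        DimRed.CurrentVanishesAtInfinity a Φ ∧
        (DimRed.secondChern C.A₀ : ℂ) = DimRed.firstChern a) := by
  exact ⟨DimRed.invariant_iff_exists_pair, DimRed.pair_unique, fun a Φ h =>
    ⟨DimRed.isSelfDualOn_symConnection_iff h, DimRed.isAntiSelfDualOn_symConnection_iff h,
      DimRed.yangMills_symConnection h, DimRed.secondChern_eq_firstChern h⟩,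
    fun _ hC => hC.exists_pair⟩
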